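/- **Setting.** Consider rank-3 real tensors with symmetry $O(N)^3$ (colours red, green, blue) and two sextic interactions, given by labelled interaction graphs on the fields $1,\dots,6$. The *prism* has red edges $16,23,45$, green edges $12,34,56$ and blue edges $13,25,46$. The *wheel* ($K_{3,3}$) has red edges $16,23,45$, green edges $12,34,56$ and blue edges $14,25,36$. A *colour permutation symmetry* of an interaction is a permutation of its fields that carries the edges of each colour $c$ to those of $\pi(c)$ for some permutation $\pi$ of the colours; it is an *automorphism* if $\pi=1$. A *free-energy diagram* is either the *0-cycle* (one closed propagator, no interaction vertex, three index loops), or a nonempty finite set of interaction vertices, each a prism or a wheel, with a complete Wick contraction of their fields (a pairing of all the fields) that makes the diagram connected. Diagrams are identified up to renaming vertices and relabelling the fields of each vertex by automorphisms. An index loop of colour $c$ is a closed line alternating between Wick contractions and edges of colour $c$ inside vertices; $f_{tot}$ is the total number of index loops of all three colours (the power of $N$). A free-energy diagram is *maximal* if its $f_{tot}$ is the largest among all free-energy diagrams with the same number of interaction vertices. **Cycles.** A *1-cycle* $\langle X,Y\rangle$ at a vertex is a contraction of its fields $X$ and $Y$. A *mixed 2-cycle* $(\langle X_L,Y_R\rangle,\langle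 Z_L,W_R\rangle)$ consists of two distinct contractions, of field $X$ of a prism vertex $L$ with field $Y$ of a wheel vertex $R$, and of field $Z$ of $L$ with field $W$ of $R$. Two mixed 2-cycles are *equivalent* if they are related by a colour permutation acting on both vertices simultaneously, together with automorphisms acting on each vertex independently. The *snail pairing* is $\{16,25,34\}$ for the prism and, for the wheel, $\{12,36,45\}$ or its image under an automorphism. Two legs are *joined* if they are contracted with each other or are the two external legs of a subgraph with exactly two external legs, which does not contain the vertices of the cycle. A 1-cycle $\langle X,Y\rangle$ has *snail form* if $XY$ is a pair of a snail pairing of its vertex and the other two pairs are joined. A mixed 2-cycle is a *double snail* if $XZ$ is a pair of a snail pairing of $L$ whose other two pairs are joined, and $YW$ is a pair of a snail pairing of $R$ whose other two pairs are joined. It *yields an elementary melon* if the other four legs of $L$ are joined one-to-one with the other four legs of $R$. **Moves.** The *prism moves* are: replacing a propagator by an elementary snail (the one-vertex diagram with contractions $16,25,34$, with any one of its propagators cut); replacing a propagator by an elementary melon (two prisms, each field of one contracted with the same field of the other, with any one propagator cut); and vertex expansion, which replaces a prism vertex $P$ by two prism vertices $L,R$ with $\langle i_L,i_R\rangle$ contracted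 for $i=1,2,3$, where fields $1,2,3$ of $P$ become $6_L,5_L,4_L$ and fields $4,5,6$ of $P$ become $4_R,5_R,6_R$. The *wheel moves* are: replacing a propagator by an elementary snail (contractions $12,36,45$, any propagator cut), or by an elementary melon (two wheels, each field contracted with the same field of the other, any propagator cut). **Theorem.** In the theory with both the prism and the wheel interaction: 1. Every mixed 2-cycle $(\langle X_L,Y_R\rangle,\langle Z_L,W_R\rangle)$ with $X\ne Z$, $Y\ne W$ falls, up to equivalence, under exactly one of the following forms: (1) $(\langle 1_L,1_R\rangle,\langle 2_L,W_R\rangle)$ for some $W$; (2) $(\langle 1_L,1_R\rangle,\langle 4_L,W_R\rangle)$ for some $W$; (3) $(\langle 1_L,1_R\rangle,\langle 6_L,2_R\rangle)$; (4) $(\langle 1_L,1_R\rangle,\langle 6_L,3_R\rangle)$; (5) $(\langle 1_L,1_R\rangle,\langle 6_L,6_R\rangle)$. 2. Every 1-cycle in a maximal diagram has snail form. 3. Every mixed 2-cycle in a maximal diagram is equivalent to form (3) or (5), and is a double snail; it yields no elementary melon. (In particular forms (1), (2), (4) do not occur in maximal diagrams.) 4. Every mixed 2-cycle equivalent to form (3)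 or (5) occurs in some maximal diagram. 5. A diagram is maximal if and only if it can be generated from the 0-cycle by finitely many prism moves and wheel moves. -/

import Mathlib

namespace PrismWheel

open Equiv

/-- The three colours, one for each factor of the symmetry group `O(N)³`. -/
inductive Colour
  | red
  | green
  | blue
  deriving DecidableEq

instance : Fintype Colour :=
  ⟨{.red, .green, .blue}, fun c => by cases c <;> simp⟩

/-- The two sextic maximally-single-trace interactions of rank-3 tensors. -/
inductive Interaction
  | prism
  | wheel
  deriving DecidableEq

instance : Fintype Interaction :=
  ⟨{.prism, .wheel}, fun k => by cases k <;> simp⟩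

open Colour Interaction

/-- Labels of the six field-vertices of an interaction. Labels are read modulo `6`, so that the
literals `1, 2, 3, 4, 5, 6` are the six labels used in the literature. -/
abbrev Field6 : Type := Fin 6

/-- The labelled interaction graphs: `edge k c` exchanges the end points of each edge of
colour `c` in the interaction graph of `k`. -/
def edge : Interaction → Colour → Perm Field6
  | prism, red => swap 1 6 * swap 2 3 * swap 4 5
  | prism, green => swap 1 2 * swap 3 4 * swap 5 6
  | prism, blue => swap 1 3 * swap 2 5 * swap 4 6
  | wheel, red => swap 1 6 * swap 2 3 * swap 4 5
  | wheel, green => swap 1 2 * swap 3 4 * swap 5 6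
  | wheel, blue => swap 1 4 * swap 2 5 * swap 3 6

/-- `α` is a colour permutation symmetry of the interaction `k`, inducing the permutation `π` of
the colours: it carries the edges of colour `c` to the edges of colour `π c`. -/
def IsColourSymmetry (k : Interaction) (π : Perm Colour) (α : Perm Field6) : Prop :=
  ∀ c, α * edge k c * α⁻¹ = edge k (π c)

/-- Automorphisms of an interaction: the symmetries that keep every colour. -/
def IsAutomorphism (k : Interaction) (α : Perm Field6) : Prop :=
  IsColourSymmetry k 1 α

/-! ### Vacuum Feynman diagrams -/

/-- A Feynman diagram without external legs in the theory with both interactions. A half-edge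
`(v, i)` is the field labelled `i` of the interaction vertex `v`; `wick` is the complete Wick
contraction. A propagator closed on itself, with no interaction vertex on it, is not visible in the
half-edges; `circles` is the number of these. -/
structure Diagram where
  V : Type
  finite : Finite V
  kind : V → Interaction
  wick : V × Field6 → V × Field6
  wick_wick : ∀ h, wick (wick h) = h
  wick_ne : ∀ h, wick h ≠ h
  circles : ℕ

namespace Diagram

/-- The number of interaction vertices. -/
noncomputable def numVertices (D : Diagram) : ℕ := Nat.card D.V

/-- Two half-edges are consecutive on a line of colour `c` of the multi-line diagram if they are
Wick contracted or are joined by an edge of colour `c` inside an interaction vertex. -/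
def Consecutive (D : Diagram) (c : Colour) (h h' : D.V × Field6) : Prop :=
  h' = D.wick h ∨ h' = (h.1, edge (D.kind h.1) c h.2)

/-- The closed loops of colour `c` that pass through some interaction vertex. -/
def Loop (D : Diagram) (c : Colour) : Type := Quot (D.Consecutive c)

/-- The total number of index loops, that is the exponent of `N`. A circle carries one loop
of each colour. -/
noncomputable def fTotal (D : Diagram) : ℕ :=
  Nat.card (D.Loop red) + Nat.card (D.Loop green) + Nat.card (D.Loop blue) + 3 * D.circles

/-- Two interaction vertices are adjacent if a field of one is contracted with a field of the
other. -/
def Adj (D : Diagram) (u v : D.V) : Prop := ∃ i j, D.wick (u, i) = (v, j)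

/-- The diagram with no interaction vertices: a single closed propagator. -/
def IsZeroCycle (D : Diagram) : Prop := IsEmpty D.V ∧ D.circles = 1

/-- Connected vacuum diagrams, i.e. those that contribute to the free energy. -/
def Connected (D : Diagram) : Prop :=
  D.IsZeroCycle ∨
    (Nonempty D.V ∧ D.circles = 0 ∧ ∀ u v : D.V, Relation.ReflTransGen D.Adj u v)

/-- A maximal diagram contributes to the free energy and has the largest number of index loops
among all such diagrams with as many interaction vertices. -/
def IsMaximal (D : Diagram) : Prop :=
  D.Connected ∧
    ∀ D' : Diagram, D'.Connected → D'.numVertices = D.numVertices → D'.fTotal ≤ D.fTotal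

/-- `D` and `D'` are the same diagram: they differ by the names of the interaction vertices and by
relabelling the fields of each vertex by an automorphism of its interaction. -/
def Same (D D' : Diagram) : Prop :=
  D'.circles = D.circles ∧
    ∃ (φ : D.V ≃ D'.V) (α : D.V → Perm Field6),
      (∀ v, D'.kind (φ v) = D.kind v) ∧ (∀ v, IsAutomorphism (D.kind v) (α v)) ∧
      ∀ h : D.V × Field6,
        D'.wick (φ h.1, α h.1 h.2) = (φ (D.wick h).1, α (D.wick h).1 (D.wick h).2)

end Diagram

/-! ### Melonic moves -/

/-- The contractions of the elementary snail closed to a vacuum diagram with one vertex. -/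
def snailPairing : Interaction → Perm Field6
  | prism => swap 1 6 * swap 2 5 * swap 3 4
  | wheel => swap 1 2 * swap 3 6 * swap 4 5

theorem snailPairing_snailPairing (k : Interaction) (i : Field6) :
    snailPairing k (snailPairing k i) = i := by
  revert k i; decide

theorem snailPairing_ne (k : Interaction) (i : Field6) : snailPairing k i ≠ i := by
  revert k i; decide

/-- The vacuum diagram that yields the elementary snail when one of its propagators is cut. -/
def closedSnail (k : Interaction) : Diagram where
  V := Unit
  finite := inferInstance
  kind := fun _ => k
  wick := fun h => (h.1, snailPairing k h.2)
  wick_wick := fun h => Prod.ext rfl (snailPairing_snailPairing k h.2)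
  wick_ne := fun h e => snailPairing_ne k h.2 (congrArg Prod.snd e)
  circles := 0

/-- The vacuum diagram that yields the elementary melons when one of its propagators is cut: two
vertices of the same kind, each field of one contracted with the same field of the other. -/
def closedMelon (k : Interaction) : Diagram where
  V := Bool
  finite := inferInstance
  kind := fun _ => k
  wick := fun h => (!h.1, h.2)
  wick_wick := fun h => Prod.ext (Bool.not_not h.1) rfl
  wick_ne := fun h e => Bool.not_ne_self h.1 (congrArg Prod.fst e)
  circles := 0

/-- `D'` arises from `D` by replacing one propagator of `D` by the diagram with two external legs
that is obtained by cutting a propagator of the vacuum diagram `E` (which has no circles). The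
propagator of `D` is either the contraction `{h, wick h}` or a circle. In the first case `h` and
`wick h` get contracted with the two ends of the cut propagator `{a, wick a}` of `E`; in the second
case the cut is closed again. -/
def ReplacesPropagator (E D D' : Diagram) : Prop :=
  ∃ φ : D.V ⊕ E.V ≃ D'.V,
    (∀ v, D'.kind (φ (Sum.inl v)) = D.kind v) ∧
    (∀ v, D'.kind (φ (Sum.inr v)) = E.kind v) ∧
    ((D'.circles = D.circles ∧ ∃ (h : D.V × Field6) (a : E.V × Field6),
        D'.wick (φ (Sum.inl h.1), h.2) = (φ (Sum.inr a.1), a.2) ∧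
        D'.wick (φ (Sum.inl (D.wick h).1), (D.wick h).2) =
          (φ (Sum.inr (E.wick a).1), (E.wick a).2) ∧
        (∀ k, k ≠ h → k ≠ D.wick h →
          D'.wick (φ (Sum.inl k.1), k.2) = (φ (Sum.inl (D.wick k).1), (D.wick k).2)) ∧
        (∀ b, b ≠ a → b ≠ E.wick a →
          D'.wick (φ (Sum.inr b.1), b.2) = (φ (Sum.inr (E.wick b).1), (E.wick b).2))) ∨
     (D'.circles + 1 = D.circles ∧
        (∀ k, D'.wick (φ (Sum.inl k.1), k.2) = (φ (Sum.inl (D.wick k).1), (D.wick k).2)) ∧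
        (∀ b, D'.wick (φ (Sum.inr b.1), b.2) = (φ (Sum.inr (E.wick b).1), (E.wick b).2))))

open Classical in
/-- Where the half-edges of a diagram go when its vertex `P` is expanded into the two vertices
`none` (the left one) and `some P` (the right one): the fields `1, 2, 3` of `P` become the
fields `6, 5, 4` of the left vertex, the fields `4, 5, 6` of `P` those of the right vertex. -/
noncomputable def expandLeg {V : Type} (P : V) (h : V × Field6) : Option V × Field6 :=
  if h.1 = P ∧ h.2 = 1 then (none, 6)
  else if h.1 = P ∧ h.2 = 2 then (none, 5)
  else if h.1 = P ∧ h.2 = 3 then (none, 4)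
  else (some h.1, h.2)

/-- Vertex expansion: a prism vertex of `D` is replaced by two prism vertices whose
fields `1, 2, 3` are contracted with each other. -/
def ExpandsVertex (D D' : Diagram) : Prop :=
  ∃ (P : D.V) (φ : Option D.V ≃ D'.V),
    D.kind P = prism ∧ D'.circles = D.circles ∧
    D'.kind (φ none) = prism ∧ (∀ v, D'.kind (φ (some v)) = D.kind v) ∧
    (∀ i : Field6, i = 1 ∨ i = 2 ∨ i = 3 → D'.wick (φ none, i) = (φ (some P), i)) ∧
    ∀ h : D.V × Field6,
      D'.wick (φ (expandLeg P h).1, (expandLeg P h).2) =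
        (φ (expandLeg P (D.wick h)).1, (expandLeg P (D.wick h)).2)

/-- The melonic moves of the theory with the prism interaction only. -/
def PrismMove (D D' : Diagram) : Prop :=
  ReplacesPropagator (closedSnail prism) D D' ∨ ReplacesPropagator (closedMelon prism) D D' ∨
    ExpandsVertex D D'

/-- The melonic moves of the theory with the wheel interaction only. -/
def WheelMove (D D' : Diagram) : Prop :=
  ReplacesPropagator (closedSnail wheel) D D' ∨ ReplacesPropagator (closedMelon wheel) D D'

/-- The diagrams generated from the 0-cycle by the melonic moves of the prism theory and of the
wheel theory. -/
inductive Melonic : Diagram → Prop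
  | zeroCycle (D : Diagram) : D.IsZeroCycle → Melonic D
  | prismMove (D D' : Diagram) : Melonic D → PrismMove D D' → Melonic D'
  | wheelMove (D D' : Diagram) : Melonic D → WheelMove D D' → Melonic D'
  | same (D D' : Diagram) : Melonic D → D.Same D' → Melonic D'

/-! ### Cycles -/

namespace Diagram

/-- Once the vertices in `A` are taken out, the legs `h` and `h'` are the two external legs of a
subgraph with exactly these two external legs (`S` is the set of its vertices), or are directly
contracted with each other (`S` is empty). -/
def Joined (D : Diagram) (A : Set D.V) (h h' : D.V × Field6) : Prop :=
  ∃ S : Set D.V, Disjoint S A ∧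
    ∀ k : D.V × Field6, (k.1 ∈ S ∨ k = h ∨ k = h') →
      ((D.wick k).1 ∈ S ∨ D.wick k = h ∨ D.wick k = h')

end Diagram

/-- The pairings of the fields of an interaction as in the elementary snail, up to
automorphisms. -/
def IsSnailPairing (k : Interaction) (s : Perm Field6) : Prop :=
  ∃ α, IsAutomorphism k α ∧ s = α * snailPairing k * α⁻¹

namespace Diagram

/-- A 1-cycle through the vertex `v`: its fields `x` and `y` are contracted. -/
def IsOneCycle (D : Diagram) (v : D.V) (x y : Field6) : Prop := D.wick (v, x) = (v, y)

/-- The diagram has the form of an elementary snail at `v` with one propagator `⟨x, y⟩`, the other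
two propagators being replaced by subgraphs with two external legs. -/
def IsSnailForm (D : Diagram) (v : D.V) (x y : Field6) : Prop :=
  ∃ s, IsSnailPairing (D.kind v) s ∧ s x = y ∧
    ∀ i, i ≠ x → i ≠ y → D.Joined {v} (v, i) (v, s i)

/-- A 2-cycle `(⟨x_L, y_R⟩, ⟨z_L, w_R⟩)` through a prism vertex `L` and a wheel vertex `R`. -/
def IsMixedTwoCycle (D : Diagram) (L R : D.V) (x y z w : Field6) : Prop :=
  D.kind L = prism ∧ D.kind R = wheel ∧ x ≠ z ∧
    D.wick (L, x) = (R, y) ∧ D.wick (L, z) = (R, w)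

/-- The 2-cycle comes from the insertion of two elementary snails, at `L` with external
legs `x, z` and at `R` with external legs `y, w`: the other four legs of `L` are joined in pairs as
in a snail, by subgraphs with two external legs, and so are the other four legs of `R`. -/
def IsDoubleSnail (D : Diagram) (L R : D.V) (x y z w : Field6) : Prop :=
  (∃ s, IsSnailPairing (D.kind L) s ∧ s x = z ∧
    ∀ i, i ≠ x → i ≠ z → D.Joined {L, R} (L, i) (L, s i)) ∧
  ∃ s, IsSnailPairing (D.kind R) s ∧ s y = w ∧
    ∀ i, i ≠ y → i ≠ w → D.Joined {L, R} (R, i) (R, s i)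

/-- The 2-cycle yields an elementary melon: the other four legs of `L` are joined one by one to the
other four legs of `R`, by subgraphs with two external legs. -/
def IsMelonForm (D : Diagram) (L R : D.V) (x y z w : Field6) : Prop :=
  ∃ ρ : Perm Field6, ρ x = y ∧ ρ z = w ∧
    ∀ i, i ≠ x → i ≠ z → D.Joined {L, R} (L, i) (R, ρ i)

end Diagram

/-- Equivalence of mixed 2-cycles `(⟨x_L, y_R⟩, ⟨z_L, w_R⟩)`, `(⟨x'_L, y'_R⟩, ⟨z'_L, w'_R⟩)`: colour
permutations act on both vertices simultaneously, automorphisms on each vertex independently. -/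
def EquivalentMixed (x y z w x' y' z' w' : Field6) : Prop :=
  ∃ (π : Perm Colour) (α β : Perm Field6),
    IsColourSymmetry prism π α ∧ IsColourSymmetry wheel π β ∧
      α x = x' ∧ β y = y' ∧ α z = z' ∧ β w = w'

/-- The five forms of mixed 2-cycles:
`(⟨1,1⟩, ⟨2,W⟩)`, `(⟨1,1⟩, ⟨4,W⟩)`, `(⟨1,1⟩, ⟨6,2⟩)`, `(⟨1,1⟩, ⟨6,3⟩)`, `(⟨1,1⟩, ⟨6,6⟩)`,
with the prism field first in each contraction. -/
inductive MixedForm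
  | form1
  | form2
  | form3
  | form4
  | form5

/-- The mixed 2-cycle `(⟨x_L, y_R⟩, ⟨z_L, w_R⟩)` is equivalent to one of the given form. -/
def HasForm (x y z w : Field6) : MixedForm → Prop
  | .form1 => ∃ W, EquivalentMixed x y z w 1 1 2 W
  | .form2 => ∃ W, EquivalentMixed x y z w 1 1 4 W
  | .form3 => EquivalentMixed x y z w 1 1 6 2
  | .form4 => EquivalentMixed x y z w 1 1 6 3
  | .form5 => EquivalentMixed x y z w 1 1 6 6

end PrismWheel

/-! In the prism and in the wheel the edges of any two colours form one hexagon. The index loops of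
two colours `a`, `b` are therefore the faces of a ribbon graph with `V` vertices and `3V`
propagators, and Euler's inequality reads `F_a + F_b ≤ 2V + 2` (`euler_bound`, by linear algebra
over `ZMod 2`, also for subdiagrams with legs). Adding the three pairs of colours gives `f_tot ≤ 3V
+ 3`. Rings of prism snails reach this bound, so a diagram with vertices is maximal exactly if it is
connected, has no circles and has `V + 1` loops of each colour (`IsPlanar`).

The main tool is `IsPlanar.bond`. If a planar diagram is split into two connected sides, the Euler
bounds of both sides add up to the total, so all of them are equalities. Hence the number of legs is
`2m` with `m` odd, the loops inside each side are counted exactly, and each loop that crosses uses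
exactly two legs. In particular a component left after removing a connected vertex set has two legs
or at least six.

For one vertex this gives a dichotomy (`isRegular_or_snail`): either every loop passes the vertex at
most once (regular), or its legs are joined in pairs by two-point subgraphs, and counting loops
shows that this pairing shares an edge with every colour, hence is a snail pairing. A regular vertex
admits no 1-cycle, which settles 1-cycles. For a 2-cycle between regular vertices
(`IsPlanar.two_cycle`) either all legs of `L` and `R` are joined by a colour-preserving isomorphism,
or three of them are, along a triangle of both graphs. The prism is not isomorphic to the wheel and
the wheel is bipartite, so a mixed 2-cycle can only run between two snail vertices. Its two pairs of
fields then belong to snail pairings, which characterizes forms (3) and (5); inserting a wheel snail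
into a prism snail realizes all of these.

The moves preserve maximality because they add as many loops as the bound allows. Conversely, take a
smallest nonempty vertex set `S` with at most two legs (`IsMaximal.isReducible`). If it contains a
snail vertex, minimality turns all but one of the joined pairs into direct contractions, and a snail
can be removed. Otherwise all its vertices are regular, a count of half-edges yields a loop of
length two, and the 2-cycle is a melon or the result of a vertex expansion. Induction on the number
of vertices concludes. The five forms are found by normalizing with explicit symmetries and told
apart by the invariant `mixedForm`. -/

namespace PrismWheel

open Equiv Colour Interaction

/-! ### Interaction graphs -/

theorem edge_edge (k : Interaction) (c : Colour) (i : Field6) : edge k c (edge k c i) = i := by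
  revert k c i; decide

theorem edge_ne (k : Interaction) (c : Colour) (i : Field6) : edge k c i ≠ i := by
  revert k c i; decide

theorem edge_ne_edge (k : Interaction) {a b : Colour} (hab : a ≠ b) (i : Field6) :
    edge k a i ≠ edge k b i := by
  revert k a b i; decide

/-- The edges of two colours form a hexagon. -/
theorem edge_hexagon (k : Interaction) {a b : Colour} (hab : a ≠ b) (i j : Field6) :
    j = i ∨ j = edge k a i ∨ j = edge k b i ∨ j = edge k b (edge k a i) ∨
      j = edge k a (edge k b i) ∨ j = edge k a (edge k b (edge k a i)) := by
  revert k a b i j; decide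

/-! ### Parity of sets with an involution -/

theorem even_ncard_of_involution {α : Type*} [Finite α] {T : Set α} (f : α → α)
    (hf : ∀ x ∈ T, f x ∈ T) (hff : ∀ x ∈ T, f (f x) = x) (hne : ∀ x ∈ T, f x ≠ x) :
    Even T.ncard := by
  classical
  have : Fintype α := Fintype.ofFinite α
  have h : ∑ x ∈ T.toFinset, (1 : ZMod 2) = 0 :=
    Finset.sum_involution (fun x _ => f x) (fun _ _ => by decide)
      (fun x hx _ => hne x (by simpa using hx)) (fun x hx => by simpa using hf x (by simpa using hx))
      (fun x hx => hff x (by simpa using hx))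
  rw [Set.ncard_eq_toFinset_card', ← ZMod.natCast_eq_zero_iff_even]
  simpa using h

/-- A finite set cannot carry a fixed-point-free involution if it does after removing a point. -/
theorem false_of_involutions {α : Type*} [Finite α] {T : Set α} {a : α} (ha : a ∈ T) (f g : α → α)
    (hf : ∀ x ∈ T, f x ∈ T) (hff : ∀ x, f (f x) = x) (hne : ∀ x, f x ≠ x)
    (hg : ∀ x ∈ T, x ≠ a → g x ∈ T ∧ g x ≠ a) (hgg : ∀ x, g (g x) = x) (hgne : ∀ x, g x ≠ x) :
    False := by
  have h1 := even_ncard_of_involution f hf (fun x _ => hff x) (fun x _ => hne x)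
  have h2 : Even (T \ {a}).ncard := even_ncard_of_involution g
    (fun x hx => hg x hx.1 hx.2) (fun x _ => hgg x) (fun x _ => hgne x)
  have h3 := Set.ncard_sdiff_singleton_add_one ha
  rw [← h3] at h1
  exact (Nat.even_add_one.1 h1) h2

/-! ### Index loops and the Euler bound for two colours -/

namespace Diagram

variable (D : Diagram)

instance : Finite D.V := D.finite

/-- The other end of the edge of colour `c` at a half-edge. -/
def inner (c : Colour) (h : D.V × Field6) : D.V × Field6 := (h.1, edge (D.kind h.1) c h.2)

/-- The index loop of colour `c` through a half-edge. -/
def loop (c : Colour) (h : D.V × Field6) : D.Loop c := Quot.mk _ h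

variable {D}

theorem inner_inner (c : Colour) (h : D.V × Field6) : D.inner c (D.inner c h) = h :=
  Prod.ext rfl (edge_edge _ _ _)

theorem inner_ne (c : Colour) (h : D.V × Field6) : D.inner c h ≠ h :=
  fun e => edge_ne _ _ _ (congrArg Prod.snd e)

theorem wick_injective : Function.Injective D.wick :=
  (show Function.Involutive D.wick from D.wick_wick).injective

theorem loop_wick (c : Colour) (h : D.V × Field6) : D.loop c (D.wick h) = D.loop c h :=
  (Quot.sound (r := D.Consecutive c) (Or.inl rfl)).symm

theorem loop_inner (c : Colour) (h : D.V × Field6) : D.loop c (D.inner c h) = D.loop c h :=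
  (Quot.sound (r := D.Consecutive c) (Or.inr rfl)).symm

theorem loop_edge (c : Colour) (v : D.V) (i : Field6) :
    D.loop c (v, edge (D.kind v) c i) = D.loop c (v, i) := D.loop_inner c (v, i)

theorem loop_surjective (c : Colour) : Function.Surjective (D.loop c) := Quot.mk_surjective

instance (c : Colour) : Finite (D.Loop c) := Finite.of_surjective _ (D.loop_surjective c)

/-- A set of half-edges closed under contractions and edges of colour `c` is a union of loops. -/
theorem mem_of_loop_eq {c : Colour} {T : Set (D.V × Field6)} (hw : ∀ h ∈ T, D.wick h ∈ T)
    (he : ∀ h ∈ T, D.inner c h ∈ T) {h h' : D.V × Field6} (hh : D.loop c h = D.loop c h')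
    (hT : h ∈ T) : h' ∈ T := by
  let p : D.Loop c → Prop := Quot.lift (· ∈ T) (by
    rintro k _ (rfl | rfl)
    · exact propext ⟨hw k, fun h => by simpa [D.wick_wick] using hw _ h⟩
    · exact propext ⟨he k, fun h => by
        have := he _ h
        rwa [show D.inner c (k.1, edge (D.kind k.1) c k.2) = k from D.inner_inner c k] at this⟩)
  have : p (D.loop c h) = p (D.loop c h') := by rw [hh]
  exact (show (h ∈ T) = (h' ∈ T) from this) ▸ hT

/-- The half-edges of a vertex set that are contracted with half-edges outside. -/
def legs (D : Diagram) (S : Set D.V) : Set (D.V × Field6) := {h | h.1 ∈ S ∧ (D.wick h).1 ∉ S}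

/-- The loops of colour `c` that stay in a vertex set. -/
def innerLoops (D : Diagram) (c : Colour) (S : Set D.V) : Set (D.Loop c) :=
  {l | ∀ h, D.loop c h = l → h.1 ∈ S}

/-- The subdiagram on a vertex set is connected. -/
def IsConn (D : Diagram) (S : Set D.V) : Prop :=
  S.Nonempty ∧ ∀ T ⊆ S, T.Nonempty →
    (∀ h : D.V × Field6, h.1 ∈ T → (D.wick h).1 ∈ S → (D.wick h).1 ∈ T) → T = S

theorem sum_eq_sum_oriented {M : Type*} [AddCommMonoid M] [Fintype (D.V × Field6)] {n : ℕ}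
    (f : D.V × Field6 ≃ Fin n) (S : Set D.V)
    [Fintype {h : D.V × Field6 // h.1 ∈ S ∧ (D.wick h).1 ∈ S ∧ f h < f (D.wick h)}]
    (G : D.V × Field6 → M) (hG : ∀ h, ¬ (h.1 ∈ S ∧ (D.wick h).1 ∈ S) → G h = 0) :
    ∑ h, G h =
      ∑ p : {h : D.V × Field6 // h.1 ∈ S ∧ (D.wick h).1 ∈ S ∧ f h < f (D.wick h)},
        (G p + G (D.wick p)) := by
  classical
  let w : D.V × Field6 ≃ D.V × Field6 := ⟨D.wick, D.wick, D.wick_wick, D.wick_wick⟩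
  have h1 : ∀ h, G h = (if f h < f (D.wick h) then G h else 0) +
      (if f (D.wick h) < f h then G h else 0) := by
    intro h
    rcases lt_trichotomy (f h) (f (D.wick h)) with hl | he | hl
    · simp [hl, hl.le.not_gt]
    · exact absurd (f.injective he).symm (D.wick_ne h)
    · simp [hl, hl.le.not_gt]
  have h2 : ∑ h, (if f (D.wick h) < f h then G h else 0) =
      ∑ h, (if f h < f (D.wick h) then G (D.wick h) else 0) := by
    rw [← w.sum_comp]
    refine Finset.sum_congr rfl fun h _ => ?_
    simp [w, D.wick_wick]
  calc ∑ h, G h = ∑ h, (if f h < f (D.wick h) then G h + G (D.wick h) else 0) := by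
        rw [Finset.sum_congr rfl fun h _ => h1 h, Finset.sum_add_distrib, h2,
          ← Finset.sum_add_distrib]
        refine Finset.sum_congr rfl fun h _ => ?_
        split_ifs <;> simp
    _ = ∑ h with (h.1 ∈ S ∧ (D.wick h).1 ∈ S ∧ f h < f (D.wick h)), (G h + G (D.wick h)) := by
        rw [Finset.sum_filter]
        refine Finset.sum_congr rfl fun h _ => ?_
        by_cases hS : h.1 ∈ S ∧ (D.wick h).1 ∈ S
        · simp [hS.1, hS.2]
        · rw [hG h hS, hG (D.wick h) (by rw [D.wick_wick]; tauto)]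
          simp
    _ = _ := by
        rw [← Finset.sum_subtype_eq_sum_filter, Finset.subtype_univ]

/-- The Euler characteristic of a connected surface is at most two, for the ribbon graph with faces
of two colours, and for a subdiagram with external legs. -/
theorem euler_bound {S : Set D.V} (hS : D.IsConn S) {a b : Colour} (hab : a ≠ b) :
    2 * ((D.innerLoops a S).ncard + (D.innerLoops b S).ncard) + (D.legs S).ncard ≤
      4 * S.ncard + 2 + (by classical exact if D.legs S = ∅ then 2 else 0) := by
  classical
  have : Fintype D.V := Fintype.ofFinite _
  have (c : Colour) : Fintype (D.Loop c) := Fintype.ofFinite _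
  obtain ⟨n, ⟨f⟩⟩ := Finite.exists_equiv_fin (D.V × Field6)
  -- A propagator inside `S` is represented by its end with the smaller number. With coefficients in
  -- `ZMod 2` no orientation is needed, so the surface may be non-orientable.
  let P := {h : D.V × Field6 // h.1 ∈ S ∧ (D.wick h).1 ∈ S ∧ f h < f (D.wick h)}
  have two : ∀ x : ZMod 2, x + x = 0 := by decide
  have eq_of_add : ∀ x y : ZMod 2, x + y = 0 → x = y := by decide
  -- counting the internal propagators
  have hP : 2 * Fintype.card P + (D.legs S).ncard = 6 * S.ncard := by
    have h1 := D.sum_eq_sum_oriented f S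
      (fun h => if h.1 ∈ S ∧ (D.wick h).1 ∈ S then 1 else 0) (fun h hh => by simp [hh])
    have h2 : ∀ p : P, ((if p.1.1 ∈ S ∧ (D.wick p.1).1 ∈ S then 1 else 0) +
        (if (D.wick p.1).1 ∈ S ∧ (D.wick (D.wick p.1)).1 ∈ S then 1 else 0)) = 2 := by
      intro p; simp [D.wick_wick, p.2.1, p.2.2.1]
    rw [Finset.sum_congr rfl fun p _ => h2 p] at h1
    have h3 : (D.legs S).ncard = ∑ h : D.V × Field6, if h ∈ D.legs S then 1 else 0 := by
      rw [Set.ncard_eq_toFinset_card', ← Finset.sum_filter, Finset.card_eq_sum_ones]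
      congr 1; ext; simp
    have h4 : 6 * S.ncard = ∑ h : D.V × Field6, if h.1 ∈ S then 1 else 0 := by
      rw [Fintype.sum_prod_type, Set.ncard_eq_toFinset_card', Finset.card_eq_sum_ones,
        Finset.mul_sum, ← Finset.sum_filter_add_sum_filter_not Finset.univ (· ∈ S)]
      rw [Finset.sum_eq_zero (s := Finset.univ.filter (· ∉ S)) (by
        intro x hx; simp at hx; simp [hx]), add_zero]
      refine Finset.sum_congr (by ext; simp) fun x hx => ?_
      simp at hx; simp [hx]
    rw [h4, h3]
    have h5 : 2 * Fintype.card P = ∑ p : P, 2 := by simp [mul_comm]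
    rw [h5, ← h1, ← Finset.sum_add_distrib]
    refine Finset.sum_congr rfl fun h _ => ?_
    by_cases h1 : h.1 ∈ S <;> by_cases h2 : (D.wick h).1 ∈ S <;> simp [legs, h1, h2]
  -- faces to propagators
  let lft (c : Colour) : (D.innerLoops c S → (ZMod 2)) →ₗ[(ZMod 2)] (D.V × Field6 → (ZMod 2)) :=
    { toFun := fun g h => if hh : D.loop c h ∈ D.innerLoops c S then g ⟨_, hh⟩ else 0
      map_add' := by intro x y; ext h; by_cases hh : D.loop c h ∈ D.innerLoops c S <;> simp [hh]
      map_smul' := by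
        intro x y; ext h; by_cases hh : D.loop c h ∈ D.innerLoops c S <;> simp [hh] }
  have lft_congr : ∀ c g h h', D.loop c h = D.loop c h' → lft c g h = lft c g h' := by
    intro c g h h' e
    by_cases hh : D.loop c h ∈ D.innerLoops c S
    · have hh' : D.loop c h' ∈ D.innerLoops c S := e ▸ hh
      simp only [lft, LinearMap.coe_mk, AddHom.coe_mk, dif_pos hh', e]
    · have hh' : D.loop c h' ∉ D.innerLoops c S := e ▸ hh
      simp only [lft, LinearMap.coe_mk, AddHom.coe_mk, dif_neg hh, dif_neg hh']
  have lft_wick : ∀ c g h, lft c g (D.wick h) = lft c g h :=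
    fun c g h => lft_congr c g _ _ (D.loop_wick c h)
  have lft_inner : ∀ c g h, lft c g (D.inner c h) = lft c g h :=
    fun c g h => lft_congr c g _ _ (D.loop_inner c h)
  have lft_zero : ∀ c g h, ¬ (h.1 ∈ S ∧ (D.wick h).1 ∈ S) → lft c g h = 0 := by
    intro c g h hh
    refine dif_neg fun hl => hh ⟨hl _ rfl, hl _ (D.loop_wick c h)⟩
  have lft_mk : ∀ c g (l : D.innerLoops c S), ∃ h, h.1 ∈ S ∧ lft c g h = g l := by
    rintro c g ⟨l, hl⟩
    obtain ⟨h, rfl⟩ := D.loop_surjective c l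
    exact ⟨h, hl h rfl, dif_pos hl⟩
  -- `Φ` and `Ψ` are the boundary maps of the chain complex faces → propagators → vertices; only
  -- loops that stay in `S` count as faces.
  let Φ : ((D.innerLoops a S → (ZMod 2)) × (D.innerLoops b S → (ZMod 2))) →ₗ[(ZMod 2)] (P → (ZMod 2)) :=
    LinearMap.pi fun p => (LinearMap.proj p.1 ∘ₗ lft a).coprod (LinearMap.proj p.1 ∘ₗ lft b)
  have hΦ : ∀ x p, Φ x p = lft a x.1 p.1 + lft b x.2 p.1 := fun x p => by
    simp [Φ]
  let inc (v : S) (h : D.V × Field6) : (ZMod 2) := if h.1 = v then 1 else 0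
  let Ψ : (P → (ZMod 2)) →ₗ[(ZMod 2)] (S → (ZMod 2)) :=
    LinearMap.pi fun v => ∑ p : P, (inc v p.1 + inc v (D.wick p.1)) • LinearMap.proj p
  have hΨ : ∀ g v, Ψ g v = ∑ p : P, (inc v p.1 + inc v (D.wick p.1)) * g p := fun g v => by
    simp [Ψ]
  have hzero : ∀ x, Ψ (Φ x) = 0 := by
    intro x
    ext v
    -- The edges of colour `c` pair the half-edges at `v`, with equal values on both ends, so
    -- everything cancels in characteristic two.
    have h1 : ∀ c g, ∑ h : D.V × Field6, inc v h * lft c g h = 0 := by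
      intro c g
      refine Finset.sum_involution (fun h _ => D.inner c h) (fun h _ => ?_)
        (fun h _ _ => D.inner_ne c h) (fun _ _ => Finset.mem_univ _)
        (fun h _ => D.inner_inner c h)
      rw [lft_inner]
      exact two _
    have h2 := D.sum_eq_sum_oriented f S (fun h => inc v h * (lft a x.1 h + lft b x.2 h))
      (fun h hh => by simp only [lft_zero _ _ h hh]; simp)
    rw [hΨ]
    simp only [hΦ, Pi.zero_apply]
    simp only [lft_wick] at h2
    rw [Finset.sum_congr rfl fun p _ => add_mul _ _ _, ← h2]
    simp only [mul_add, Finset.sum_add_distrib, h1, add_zero]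
  -- the rank of the boundary map
  obtain ⟨v₀, hv₀⟩ := hS.1
  have hrank : S.ncard ≤ Module.finrank (ZMod 2) (LinearMap.range Ψ) + 1 := by
    -- The range of `Ψ` contains the sum of the two ends of each propagator. As `S` is connected,
    -- adjoining a single basis vector yields the whole space.
    let M := LinearMap.range Ψ ⊔ Submodule.span (ZMod 2) {(Pi.single (⟨v₀, hv₀⟩ : S) (1 : ZMod 2) : S → ZMod 2)}
    have hM : ∀ v : S, (Pi.single v (1 : ZMod 2) : S → ZMod 2) ∈ M := by
      let T : Set D.V := {v | ∃ hv : v ∈ S, (Pi.single (⟨v, hv⟩ : S) (1 : ZMod 2) : S → ZMod 2) ∈ M}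
      have hT : T = S := by
        refine hS.2 T (fun v hv => hv.1) ⟨v₀, hv₀, ?_⟩ ?_
        · exact Submodule.mem_sup_right (Submodule.mem_span_singleton_self _)
        · rintro h ⟨hh, hm⟩ hw
          have key : ∀ p : P, (Pi.single (⟨p.1.1, p.2.1⟩ : S) (1 : ZMod 2) : S → ZMod 2) +
              (Pi.single (⟨(D.wick p.1).1, p.2.2.1⟩ : S) (1 : ZMod 2) : S → ZMod 2) ∈ M := by
            intro p
            refine Submodule.mem_sup_left ⟨Pi.single p 1, ?_⟩
            ext v
            rw [hΨ, Finset.sum_eq_single p (fun q _ hq => by simp [hq])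
              (fun hp => absurd (Finset.mem_univ _) hp)]
            simp only [inc, Pi.single_eq_same, mul_one, Pi.add_apply, Pi.single_apply,
              Subtype.ext_iff, eq_comm]
          refine ⟨hw, ?_⟩
          rcases lt_trichotomy (f h) (f (D.wick h)) with hl | he | hl
          · have := key ⟨h, hh, hw, hl⟩
            exact (Submodule.add_mem_iff_right _ hm).1 this
          · exact absurd (f.injective he).symm (D.wick_ne h)
          · have := key ⟨D.wick h, hw, by rwa [D.wick_wick], by rwa [D.wick_wick]⟩
            simp only [D.wick_wick] at this
            exact (Submodule.add_mem_iff_left _ hm).1 this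
      intro v
      have hv : v.1 ∈ T := by rw [hT]; exact v.2
      exact hv.2
    have htop : M = ⊤ := by
      rw [eq_top_iff]
      intro g _
      have : g = ∑ v, g v • (Pi.single v (1 : ZMod 2) : S → ZMod 2) := by
        ext u; simp [Finset.sum_apply, Pi.single_apply]
      rw [this]
      exact Submodule.sum_mem _ fun v _ => Submodule.smul_mem _ _ (hM v)
    have h1 : Module.finrank (ZMod 2) M = S.ncard := by
      rw [htop, finrank_top, Module.finrank_fintype_fun_eq_card, Set.ncard_eq_toFinset_card',
        Set.toFinset_card]
    have h2 : Module.finrank (ZMod 2) M ≤ _ := Submodule.finrank_add_le_finrank_add_finrank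
      (LinearMap.range Ψ)
      (Submodule.span (ZMod 2) {(Pi.single (⟨v₀, hv₀⟩ : S) (1 : ZMod 2) : S → ZMod 2)})
    have h3 : Module.finrank (ZMod 2) (Submodule.span (ZMod 2) {(Pi.single (⟨v₀, hv₀⟩ : S) (1 : ZMod 2) : S → ZMod 2)}) ≤ 1 :=
      (finrank_span_le_card _).trans (by simp)
    omega
  -- the kernel of the face map
  have hker : ∀ x, Φ x = 0 → ∀ h₀ : D.V × Field6, h₀.1 ∈ S → lft a x.1 h₀ = 0 → x = 0 := by
    intro x hx h₀ hh₀ h0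
    have h1 : ∀ h, lft a x.1 h = lft b x.2 h := by
      intro h
      by_cases hh : h.1 ∈ S ∧ (D.wick h).1 ∈ S
      · rcases lt_trichotomy (f h) (f (D.wick h)) with hl | he | hl
        · exact eq_of_add _ _ (by rw [← hΦ x ⟨h, hh.1, hh.2, hl⟩, hx]; rfl)
        · exact absurd (f.injective he).symm (D.wick_ne h)
        · have := hΦ x ⟨D.wick h, hh.2, by rw [D.wick_wick]; exact hh.1, by rwa [D.wick_wick]⟩
          rw [hx, lft_wick, lft_wick] at this
          exact eq_of_add _ _ this.symm
      · rw [lft_zero _ _ h hh, lft_zero _ _ h hh]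
    have ha : ∀ v i, lft a x.1 (v, edge (D.kind v) a i) = lft a x.1 (v, i) :=
      fun v i => lft_inner a x.1 (v, i)
    have hb : ∀ v i, lft a x.1 (v, edge (D.kind v) b i) = lft a x.1 (v, i) :=
      fun v i => by rw [h1, h1]; exact lft_inner b x.2 (v, i)
    -- For a chain in the kernel the lifts of both colours agree, so the value is invariant under
    -- the edges of both; the hexagon makes it constant at a vertex, connectedness constant on `S`.
    have hv : ∀ v i j, lft a x.1 (v, i) = lft a x.1 (v, j) := by
      intro v i j
      rcases edge_hexagon (D.kind v) hab i j with e | e | e | e | e | e <;> rw [e] <;>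
        simp only [ha, hb]
    have hT : {v ∈ S | ∀ i, lft a x.1 (v, i) = 0} = S := by
      refine hS.2 _ (fun v hv => hv.1) ⟨h₀.1, hh₀, fun i => ?_⟩ ?_
      · rw [hv _ i h₀.2]; exact h0
      · rintro ⟨u, i⟩ ⟨hu, h2⟩ hw
        refine ⟨hw, fun j => ?_⟩
        rw [hv _ j (D.wick (u, i)).2]
        exact (lft_wick a x.1 (u, i)).trans (h2 i)
    have h3 : ∀ h : D.V × Field6, h.1 ∈ S → lft a x.1 h = 0 := by
      intro h hh
      rw [← hT] at hh
      exact hh.2 h.2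
    refine Prod.ext (funext fun l => ?_) (funext fun l => ?_)
    · obtain ⟨h, hh, e⟩ := lft_mk a x.1 l
      rw [← e, h3 h hh]; rfl
    · obtain ⟨h, hh, e⟩ := lft_mk b x.2 l
      rw [← e, ← h1, h3 h hh]; rfl
  -- On a closed surface only the constant chain is left. A leg lies on no face inside `S`, which
  -- forces the constant to be zero.
  have hkerrank : Module.finrank (ZMod 2) (LinearMap.ker Φ) ≤ if D.legs S = ∅ then 1 else 0 := by
    split_ifs with hl
    · let ev : LinearMap.ker Φ →ₗ[(ZMod 2)] (ZMod 2) :=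
        LinearMap.proj (v₀, (0 : Field6)) ∘ₗ lft a ∘ₗ LinearMap.fst _ _ _ ∘ₗ (LinearMap.ker Φ).subtype
      have : Function.Injective ev := by
        rw [← LinearMap.ker_eq_bot, LinearMap.ker_eq_bot']
        intro x hx
        exact Subtype.ext (hker x.1 x.2 (v₀, 0) hv₀ hx)
      simpa using LinearMap.finrank_le_finrank_of_injective this
    · obtain ⟨h, hh⟩ := Set.nonempty_iff_ne_empty.2 hl
      have : LinearMap.ker Φ = ⊥ := by
        rw [LinearMap.ker_eq_bot']
        exact fun x hx => hker x hx h hh.1 (lft_zero _ _ _ fun h' => hh.2 h'.2)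
      rw [this, finrank_bot]
  -- Since `Ψ ∘ Φ = 0`, the number of faces is at most the number of propagators minus the rank of
  -- `Ψ` plus the dimension of `ker Φ`; `hP` then eliminates the propagators.
  have h1 := LinearMap.finrank_range_add_finrank_ker Φ
  have h2 := LinearMap.finrank_range_add_finrank_ker Ψ
  have h3 : Module.finrank (ZMod 2) (LinearMap.range Φ) ≤ Module.finrank (ZMod 2) (LinearMap.ker Ψ) :=
    Submodule.finrank_mono (by rintro _ ⟨x, rfl⟩; exact hzero x)
  rw [Module.finrank_prod, Module.finrank_fintype_fun_eq_card, Module.finrank_fintype_fun_eq_card,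
    ← Nat.card_eq_fintype_card, ← Nat.card_eq_fintype_card] at h1
  rw [Module.finrank_fintype_fun_eq_card] at h2
  change _ = Nat.card (D.innerLoops a S) + Nat.card (D.innerLoops b S) at h1
  rw [Nat.card_coe_set_eq, Nat.card_coe_set_eq] at h1
  split_ifs at hkerrank ⊢ <;> omega

/-- Connected diagrams all of whose ribbon graphs are planar. -/
structure IsPlanar (D : Diagram) : Prop where
  conn : D.IsConn Set.univ
  card_loop : ∀ c, Nat.card (D.Loop c) = Nat.card D.V + 1

/-! ### Legs -/

/-- Inner edges pair all half-edges of `S` that satisfy `Q`, and contractions pair those contracted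
inside `S`. The legs are the difference of two even sets. -/
theorem even_legs_filter (c : Colour) (S : Set D.V) (Q : D.V × Field6 → Prop)
    (hw : ∀ h, Q h → Q (D.wick h)) (hc : ∀ h, Q h → Q (D.inner c h)) :
    Even {h ∈ D.legs S | Q h}.ncard := by
  have h1 : Even {h | h.1 ∈ S ∧ Q h}.ncard :=
    even_ncard_of_involution (D.inner c) (fun h hh => ⟨hh.1, hc h hh.2⟩)
      (fun h _ => D.inner_inner c h) (fun h _ => D.inner_ne c h)
  have h2 : Even {h | h.1 ∈ S ∧ (D.wick h).1 ∈ S ∧ Q h}.ncard :=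
    even_ncard_of_involution D.wick
      (fun h hh => ⟨hh.2.1, by rw [D.wick_wick]; exact hh.1, hw h hh.2.2⟩)
      (fun h _ => D.wick_wick h) (fun h _ => D.wick_ne h)
  have h3 : {h | h.1 ∈ S ∧ Q h} =
      {h | h.1 ∈ S ∧ (D.wick h).1 ∈ S ∧ Q h} ∪ {h ∈ D.legs S | Q h} := by
    ext h; simp only [Set.mem_ofPred_eq, Set.mem_union, legs]; tauto
  rw [h3, Set.ncard_union_eq (Set.disjoint_left.2 fun h hh hh' => hh'.1.2 hh.2.1)] at h1
  exact (Nat.even_add.1 h1).1 h2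

theorem even_legs_loop (c : Colour) (S : Set D.V) (l : D.Loop c) :
    Even {h ∈ D.legs S | D.loop c h = l}.ncard :=
  even_legs_filter c S _ (fun h hh => (D.loop_wick c h).trans hh)
    (fun h hh => (D.loop_inner c h).trans hh)

theorem even_legs (S : Set D.V) : Even (D.legs S).ncard := by
  have := even_legs_filter red S (fun _ => True) (fun _ h => h) (fun _ h => h)
  simpa using this

theorem legs_compl (S : Set D.V) : D.legs Sᶜ = D.wick '' D.legs S := by
  ext h
  constructor
  · rintro ⟨h1, h2⟩
    exact ⟨D.wick h, ⟨not_not.1 h2, by rw [D.wick_wick]; exact h1⟩, D.wick_wick h⟩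
  · rintro ⟨k, ⟨h1, h2⟩, rfl⟩
    exact ⟨h2, by rw [D.wick_wick]; exact not_not.2 h1⟩

theorem ncard_legs_compl (S : Set D.V) : (D.legs Sᶜ).ncard = (D.legs S).ncard := by
  rw [legs_compl, Set.ncard_image_of_injective _ wick_injective]

theorem legs_univ : D.legs Set.univ = ∅ := by
  ext h; simp [legs]

theorem legs_nonempty (hD : D.IsConn Set.univ) {S : Set D.V} (hS : S.Nonempty)
    (hne : S ≠ Set.univ) : (D.legs S).Nonempty := by
  by_contra hl
  rw [Set.not_nonempty_iff_eq_empty] at hl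
  refine hne (hD.2 S (Set.subset_univ _) hS fun h hh _ => ?_)
  by_contra hw
  have : h ∈ D.legs S := ⟨hh, hw⟩
  rw [hl] at this
  exact this

theorem mem_innerLoops_of_disjoint_legs {c : Colour} {S : Set D.V} {h : D.V × Field6}
    (hh : h.1 ∈ S) (hl : ∀ k ∈ D.legs S, D.loop c k ≠ D.loop c h) :
    D.loop c h ∈ D.innerLoops c S := by
  intro k hk
  refine (mem_of_loop_eq (T := {k | k.1 ∈ S ∧ D.loop c k = D.loop c h}) ?_ ?_ hk.symm
    ⟨hh, rfl⟩).1
  · rintro k ⟨h1, h2⟩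
    refine ⟨?_, (D.loop_wick c k).trans h2⟩
    by_contra hw
    exact hl k ⟨h1, hw⟩ h2
  · rintro k ⟨h1, h2⟩
    exact ⟨h1, (D.loop_inner c k).trans h2⟩

theorem card_loop_le (c : Colour) (S : Set D.V) :
    Nat.card (D.Loop c) ≤ (D.loop c '' D.legs S).ncard + (D.innerLoops c S).ncard +
      (D.innerLoops c Sᶜ).ncard := by
  rw [← Set.ncard_univ]
  refine (Set.ncard_le_ncard (t := D.loop c '' D.legs S ∪ D.innerLoops c S ∪ D.innerLoops c Sᶜ)
    fun l _ => ?_).trans ((Set.ncard_union_le _ _).trans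
      (Nat.add_le_add_right (Set.ncard_union_le _ _) _))
  by_cases hl : l ∈ D.loop c '' D.legs S
  · exact Or.inl (Or.inl hl)
  obtain ⟨h, rfl⟩ := D.loop_surjective c l
  by_cases hh : h.1 ∈ S
  · exact Or.inl (Or.inr (mem_innerLoops_of_disjoint_legs hh fun k hk e => hl ⟨k, hk, e⟩))
  · refine Or.inr (mem_innerLoops_of_disjoint_legs hh fun k hk e => ?_)
    rw [legs_compl] at hk
    obtain ⟨k, hk, rfl⟩ := hk
    exact hl ⟨k, hk, (D.loop_wick c k).symm.trans e⟩

theorem euler_bound_of_legs {S : Set D.V} (hS : D.IsConn S) (hl : (D.legs S).Nonempty)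
    {a b : Colour} (hab : a ≠ b) :
    2 * ((D.innerLoops a S).ncard + (D.innerLoops b S).ncard) + (D.legs S).ncard ≤
      4 * S.ncard + 2 := by
  have := euler_bound hS hab
  rwa [if_neg hl.ne_empty, add_zero] at this

theorem two_le_of_even {n : ℕ} (h : Even n) (h0 : n ≠ 0) : 2 ≤ n := by
  obtain ⟨m, rfl⟩ := h; omega

/-- Along a bond of a planar diagram, the numbers of loops on both sides are determined, and each
loop crosses the bond at most once forth and back. -/
theorem IsPlanar.bond (hD : D.IsPlanar) {S : Set D.V} (hS : D.IsConn S) (hS' : D.IsConn Sᶜ) :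
    ∃ m, (D.legs S).ncard = 2 * m ∧ Odd m ∧
      (∀ c, 2 * (D.innerLoops c S).ncard + m = 2 * S.ncard + 1) ∧
      ∀ c, ∀ h ∈ D.legs S, {k ∈ D.legs S | D.loop c k = D.loop c h}.ncard = 2 := by
  classical
  have : Fintype D.V := Fintype.ofFinite _
  have (c : Colour) : Fintype (D.Loop c) := Fintype.ofFinite _
  have hne : S ≠ Set.univ := by
    rintro rfl; simpa using hS'.1
  have hne' : Sᶜ ≠ Set.univ := by
    intro h; rw [Set.compl_univ_iff] at h; simpa [h] using hS.1
  have hl := legs_nonempty hD.conn hS.1 hne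
  have hl' := legs_nonempty hD.conn hS'.1 hne'
  obtain ⟨m, hm⟩ := even_legs S
  have hV : S.ncard + Sᶜ.ncard = Nat.card D.V := Set.ncard_add_ncard_compl S
  have fib : ∀ c, (D.legs S).ncard = ∑ l ∈ (D.loop c '' D.legs S).toFinset,
      {k ∈ D.legs S | D.loop c k = l}.ncard := by
    intro c
    rw [Set.ncard_eq_toFinset_card', Set.toFinset_image, Finset.card_eq_sum_card_image (D.loop c)]
    refine Finset.sum_congr rfl fun l _ => ?_
    rw [Set.ncard_eq_toFinset_card']
    congr 1; ext; simp
  have two : ∀ c, ∀ l ∈ (D.loop c '' D.legs S).toFinset,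
      2 ≤ {k ∈ D.legs S | D.loop c k = l}.ncard := by
    intro c l hl
    refine two_le_of_even (even_legs_loop c S l) ?_
    rw [Set.mem_toFinset] at hl
    obtain ⟨h, hh, e⟩ := hl
    have hne : {k ∈ D.legs S | D.loop c k = l}.Nonempty := ⟨h, hh, e⟩
    exact ((Set.ncard_pos (Set.toFinite _)).2 hne).ne'
  have hX : ∀ c, 2 * (D.loop c '' D.legs S).ncard ≤ 2 * m := by
    intro c
    have h1 := Finset.card_nsmul_le_sum _ _ _ (two c)
    rw [← fib c, smul_eq_mul, ← Set.ncard_eq_toFinset_card'] at h1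
    omega
  have hN : ∀ c, Nat.card D.V + 1 ≤ _ := fun c => (hD.card_loop c) ▸ D.card_loop_le c S
  have e1 := euler_bound_of_legs hS hl (show red ≠ green by decide)
  have e2 := euler_bound_of_legs hS hl (show green ≠ blue by decide)
  have e3 := euler_bound_of_legs hS hl (show red ≠ blue by decide)
  have e1' := euler_bound_of_legs hS' hl' (show red ≠ green by decide)
  have e2' := euler_bound_of_legs hS' hl' (show green ≠ blue by decide)
  have e3' := euler_bound_of_legs hS' hl' (show red ≠ blue by decide)
  rw [ncard_legs_compl] at e1' e2' e3'
  have n1 := hN red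
  have n2 := hN green
  have n3 := hN blue
  have x1 := hX red
  have x2 := hX green
  have x3 := hX blue
  -- The Euler bounds of the two sides allow at most `2V + 2 - 2m` inner loops of two colours, and
  -- at most `2m` loops of these colours cross. Planarity requires `2V + 2`, so all bounds are
  -- sharp, and the three pairs of colours determine each colour.
  have hint : ∀ c, 2 * (D.innerLoops c S).ncard + m = 2 * S.ncard + 1 := by
    intro c; cases c <;> omega
  have hcross : ∀ c, (D.loop c '' D.legs S).ncard = m := by
    intro c; cases c <;> omega
  refine ⟨m, by omega, ?_, hint, fun c h hh => ?_⟩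
  · rw [← Nat.not_even_iff_odd]
    rintro ⟨r, hr⟩
    have := hint red
    omega
  -- The `m` crossing loops share `2m` legs and each uses at least two of them, hence exactly two.
  · have h1 : ∑ l ∈ (D.loop c '' D.legs S).toFinset, 2 = ∑ l ∈ (D.loop c '' D.legs S).toFinset,
        {k ∈ D.legs S | D.loop c k = l}.ncard := by
      rw [← fib c, Finset.sum_const, smul_eq_mul, ← Set.ncard_eq_toFinset_card', hcross]
      omega
    exact ((Finset.sum_eq_sum_iff_of_le (two c)).1 h1 _ (by rw [Set.mem_toFinset]; exact ⟨h, hh, rfl⟩)).symm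

/-! ### Components of the complement of a vertex set -/

/-- The component of a vertex after a set of vertices is taken out. -/
def component (D : Diagram) (A : Set D.V) (u : D.V) : Set D.V :=
  {v | Relation.ReflTransGen (fun p q => q ∉ A ∧ D.Adj p q) u v}

theorem adj_symm {u v : D.V} (h : D.Adj u v) : D.Adj v u := by
  obtain ⟨i, j, e⟩ := h
  exact ⟨j, i, by rw [← e, D.wick_wick]⟩

theorem adj_wick (h : D.V × Field6) : D.Adj h.1 (D.wick h).1 := ⟨h.2, (D.wick h).2, rfl⟩

theorem self_mem_component (A : Set D.V) (u : D.V) : u ∈ D.component A u :=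
  Relation.ReflTransGen.refl

theorem notMem_of_mem_component {A : Set D.V} {u v : D.V} (hu : u ∉ A)
    (h : v ∈ D.component A u) : v ∉ A := by
  cases h with
  | refl => exact hu
  | tail _ h => exact h.1

theorem wick_mem_component {A : Set D.V} {u : D.V} {h : D.V × Field6}
    (hh : h.1 ∈ D.component A u) (hw : (D.wick h).1 ∉ A) : (D.wick h).1 ∈ D.component A u :=
  Relation.ReflTransGen.tail hh ⟨hw, adj_wick h⟩

theorem mem_component_symm {A : Set D.V} {u v : D.V} (hu : u ∉ A) (h : v ∈ D.component A u) :
    u ∈ D.component A v := by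
  induction h with
  | refl => exact self_mem_component A u
  | tail h1 h2 ih =>
    exact Relation.ReflTransGen.head ⟨notMem_of_mem_component hu h1, adj_symm h2.2⟩ ih

theorem component_eq {A : Set D.V} {u v : D.V} (hu : u ∉ A) (h : v ∈ D.component A u) :
    D.component A v = D.component A u := by
  ext w
  exact ⟨fun h' => Relation.ReflTransGen.trans h h',
    fun h' => Relation.ReflTransGen.trans (mem_component_symm hu h) h'⟩

theorem isConn_component {A : Set D.V} {u : D.V} (hu : u ∉ A) : D.IsConn (D.component A u) := by
  refine ⟨⟨u, self_mem_component A u⟩, fun T hT ⟨t, ht⟩ hcl => hT.antisymm fun v hv => ?_⟩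
  rw [← component_eq hu (hT ht)] at hv
  induction hv with
  | refl => exact ht
  | tail _ h2 ih =>
    obtain ⟨h2, i, j, e⟩ := h2
    have := hcl (_, i) ih
    rw [e] at this
    refine this (Relation.ReflTransGen.tail (hT ih) ⟨h2, i, j, e⟩)

theorem isConn_singleton (v : D.V) : D.IsConn {v} :=
  ⟨⟨v, rfl⟩, fun _ hT ht _ => (Set.subset_singleton_iff_eq.1 hT).resolve_left ht.ne_empty⟩

theorem isConn_pair {h : D.V × Field6} {L R : D.V} (hL : h.1 = L) (hR : (D.wick h).1 = R) :
    D.IsConn {L, R} := by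
  subst hL hR
  refine ⟨⟨h.1, Or.inl rfl⟩, fun T hT ⟨t, ht⟩ hcl => hT.antisymm ?_⟩
  rcases hT ht with rfl | rfl
  · rintro _ (rfl | rfl)
    · exact ht
    · exact hcl h ht (Or.inr rfl)
  · have := hcl (D.wick h) ht (by rw [D.wick_wick]; exact Or.inl rfl)
    rw [D.wick_wick] at this
    rintro _ (rfl | rfl)
    · exact this
    · exact ht

theorem wick_notMem_component {A : Set D.V} {u : D.V} {h : D.V × Field6}
    (hA : h.1 ∉ A) (hh : h.1 ∉ D.component A u) : (D.wick h).1 ∉ D.component A u := fun hw =>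
  hh (by simpa [D.wick_wick] using wick_mem_component hw (by rwa [D.wick_wick]))

/-- No propagator joins two different components, so in a connected diagram everything outside one
component hangs on `A`. This makes the legs of a component a bond, to which `IsPlanar.bond` applies.
-/
theorem isConn_compl_component (hD : D.IsConn Set.univ) {A : Set D.V} (hA : D.IsConn A) {u : D.V}
    (hu : u ∉ A) : D.IsConn (D.component A u)ᶜ := by
  have hAK : A ⊆ (D.component A u)ᶜ := fun a ha hK => notMem_of_mem_component hu hK ha
  have closed : ∀ U ⊆ (D.component A u)ᶜ, U.Nonempty → (∀ a ∈ U, a ∉ A) →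
      (∀ h : D.V × Field6, h.1 ∈ U → (D.wick h).1 ∈ (D.component A u)ᶜ → (D.wick h).1 ∈ U) →
      False := by
    intro U hU hne hUA hcl
    have := hD.2 U (Set.subset_univ _) hne fun h hh _ =>
      hcl h hh (wick_notMem_component (hUA _ hh) (hU hh))
    obtain ⟨a, ha⟩ := hA.1
    exact hUA a (this ▸ Set.mem_univ a) ha
  refine ⟨hA.1.mono hAK, fun T hT hne hcl => hT.antisymm ?_⟩
  have hTA : (T ∩ A).Nonempty := by
    by_contra h
    rw [Set.not_nonempty_iff_eq_empty] at h
    exact closed T hT hne (fun a ha ha' => (h ▸ ⟨ha, ha'⟩ : a ∈ (∅ : Set D.V))) hcl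
  have hAT : A ⊆ T := by
    have := hA.2 (T ∩ A) Set.inter_subset_right hTA
      fun h hh hw => ⟨hcl h hh.1 (hAK hw), hw⟩
    rw [← this]; exact Set.inter_subset_left
  by_contra hn
  obtain ⟨v, hv, hvT⟩ := Set.not_subset.1 hn
  refine closed ((D.component A u)ᶜ \ T) Set.sdiff_subset ⟨v, hv, hvT⟩ (fun a ha ha' => ha.2 (hAT ha'))
    fun h hh hw => ⟨hw, fun hwT => hh.2 ?_⟩
  have := hcl (D.wick h) hwT (by rw [D.wick_wick]; exact hh.1)
  rwa [D.wick_wick] at this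

theorem mem_legs_component {A : Set D.V} {u : D.V} {h : D.V × Field6} :
    h ∈ D.legs (D.component A u) → (D.wick h).1 ∈ A := fun hh => by
  by_contra hw
  exact hh.2 (wick_mem_component hh.1 hw)

/-- Since `m` is odd, a component has either two legs or at least six; this gap drives the whole
local analysis. -/
theorem IsPlanar.bond_component (hD : D.IsPlanar) {A : Set D.V} (hA : D.IsConn A) {u : D.V}
    (hu : u ∉ A) :
    ∃ m, (D.legs (D.component A u)).ncard = 2 * m ∧ Odd m ∧
      ∀ c, 2 * (D.innerLoops c (D.component A u)).ncard + m = 2 * (D.component A u).ncard + 1 := by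
  obtain ⟨m, h1, h2, h3, -⟩ :=
    hD.bond (isConn_component hu) (isConn_compl_component hD.conn hA hu)
  exact ⟨m, h1, h2, h3⟩

/-- The loops of colour `c` that pass through a vertex set. -/
def touching (D : Diagram) (c : Colour) (A : Set D.V) : Set (D.Loop c) :=
  {l | ∃ h, h.1 ∈ A ∧ D.loop c h = l}

theorem mem_innerLoops_component {c : Colour} {A : Set D.V} {h : D.V × Field6}
    (hl : D.loop c h ∉ D.touching c A) : D.loop c h ∈ D.innerLoops c (D.component A h.1) := by
  refine mem_innerLoops_of_disjoint_legs (self_mem_component A h.1) fun k hk e => hl ?_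
  exact ⟨D.wick k, mem_legs_component hk, (D.loop_wick c k).trans e⟩

/-- The number of loops through a connected vertex set of a planar diagram is bounded from below in
terms of the numbers of legs of the components of its complement. -/
theorem IsPlanar.le_touching (hD : D.IsPlanar) {A : Set D.V} (hA : D.IsConn A) (c : Colour)
    (𝒦 : Finset (Set D.V)) (h𝒦 : ∀ K, K ∈ 𝒦 ↔ ∃ u, u ∉ A ∧ D.component A u = K) :
    4 + 4 * A.ncard + ∑ K ∈ 𝒦, ((D.legs K).ncard - 2) ≤ 4 * (D.touching c A).ncard := by
  classical
  have : Fintype D.V := Fintype.ofFinite _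
  have (c : Colour) : Fintype (D.Loop c) := Fintype.ofFinite _
  have h1 : Nat.card (D.Loop c) ≤
      (D.touching c A).ncard + ∑ K ∈ 𝒦, (D.innerLoops c K).ncard := by
    have hsub : (Finset.univ : Finset (D.Loop c)) ⊆
        (D.touching c A).toFinset ∪ 𝒦.biUnion fun K => (D.innerLoops c K).toFinset := by
      intro l _
      rw [Finset.mem_union, Set.mem_toFinset, Finset.mem_biUnion]
      by_cases hl : l ∈ D.touching c A
      · exact Or.inl hl
      obtain ⟨h, rfl⟩ := D.loop_surjective c l
      have hh : h.1 ∉ A := fun hh => hl ⟨h, hh, rfl⟩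
      exact Or.inr ⟨_, (h𝒦 _).2 ⟨h.1, hh, rfl⟩, by
        rw [Set.mem_toFinset]; exact mem_innerLoops_component hl⟩
    have h2 := (Finset.card_le_card hsub).trans (Finset.card_union_le _ _)
    have h3 := Finset.card_biUnion_le (s := 𝒦) (t := fun K => (D.innerLoops c K).toFinset)
    simp only [← Set.ncard_eq_toFinset_card'] at h2 h3
    rw [Finset.card_univ, ← Nat.card_eq_fintype_card] at h2
    omega
  have h2 : ∑ K ∈ 𝒦, K.ncard ≤ Aᶜ.ncard := by
    simp only [Set.ncard_eq_toFinset_card']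
    rw [← Finset.card_biUnion]
    · refine Finset.card_le_card fun v hv => ?_
      simp only [Finset.mem_biUnion, Set.mem_toFinset] at hv ⊢
      obtain ⟨K, hK, hv⟩ := hv
      obtain ⟨u, hu, rfl⟩ := (h𝒦 K).1 hK
      exact notMem_of_mem_component hu hv
    · intro K hK K' hK' hne
      rw [Function.onFun, Finset.disjoint_left]
      intro v hv hv'
      rw [Set.mem_toFinset] at hv hv'
      obtain ⟨u, hu, rfl⟩ := (h𝒦 K).1 hK
      obtain ⟨u', hu', rfl⟩ := (h𝒦 K').1 hK'
      exact hne ((component_eq hu hv).symm.trans (component_eq hu' hv'))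
  -- Four times the count of inner loops from the bond equation. The truncated subtraction is exact,
  -- because an odd `m` gives at least two legs.
  have h3 : ∑ K ∈ 𝒦, (4 * (D.innerLoops c K).ncard + ((D.legs K).ncard - 2)) =
      ∑ K ∈ 𝒦, 4 * K.ncard := by
    refine Finset.sum_congr rfl fun K hK => ?_
    obtain ⟨u, hu, rfl⟩ := (h𝒦 K).1 hK
    obtain ⟨m, e1, e2, e3⟩ := hD.bond_component hA hu
    have := e3 c
    obtain ⟨r, rfl⟩ := e2
    omega
  rw [Finset.sum_add_distrib, ← Finset.mul_sum, ← Finset.mul_sum] at h3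
  have h4 : A.ncard + Aᶜ.ncard = Nat.card D.V := Set.ncard_add_ncard_compl A
  have h5 := hD.card_loop c
  omega

end Diagram

/-! ### Perfect matchings of the interaction graphs -/

instance (k : Interaction) (π : Perm Colour) (α : Perm Field6) :
    Decidable (IsColourSymmetry k π α) :=
  inferInstanceAs (Decidable (∀ c, α * edge k c * α⁻¹ = edge k (π c)))

instance (k : Interaction) (α : Perm Field6) : Decidable (IsAutomorphism k α) :=
  inferInstanceAs (Decidable (IsColourSymmetry k 1 α))

/-- Two perfect matchings of six points that do not form a single cycle have a common edge. -/
theorem exists_common_edge (s e : Field6 → Field6) (hs : ∀ i, s (s i) = i) (hs' : ∀ i, s i ≠ i)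
    (he : ∀ i, e (e i) = i) (he' : ∀ i, e i ≠ i) (T : Set Field6) (hTs : ∀ i ∈ T, s i ∈ T)
    (hTe : ∀ i ∈ T, e i ∈ T) (hT : T.Nonempty) (hT' : Tᶜ.Nonempty) : ∃ i, s i = e i := by
  -- `T` and its complement are nonempty, of even size and invariant under both matchings. Of six
  -- points one of them has only two, and on it both matchings are the same edge.
  have key : ∀ U : Set Field6, (∀ i ∈ U, s i ∈ U) → (∀ i ∈ U, e i ∈ U) → U.ncard = 2 →
      ∃ i, s i = e i := by
    intro U h1 h2 h3
    obtain ⟨x, y, hxy, rfl⟩ := Set.ncard_eq_two.1 h3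
    refine ⟨x, ?_⟩
    rcases h1 x (Or.inl rfl) with h | h
    · exact absurd h (hs' x)
    rcases h2 x (Or.inl rfl) with h' | h'
    · exact absurd h' (he' x)
    · exact h.trans h'.symm
  have c1 := even_ncard_of_involution s hTs (fun i _ => hs i) (fun i _ => hs' i)
  have c2 := (Set.ncard_pos (Set.toFinite _)).2 hT
  have c3 := (Set.ncard_pos (Set.toFinite _)).2 hT'
  have c4 := Set.ncard_add_ncard_compl T
  rw [Nat.card_eq_fintype_card, Fintype.card_fin] at c4
  obtain ⟨r, hr⟩ := c1
  by_cases h : T.ncard = 2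
  · exact key T hTs hTe h
  · refine key Tᶜ (fun i hi hi' => hi ?_) (fun i hi hi' => hi ?_) (by omega)
    · simpa [hs] using hTs _ hi'
    · simpa [he] using hTe _ hi'

/-- The automorphism of the wheel that moves the labels by two. -/
def wheelRotation : Perm Field6 := swap 1 3 * swap 3 5 * (swap 2 4 * swap 4 6)

/-- A perfect matching of the prism that uses a side of a triangle is monochromatic, so the only one
with three colours consists of the three rungs. In `K_{3,3}` there are three such matchings,
permuted by `wheelRotation`; the short list of candidates keeps the check finite and small. -/
theorem rainbow_matching (k : Interaction) (i j l : Field6)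
    (h1 : j ≠ i) (h2 : j ≠ edge k red i) (h3 : edge k green j ≠ i) (h4 : l ≠ i)
    (h5 : l ≠ edge k red i) (h6 : edge k blue l ≠ i) (h7 : l ≠ j) (h8 : l ≠ edge k green j)
    (h9 : edge k blue l ≠ j) (h10 : edge k green j ≠ edge k red i)
    (h11 : edge k blue l ≠ edge k red i) (h12 : edge k blue l ≠ edge k green j) :
    ∃ α ∈ [1, wheelRotation, wheelRotation⁻¹], IsAutomorphism k α ∧
      (α * snailPairing k * α⁻¹) i = edge k red i ∧
      (α * snailPairing k * α⁻¹) j = edge k green j ∧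
      (α * snailPairing k * α⁻¹) l = edge k blue l ∧
      ∀ n, n = i ∨ n = edge k red i ∨ n = j ∨ n = edge k green j ∨ n = l ∨ n = edge k blue l := by
  revert k i j l; decide +kernel

theorem isSnailPairing_of_common_edges (k : Interaction) (s : Perm Field6)
    (hs : ∀ i, s (s i) = i) (h : ∀ c, ∃ i, s i = edge k c i) : IsSnailPairing k s := by
  obtain ⟨i, hi⟩ := h red
  obtain ⟨j, hj⟩ := h green
  obtain ⟨l, hl⟩ := h blue
  have hi' : s (edge k red i) = i := by rw [← hi, hs]
  have hj' : s (edge k green j) = j := by rw [← hj, hs]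
  have hl' : s (edge k blue l) = l := by rw [← hl, hs]
  have ne {a b : Colour} (hab : a ≠ b) {p q : Field6} (hp : s p = edge k a p)
      (hq : s q = edge k b q) : q ≠ p := by
    rintro rfl; exact edge_ne_edge k hab q (hp.symm.trans hq)
  have sw {a : Colour} {p : Field6} (hp : s p = edge k a p) :
      s (edge k a p) = edge k a (edge k a p) := by rw [edge_edge, ← hp, hs]
  obtain ⟨α, -, h1, h2, h3, h4, h5⟩ := rainbow_matching k i j l
    (ne (by decide) hi hj) (ne (by decide) (sw hi) hj) (ne (by decide) hi (sw hj))
    (ne (by decide) hi hl) (ne (by decide) (sw hi) hl) (ne (by decide) hi (sw hl))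
    (ne (by decide) hj hl) (ne (by decide) (sw hj) hl) (ne (by decide) hj (sw hl))
    (ne (by decide) (sw hi) (sw hj)) (ne (by decide) (sw hi) (sw hl)) (ne (by decide) (sw hj) (sw hl))
  refine ⟨α, h1, ?_⟩
  have inv : ∀ n, (α * snailPairing k * α⁻¹) ((α * snailPairing k * α⁻¹) n) = n := by
    intro n; simp [snailPairing_snailPairing]
  ext n
  rcases h5 n with rfl | rfl | rfl | rfl | rfl | rfl
  · rw [hi, h2]
  · rw [hi', ← h2, inv]
  · rw [hj, h3]
  · rw [hj', ← h3, inv]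
  · rw [hl, h4]
  · rw [hl', ← h4, inv]

theorem eq_or_eq_of_mem_pair {X : Type*} {p q a b c : X} (ha : a ∈ ({p, q} : Set X))
    (hb : b ∈ ({p, q} : Set X)) (hc : c ∈ ({p, q} : Set X)) (hab : b ≠ a) : c = a ∨ c = b := by
  simp only [Set.mem_insert_iff, Set.mem_singleton_iff] at ha hb hc
  grind

namespace Diagram

variable {D : Diagram}

/-! ### Legs joined by two-point subgraphs -/

/-- The legs `h`, `h'` of the vertex set `A` are contracted or attached to a connected subgraph
outside `A` without further external legs. -/
def Twin (D : Diagram) (A : Set D.V) (h h' : D.V × Field6) : Prop :=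
  h ≠ h' ∧ h.1 ∈ A ∧ h'.1 ∈ A ∧
    (D.wick h = h' ∨ ∃ K, D.IsConn K ∧ Disjoint K A ∧ D.legs K = {D.wick h, D.wick h'})

theorem Twin.symm {A : Set D.V} {h h' : D.V × Field6} (ht : D.Twin A h h') : D.Twin A h' h := by
  obtain ⟨h1, h2, h3, h4⟩ := ht
  refine ⟨h1.symm, h3, h2, h4.imp (fun e => by rw [← e, D.wick_wick]) fun ⟨K, k1, k2, k3⟩ =>
    ⟨K, k1, k2, by rw [k3, Set.pair_comm]⟩⟩

theorem twin_of_wick {A : Set D.V} {h h' : D.V × Field6} (h1 : h.1 ∈ A) (h2 : h'.1 ∈ A)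
    (e : D.wick h = h') : D.Twin A h h' :=
  ⟨fun e' => D.wick_ne h (e.trans e'.symm), h1, h2, Or.inl e⟩

theorem joined_of_wick (A : Set D.V) {h h' : D.V × Field6} (e : D.wick h = h') :
    D.Joined A h h' := by
  refine ⟨∅, Set.empty_disjoint A, fun k hk => Or.inr ?_⟩
  rcases hk with hk | rfl | rfl
  · exact absurd hk (Set.notMem_empty _)
  · exact Or.inr e
  · exact Or.inl (by rw [← e, D.wick_wick])

theorem joined_of_legs {A K : Set D.V} {h h' : D.V × Field6} (hd : Disjoint K A)
    (hl : D.legs K = {D.wick h, D.wick h'}) : D.Joined A h h' := by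
  refine ⟨K, hd, fun k hk => ?_⟩
  have h1 : (D.wick h) ∈ D.legs K := by rw [hl]; exact Or.inl rfl
  have h2 : (D.wick h') ∈ D.legs K := by rw [hl]; exact Or.inr rfl
  rcases hk with hk | rfl | rfl
  · by_cases hw : (D.wick k).1 ∈ K
    · exact Or.inl hw
    · have : k ∈ D.legs K := ⟨hk, hw⟩
      rw [hl] at this
      rcases this with rfl | rfl
      · exact Or.inr (Or.inl (D.wick_wick h))
      · exact Or.inr (Or.inr (D.wick_wick h'))
  · exact Or.inl h1.1
  · exact Or.inl h2.1

theorem Twin.joined {A : Set D.V} {h h' : D.V × Field6} (ht : D.Twin A h h') :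
    D.Joined A h h' := by
  rcases ht.2.2.2 with e | ⟨K, -, k2, k3⟩
  · exact joined_of_wick A e
  · exact joined_of_legs k2 k3

/-- A strand that enters the two-point subgraph at `h` has to leave at `h'`. Otherwise the
half-edges of its loop in `S` together with `h` are paired by contractions, and without `h` by inner
edges, which is impossible for parity. -/
theorem Joined.loop_eq {A : Set D.V} {h h' : D.V × Field6} (hj : D.Joined A h h') (h1 : h.1 ∈ A)
    (h2 : h'.1 ∈ A) (c : Colour) : D.loop c h = D.loop c h' := by
  obtain ⟨S, hS, hcl⟩ := hj
  by_contra hne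
  refine false_of_involutions (a := h)
    (T := {k | (k.1 ∈ S ∨ k = h ∨ k = h') ∧ D.loop c k = D.loop c h}) ⟨Or.inr (Or.inl rfl), rfl⟩
    D.wick (D.inner c) ?_ D.wick_wick D.wick_ne ?_ (D.inner_inner c) (D.inner_ne c)
  · exact fun k hk => ⟨hcl k hk.1, (D.loop_wick c k).trans hk.2⟩
  · rintro k ⟨hk, hl⟩ hkh
    have hkS : k.1 ∈ S := by
      rcases hk with hk | rfl | rfl
      · exact hk
      · exact absurd rfl hkh
      · exact absurd hl.symm hne
    refine ⟨⟨Or.inl hkS, (D.loop_inner c k).trans hl⟩, fun e => ?_⟩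
    exact Set.disjoint_left.1 hS hkS (e ▸ h1 : (D.inner c k).1 ∈ A)

theorem Twin.loop_eq {A : Set D.V} {h h' : D.V × Field6} (ht : D.Twin A h h') (c : Colour) :
    D.loop c h = D.loop c h' := ht.joined.loop_eq ht.2.1 ht.2.2.1 c

theorem subset_of_isConn {K K' : Set D.V} (hK : D.IsConn K) {u : D.V} (hu : u ∈ K) (hu' : u ∈ K')
    (h : ∀ k ∈ D.legs K', (D.wick k).1 ∉ K) : K ⊆ K' := by
  have := hK.2 (K ∩ K') Set.inter_subset_left ⟨u, hu, hu'⟩ fun k hk hw => ⟨hw, by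
    by_contra hw'
    exact h k ⟨hk.2, hw'⟩ hw⟩
  rw [← this]; exact Set.inter_subset_right

/-- Both sets are components of the complement of `A`, since they are connected and all their legs
end in `A`. -/
theorem eq_of_isConn {A K K' : Set D.V} (hK : D.IsConn K) (hK' : D.IsConn K')
    (hA : Disjoint K A) (hA' : Disjoint K' A) (hl : ∀ k ∈ D.legs K, (D.wick k).1 ∈ A)
    (hl' : ∀ k ∈ D.legs K', (D.wick k).1 ∈ A) {u : D.V} (hu : u ∈ K) (hu' : u ∈ K') : K = K' :=
  (subset_of_isConn hK hu hu' fun k hk hw => Set.disjoint_left.1 hA hw (hl' k hk)).antisymm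
    (subset_of_isConn hK' hu' hu fun k hk hw => Set.disjoint_left.1 hA' hw (hl k hk))

theorem wick_mem_of_legs_eq {A K : Set D.V} {h h' : D.V × Field6} (h1 : h.1 ∈ A) (h2 : h'.1 ∈ A)
    (hl : D.legs K = {D.wick h, D.wick h'}) : ∀ k ∈ D.legs K, (D.wick k).1 ∈ A := by
  intro k hk
  rw [hl] at hk
  rcases hk with rfl | rfl
  · rwa [D.wick_wick]
  · rwa [D.wick_wick]

theorem fst_mem_of_legs_eq {K : Set D.V} {k k' : D.V × Field6} (hl : D.legs K = {k, k'}) :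
    k.1 ∈ K := (show k ∈ D.legs K by rw [hl]; exact Or.inl rfl).1

/-- Two attached subgraphs that share the leg of `h` coincide, and their other leg determines the
twin. Hence twins define matchings of fields. -/
theorem Twin.unique {A : Set D.V} {h h' h'' : D.V × Field6} (ht : D.Twin A h h')
    (ht' : D.Twin A h h'') : h' = h'' := by
  obtain ⟨n1, a1, b1, c1⟩ := ht
  obtain ⟨n2, -, b2, c2⟩ := ht'
  rcases c1 with e | ⟨K, k1, k2, k3⟩ <;> rcases c2 with e' | ⟨K', k1', k2', k3'⟩
  · exact e.symm.trans e'
  · subst e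
    exact absurd b1 (Set.disjoint_left.1 k2' (fst_mem_of_legs_eq k3'))
  · subst e'
    exact absurd b2 (Set.disjoint_left.1 k2 (fst_mem_of_legs_eq k3))
  · obtain rfl := eq_of_isConn k1 k1' k2 k2' (wick_mem_of_legs_eq a1 b1 k3)
      (wick_mem_of_legs_eq a1 b2 k3') (fst_mem_of_legs_eq k3) (fst_mem_of_legs_eq k3')
    have : D.wick h' ∈ ({D.wick h, D.wick h''} : Set _) := by
      rw [← k3', k3]; exact Or.inr rfl
    rcases this with e | e
    · exact absurd (wick_injective e).symm n1
    · exact wick_injective e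

theorem disjoint_component {A : Set D.V} {u : D.V} (hu : u ∉ A) :
    Disjoint (D.component A u) A :=
  Set.disjoint_left.2 fun _ hv => notMem_of_mem_component hu hv

theorem ncard_wick_mem_component {A : Set D.V} {u : D.V} (hu : u ∉ A) :
    {h : D.V × Field6 | h.1 ∈ A ∧ (D.wick h).1 ∈ D.component A u}.ncard =
      (D.legs (D.component A u)).ncard := by
  rw [← Set.ncard_image_of_injective _ (wick_injective (D := D))]
  congr 1
  ext h
  constructor
  · rintro ⟨k, ⟨h1, h2⟩, rfl⟩
    exact ⟨h2, by rw [D.wick_wick]; exact fun hk => notMem_of_mem_component hu hk h1⟩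
  · exact fun hh => ⟨D.wick h, ⟨mem_legs_component hh, by rw [D.wick_wick]; exact hh.1⟩,
      D.wick_wick h⟩

/-- A leg of a connected vertex set of a planar diagram has a twin or is attached to a component
with at least six legs. -/
theorem IsPlanar.exists_twin_or (hD : D.IsPlanar) {A : Set D.V} (hA : D.IsConn A)
    {h : D.V × Field6} (hh : h.1 ∈ A) :
    (∃ h', D.Twin A h h') ∨
      (D.wick h).1 ∉ A ∧ 6 ≤ (D.legs (D.component A (D.wick h).1)).ncard := by
  by_cases hw : (D.wick h).1 ∈ A
  · exact Or.inl ⟨_, twin_of_wick hh hw rfl⟩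
  obtain ⟨m, h1, h2, -⟩ := hD.bond_component hA hw
  by_cases h6 : 6 ≤ (D.legs (D.component A (D.wick h).1)).ncard
  · exact Or.inr ⟨hw, h6⟩
  have hm : (D.legs (D.component A (D.wick h).1)).ncard = 2 := by
    obtain ⟨r, rfl⟩ := h2; omega
  obtain ⟨p, q, hpq, hl⟩ := Set.ncard_eq_two.1 hm
  have hmem : D.wick h ∈ D.legs (D.component A (D.wick h).1) :=
    ⟨self_mem_component _ _, by
      rw [D.wick_wick]; exact fun hk => notMem_of_mem_component hw hk hh⟩
  have key : ∀ p q, p ≠ q → D.legs (D.component A (D.wick h).1) = {p, q} → D.wick h = p →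
      ∃ h', D.Twin A h h' := by
    rintro p q hpq hl rfl
    refine ⟨D.wick q, fun e => hpq (by rw [e, D.wick_wick]), hh, ?_,
      Or.inr ⟨_, isConn_component hw, disjoint_component hw, by rw [D.wick_wick]; exact hl⟩⟩
    exact mem_legs_component (u := (D.wick h).1) (by rw [hl]; exact Or.inr rfl)
  rw [hl] at hmem
  rcases hmem with e | e
  · exact Or.inl (key p q hpq hl e)
  · exact Or.inl (key q p hpq.symm (by rw [hl, Set.pair_comm]) e)

/-! ### The vertices of a planar diagram -/

/-- Each loop passes the vertex at most once. -/
def IsRegular (D : Diagram) (v : D.V) : Prop :=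
  ∀ c i j, D.loop c (v, i) = D.loop c (v, j) → j = i ∨ j = edge (D.kind v) c i

/-- Sharing the loops of all colours would mean parallel edges of different colours between two
fields. -/
theorem IsRegular.false {v : D.V} (hv : D.IsRegular v) {i j : Field6} (hij : i ≠ j)
    (h : ∀ c, D.loop c (v, i) = D.loop c (v, j)) : False := by
  have h1 := (hv red i j (h red)).resolve_left hij.symm
  have h2 := (hv green i j (h green)).resolve_left hij.symm
  exact edge_ne_edge (D.kind v) (by decide) i (h1.symm.trans h2)

theorem ncard_fields (v : D.V) : {h : D.V × Field6 | h.1 = v}.ncard = 6 := by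
  have : {h : D.V × Field6 | h.1 = v} = (fun i => (v, i)) '' (Set.univ : Set Field6) := by
    ext ⟨u, i⟩; simp [eq_comm]
  rw [this, Set.ncard_image_of_injective _ (Prod.mk_right_injective v), Set.ncard_univ,
    Nat.card_eq_fintype_card, Fintype.card_fin]

/-- A vertex whose removal splits a planar diagram into pieces with two legs looks like a snail. -/
def IsSnailVertex (D : Diagram) (v : D.V) (s : Perm Field6) : Prop :=
  IsSnailPairing (D.kind v) s ∧ ∀ i, D.Twin {v} (v, i) (v, s i)

/-- A component with six legs takes all legs of `v`; then `v` is one side of a bond and each loop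
crosses it once. Otherwise all legs have twins, and `le_touching` gives at least two loops of each
colour at `v`. So the matching by twins forms no single cycle with the edges of any colour, hence
shares an edge with each of them. -/
theorem IsPlanar.isRegular_or_snail (hD : D.IsPlanar) (v : D.V) :
    D.IsRegular v ∨ ∃ s, D.IsSnailVertex v s := by
  by_cases hbig : ∃ i, (D.wick (v, i)).1 ∉ ({v} : Set D.V) ∧
      6 ≤ (D.legs (D.component {v} (D.wick (v, i)).1)).ncard
  · left
    obtain ⟨i₀, hu, h6⟩ := hbig
    rw [← ncard_wick_mem_component hu] at h6
    have hall : {h : D.V × Field6 | h.1 ∈ ({v} : Set D.V) ∧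
        (D.wick h).1 ∈ D.component {v} (D.wick (v, i₀)).1} = {h | h.1 = v} :=
      Set.eq_of_subset_of_ncard_le (fun h hh => hh.1) (by rw [ncard_fields]; exact h6)
    have hw : ∀ i, (D.wick (v, i)).1 ∈ D.component {v} (D.wick (v, i₀)).1 := fun i =>
      ((Set.ext_iff.1 hall (v, i)).2 rfl).2
    have hc := isConn_compl_component hD.conn (isConn_singleton v) hu
    have hv : ({v} : Set D.V) = (D.component {v} (D.wick (v, i₀)).1)ᶜ := by
      refine hc.2 {v} ?_ ⟨v, rfl⟩ ?_
      · rintro _ rfl hk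
        exact notMem_of_mem_component hu hk rfl
      · rintro ⟨_, i⟩ rfl hk
        exact absurd (hw i) hk
    obtain ⟨m, -, -, -, hb⟩ := hD.bond (isConn_singleton v) (by
      rw [hv, compl_compl]; exact isConn_component hu)
    have hleg : ∀ i, (v, i) ∈ D.legs {v} := fun i =>
      ⟨rfl, fun h => notMem_of_mem_component hu (hw i) h⟩
    intro c i j hij
    obtain ⟨p, q, -, e⟩ := Set.ncard_eq_two.1 (hb c (v, i) (hleg i))
    have m1 : (v, i) ∈ ({p, q} : Set _) := by rw [← e]; exact ⟨hleg i, rfl⟩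
    have m2 : (v, edge (D.kind v) c i) ∈ ({p, q} : Set _) := by
      rw [← e]; exact ⟨hleg _, D.loop_edge c v i⟩
    have m3 : (v, j) ∈ ({p, q} : Set _) := by rw [← e]; exact ⟨hleg _, hij.symm⟩
    have hne := edge_ne (D.kind v) c i
    refine (eq_or_eq_of_mem_pair m1 m2 m3 fun e => hne (congrArg Prod.snd e)).imp
      (congrArg Prod.snd) (congrArg Prod.snd)
  · right
    have htw : ∀ i, ∃ j, D.Twin {v} (v, i) (v, j) := by
      intro i
      rcases hD.exists_twin_or (isConn_singleton v) (h := (v, i)) rfl with ⟨⟨u, j⟩, ht⟩ | h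
      · obtain rfl : u = v := ht.2.2.1
        exact ⟨j, ht⟩
      · exact absurd ⟨i, h⟩ hbig
    choose s hs using htw
    have hss : ∀ i, s (s i) = i := fun i =>
      congrArg Prod.snd ((hs (s i)).unique (hs i).symm)
    have hsne : ∀ i, s i ≠ i := fun i e => (hs i).1 (by rw [e])
    refine ⟨(show Function.Involutive s from hss).toPerm, ?_, hs⟩
    refine isSnailPairing_of_common_edges _ _ hss fun c => ?_
    have h1 := hD.le_touching (isConn_singleton v) c
      (Set.toFinite {K | ∃ u, u ∉ ({v} : Set D.V) ∧ D.component {v} u = K}).toFinset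
      (fun K => by simp)
    rw [Set.ncard_singleton] at h1
    have h2 : 1 < (D.touching c {v}).ncard := by omega
    obtain ⟨_, ⟨⟨u, i⟩, hu, rfl⟩, _, ⟨⟨u', j⟩, hu', rfl⟩, hne⟩ :=
      (Set.one_lt_ncard (Set.toFinite _)).1 h2
    obtain rfl : u = v := hu
    obtain rfl : u' = u := hu'
    exact exists_common_edge s _ hss hsne (edge_edge _ c) (edge_ne _ c)
      {k | D.loop c (u', k) = D.loop c (u', i)}
      (fun k hk => ((hs k).loop_eq c).symm.trans hk)
      (fun k hk => (D.loop_edge c u' k).trans hk) ⟨i, rfl⟩ ⟨j, fun h => hne h.symm⟩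

/-! ### Two-cycles between regular vertices -/

theorem three_edges (k : Interaction) (c : Colour) : ∃ p q r, ∀ j,
    j = p ∨ j = edge k c p ∨ j = q ∨ j = edge k c q ∨ j = r ∨ j = edge k c r := by
  revert k c; decide +kernel

theorem ncard_touching_singleton_le (c : Colour) (v : D.V) : (D.touching c {v}).ncard ≤ 3 := by
  obtain ⟨p, q, r, h⟩ := three_edges (D.kind v) c
  have hsub : D.touching c {v} ⊆ {D.loop c (v, p), D.loop c (v, q), D.loop c (v, r)} := by
    rintro _ ⟨⟨u, j⟩, hu, rfl⟩
    obtain rfl : u = v := hu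
    rcases h j with rfl | rfl | rfl | rfl | rfl | rfl <;> simp [loop_edge]
  refine (Set.ncard_le_ncard hsub).trans ((Set.ncard_insert_le _ _).trans ?_)
  have := Set.ncard_insert_le (D.loop c (v, q)) {D.loop c (v, r)}
  rw [Set.ncard_singleton] at this
  omega

theorem Twin.edge_eq {A : Set D.V} {L R : D.V} (hR : D.IsRegular R) {c : Colour}
    {i j i' j' : Field6} (h : D.Twin A (L, i) (R, j)) (h' : D.Twin A (L, i') (R, j'))
    (e : edge (D.kind L) c i = i') : edge (D.kind R) c j = j' := by
  have h1 : D.loop c (R, j) = D.loop c (R, j') := by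
    rw [← h.loop_eq c, ← h'.loop_eq c, ← e, loop_edge]
  rcases hR c j j' h1 with rfl | h2
  · have := congrArg Prod.snd (h.symm.unique h'.symm)
    exact absurd (e.trans this.symm) (edge_ne _ _ _)
  · exact h2.symm

/-- A two-cycle between regular vertices of a planar diagram: either all legs of one vertex are
joined with those of the other, or three legs that form a triangle in both vertices are. -/
theorem IsPlanar.two_cycle (hD : D.IsPlanar) {L R : D.V} (hLR : L ≠ R) (hL : D.IsRegular L)
    (hR : D.IsRegular R) {x y z w : Field6} (hxz : x ≠ z) (h1 : D.wick (L, x) = (R, y))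
    (h2 : D.wick (L, z) = (R, w)) :
    (∃ ρ : Field6 → Field6, (∀ i, D.Twin {L, R} (L, i) (R, ρ i)) ∧
      ∀ c i, ρ (edge (D.kind L) c i) = edge (D.kind R) c (ρ i)) ∨
    (∃ t t', t ≠ x ∧ t ≠ z ∧ D.Twin {L, R} (L, t) (R, t') ∧
      ∀ c, edge (D.kind L) c x = z ∧ edge (D.kind R) c y = w ∨
        edge (D.kind L) c x = t ∧ edge (D.kind R) c y = t' ∨
        edge (D.kind L) c z = t ∧ edge (D.kind R) c w = t') := by
  have hA : D.IsConn {L, R} := isConn_pair (h := (L, x)) rfl (by rw [h1])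
  have mL : L ∈ ({L, R} : Set D.V) := Or.inl rfl
  have mR : R ∈ ({L, R} : Set D.V) := Or.inr rfl
  have hyw : y ≠ w := fun e => hxz (congrArg Prod.snd (wick_injective (h1.trans (e ▸ h2.symm))))
  have tx : D.Twin {L, R} (L, x) (R, y) := twin_of_wick mL mR h1
  have tz : D.Twin {L, R} (L, z) (R, w) := twin_of_wick mL mR h2
  -- Twins share the loops of all three colours, so two legs of a regular vertex are never twins.
  have ofL : ∀ i h', D.Twin {L, R} (L, i) h' → ∃ j, h' = (R, j) := by
    rintro i ⟨u, j⟩ ht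
    rcases ht.2.2.1 with rfl | rfl
    · exact (hL.false (fun e => ht.1 (by rw [e])) ht.loop_eq).elim
    · exact ⟨j, rfl⟩
  have ofR : ∀ i h', D.Twin {L, R} (R, i) h' → ∃ j, h' = (L, j) := by
    rintro i ⟨u, j⟩ ht
    rcases ht.2.2.1 with rfl | rfl
    · exact ⟨j, rfl⟩
    · exact (hR.false (fun e => ht.1 (by rw [e])) ht.loop_eq).elim
  by_cases hbig : ∃ h : D.V × Field6, h.1 ∈ ({L, R} : Set D.V) ∧
      (D.wick h).1 ∉ ({L, R} : Set D.V) ∧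
      6 ≤ (D.legs (D.component {L, R} (D.wick h).1)).ncard
  · right
    obtain ⟨h₀, -, hu, h6⟩ := hbig
    set K := D.component {L, R} (D.wick h₀).1 with hK
    let B (u : D.V) : Set (D.V × Field6) :=
      {h | h.1 ∈ ({L, R} : Set D.V) ∧ (D.wick h).1 ∈ D.component {L, R} u}
    let X : Set (D.V × Field6) := {(L, x), (L, z), (R, y), (R, w)}
    have hX : X.ncard = 4 := by
      have e1 : (L, x) ≠ (L, z) := fun e => hxz (congrArg Prod.snd e)
      have e2 : (R, y) ≠ (R, w) := fun e => hyw (congrArg Prod.snd e)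
      simp only [X]
      rw [Set.ncard_insert_of_notMem, Set.ncard_insert_of_notMem, Set.ncard_pair e2] <;>
        simp [hxz, hLR]
    have h12 : {h : D.V × Field6 | h.1 ∈ ({L, R} : Set D.V)}.ncard = 12 := by
      have : {h : D.V × Field6 | h.1 ∈ ({L, R} : Set D.V)} = {h | h.1 = L} ∪ {h | h.1 = R} := by
        ext h; simp
      rw [this, Set.ncard_union_eq, ncard_fields, ncard_fields]
      exact Set.disjoint_left.2 fun h e e' => hLR (e.symm.trans e')
    have hXA : X ⊆ {h | h.1 ∈ ({L, R} : Set D.V)} := by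
      rintro _ (rfl | rfl | rfl | rfl) <;> simp
    have hXw : ∀ h ∈ X, (D.wick h).1 ∈ ({L, R} : Set D.V) := by
      have h1' : D.wick (R, y) = (L, x) := by rw [← h1, D.wick_wick]
      have h2' : D.wick (R, w) = (L, z) := by rw [← h2, D.wick_wick]
      rintro _ (rfl | rfl | rfl | rfl) <;> simp [h1, h2, h1', h2']
    have hXB : ∀ u, u ∉ ({L, R} : Set D.V) → Disjoint X (B u) := fun u hu =>
      Set.disjoint_left.2 fun h hh hb => notMem_of_mem_component hu hb.2 (hXw h hh)
    have hBK : (B (D.wick h₀).1).ncard = (D.legs K).ncard := ncard_wick_mem_component hu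
    -- Four of the twelve half-edges lie on the 2-cycle. At most eight can lead to the large
    -- component, whose number of legs is twice an odd number: it is six.
    have hle8 : (B (D.wick h₀).1).ncard + 4 ≤ 12 := by
      rw [← hX, ← h12, add_comm, ← Set.ncard_union_eq (hXB _ hu)]
      exact Set.ncard_le_ncard (Set.union_subset hXA fun h hh => hh.1)
    have hK6 : (D.legs K).ncard = 6 := by
      obtain ⟨m, e1, ⟨r, rfl⟩, -⟩ := hD.bond_component hA hu
      rw [← hK] at e1
      omega
    -- A second large component would need `6 + 6 + 4` of the twelve half-edges.
    have htwin : ∀ h : D.V × Field6, h.1 ∈ ({L, R} : Set D.V) → (D.wick h).1 ∉ K →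
        ∃ h', D.Twin {L, R} h h' := by
      intro h hh hw
      refine (hD.exists_twin_or hA hh).resolve_right ?_
      rintro ⟨hu', h6'⟩
      rw [← ncard_wick_mem_component hu'] at h6'
      change 6 ≤ (B (D.wick h).1).ncard at h6'
      have hd : Disjoint (B (D.wick h₀).1) (B (D.wick h).1) := by
        refine Set.disjoint_left.2 fun k hk hk' => hw ?_
        rw [hK, ← component_eq hu hk.2, component_eq hu' hk'.2]
        exact self_mem_component _ _
      have hd' : Disjoint X (B (D.wick h₀).1 ∪ B (D.wick h).1) :=
        Set.disjoint_union_right.2 ⟨hXB _ hu, hXB _ hu'⟩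
      have := Set.ncard_le_ncard (s := X ∪ (B (D.wick h₀).1 ∪ B (D.wick h).1))
        (t := {h | h.1 ∈ ({L, R} : Set D.V)})
        (Set.union_subset hXA (Set.union_subset (fun h hh => hh.1) fun h hh => hh.1))
      rw [Set.ncard_union_eq hd', Set.ncard_union_eq hd, h12, hX] at this
      omega
    -- The large component and the 2-cycle use only `6 + 4` half-edges; a remaining one gives the
    -- third pair of twins.
    obtain ⟨k, ⟨hkA, hkK⟩, hkX⟩ : ∃ k : D.V × Field6,
        (k.1 ∈ ({L, R} : Set D.V) ∧ (D.wick k).1 ∉ K) ∧ k ∉ X := by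
      by_contra hno
      have hsub : {h : D.V × Field6 | h.1 ∈ ({L, R} : Set D.V)} ⊆ B (D.wick h₀).1 ∪ X := by
        intro h hh
        by_contra hn
        rw [Set.mem_union, not_or] at hn
        exact hno ⟨h, ⟨hh, fun hw => hn.1 ⟨hh, hw⟩⟩, hn.2⟩
      have := (Set.ncard_le_ncard hsub).trans (Set.ncard_union_le _ _)
      omega
    obtain ⟨t, t', htx, htz, ht⟩ : ∃ t t', t ≠ x ∧ t ≠ z ∧ D.Twin {L, R} (L, t) (R, t') := by
      obtain ⟨k', hk'⟩ := htwin k hkA hkK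
      obtain ⟨u, i⟩ := k
      rcases hkA with rfl | rfl
      · obtain ⟨j, rfl⟩ := ofL i k' hk'
        exact ⟨i, j, fun e => hkX (by simp [X, e]), fun e => hkX (by simp [X, e]), hk'⟩
      · obtain ⟨j, rfl⟩ := ofR i k' hk'
        refine ⟨j, i, ?_, ?_, hk'.symm⟩
        · rintro rfl
          exact hkX (by rw [hk'.symm.unique tx]; simp [X])
        · rintro rfl
          exact hkX (by rw [hk'.symm.unique tz]; simp [X])
    refine ⟨t, t', htx, htz, ht, fun c => ?_⟩
    have g1 := hD.le_touching hA c
      (Set.toFinite {K | ∃ u, u ∉ ({L, R} : Set D.V) ∧ D.component {L, R} u = K}).toFinset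
      (fun K => by simp)
    have g2 := Finset.single_le_sum (f := fun K => (D.legs K).ncard - 2) (fun _ _ => Nat.zero_le _)
      (show K ∈ (Set.toFinite {K | ∃ u, u ∉ ({L, R} : Set D.V) ∧
        D.component {L, R} u = K}).toFinset by simpa using ⟨_, by simpa using hu, rfl⟩)
    have g3 : D.touching c {L, R} = D.touching c {L} ∪ D.touching c {R} := by
      ext l
      constructor
      · rintro ⟨h, hh | hh, e⟩
        · exact Or.inl ⟨h, hh, e⟩
        · exact Or.inr ⟨h, hh, e⟩
      · rintro (⟨h, hh, e⟩ | ⟨h, hh, e⟩)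
        · exact ⟨h, Or.inl hh, e⟩
        · exact ⟨h, Or.inr hh, e⟩
    have g4 := Set.ncard_union_add_ncard_inter (D.touching c {L}) (D.touching c {R})
    rw [← g3] at g4
    have g5 := ncard_touching_singleton_le c L
    have g6 := ncard_touching_singleton_le c R
    -- `le_touching` reads `4 + 4 * 2 + (6 - 2) ≤ 4 * touching`, so at least four loops touch the
    -- pair; each vertex is touched by at most three, hence at most two are shared.
    have g7 : (D.touching c {L} ∩ D.touching c {R}).ncard ≤ 2 := by
      rw [Set.ncard_pair hLR] at g1
      simp only [hK6] at g2
      omega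
    have g8 : ∀ i j, D.Twin {L, R} (L, i) (R, j) →
        D.loop c (L, i) ∈ D.touching c {L} ∩ D.touching c {R} :=
      fun i j hij => ⟨⟨(L, i), rfl, rfl⟩, ⟨(R, j), rfl, (hij.loop_eq c).symm⟩⟩
    -- Three pairs of twins lie on shared loops, of which there are at most two of each colour.
    have g9 : D.loop c (L, x) = D.loop c (L, z) ∨ D.loop c (L, x) = D.loop c (L, t) ∨
        D.loop c (L, z) = D.loop c (L, t) := by
      by_contra hne
      rw [not_or, not_or] at hne
      have hsub : ({D.loop c (L, x), D.loop c (L, z), D.loop c (L, t)} : Set _) ⊆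
          D.touching c {L} ∩ D.touching c {R} := by
        rintro _ (rfl | rfl | rfl)
        · exact g8 _ _ tx
        · exact g8 _ _ tz
        · exact g8 _ _ ht
      have := Set.ncard_le_ncard hsub
      rw [Set.ncard_insert_of_notMem (by simpa using ⟨hne.1, hne.2.1⟩),
        Set.ncard_pair hne.2.2] at this
      omega
    rcases g9 with e | e | e
    · have e' := ((hL c x z e).resolve_left hxz.symm).symm
      exact Or.inl ⟨e', tx.edge_eq hR tz e'⟩
    · have e' := ((hL c x t e).resolve_left htx).symm
      exact Or.inr (Or.inl ⟨e', tx.edge_eq hR ht e'⟩)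
    · have e' := ((hL c z t e).resolve_left htz).symm
      exact Or.inr (Or.inr ⟨e', tz.edge_eq hR ht e'⟩)
  · left
    have htw : ∀ i, ∃ j, D.Twin {L, R} (L, i) (R, j) := by
      intro i
      rcases hD.exists_twin_or hA (h := (L, i)) mL with ⟨h', ht⟩ | h
      · obtain ⟨j, rfl⟩ := ofL i h' ht
        exact ⟨j, ht⟩
      · exact absurd ⟨_, mL, h⟩ hbig
    choose ρ hρ using htw
    exact ⟨ρ, hρ, fun c i => ((hρ i).edge_eq hR (hρ _) rfl).symm⟩

/-! ### Maximal diagrams are planar -/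

theorem isConn_univ_iff :
    D.IsConn Set.univ ↔ Nonempty D.V ∧ ∀ u v : D.V, Relation.ReflTransGen D.Adj u v := by
  constructor
  · rintro ⟨⟨u, -⟩, h⟩
    refine ⟨⟨u⟩, fun u v => ?_⟩
    have := h {v | Relation.ReflTransGen D.Adj u v} (Set.subset_univ _)
      ⟨u, Relation.ReflTransGen.refl⟩ fun k hk _ => Relation.ReflTransGen.tail hk (adj_wick k)
    exact (this ▸ Set.mem_univ v : v ∈ {v | Relation.ReflTransGen D.Adj u v})
  · rintro ⟨⟨u⟩, h⟩
    refine ⟨⟨u, trivial⟩, fun T _ ⟨t, ht⟩ hcl => Set.eq_univ_of_forall fun v => ?_⟩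
    induction h t v with
    | refl => exact ht
    | tail _ h2 ih =>
      obtain ⟨i, j, e⟩ := h2
      have := hcl (_, i) ih trivial
      rwa [e] at this

theorem connected_iff : D.Connected ↔ D.IsZeroCycle ∨ D.circles = 0 ∧ D.IsConn Set.univ := by
  rw [isConn_univ_iff, Connected]; tauto

theorem innerLoops_univ (c : Colour) : D.innerLoops c Set.univ = Set.univ :=
  Set.eq_univ_of_forall fun _ _ _ => trivial

theorem card_loop_add_le (hD : D.IsConn Set.univ) {a b : Colour} (hab : a ≠ b) :
    Nat.card (D.Loop a) + Nat.card (D.Loop b) ≤ 2 * Nat.card D.V + 2 := by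
  have := euler_bound hD hab
  rw [legs_univ, if_pos rfl, innerLoops_univ, innerLoops_univ, Set.ncard_univ, Set.ncard_univ,
    Set.ncard_univ, Set.ncard_empty] at this
  omega

theorem IsZeroCycle.fTotal (h : D.IsZeroCycle) : D.fTotal = 3 * D.numVertices + 3 := by
  have := h.1
  have hl : ∀ c, Nat.card (D.Loop c) = 0 := fun c => by
    have : IsEmpty (D.Loop c) := ⟨fun l => by
      obtain ⟨h, -⟩ := D.loop_surjective c l
      exact isEmptyElim h.1⟩
    exact Nat.card_of_isEmpty
  rw [Diagram.fTotal, numVertices, hl, hl, hl, h.2, Nat.card_of_isEmpty]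

/-- The Euler bounds of the three pairs of colours count each loop twice. -/
theorem Connected.fTotal_le (h : D.Connected) : D.fTotal ≤ 3 * D.numVertices + 3 := by
  rcases connected_iff.1 h with h | ⟨h0, h⟩
  · exact h.fTotal.le
  · have h1 := card_loop_add_le h (show red ≠ green by decide)
    have h2 := card_loop_add_le h (show green ≠ blue by decide)
    have h3 := card_loop_add_le h (show red ≠ blue by decide)
    rw [Diagram.fTotal, numVertices, h0]
    omega

/-- The fields on the long loop of each colour in a necklace of prism snails. -/
def necklaceFields : Colour → Finset Field6
  | red => {0, 1}
  | green => {0, 1, 2, 5}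
  | blue => {0, 1, 3, 4}

/-- A ring of `n + 1` elementary snails. -/
def necklace (n : ℕ) : Diagram where
  V := ZMod (n + 1)
  finite := inferInstance
  kind := fun _ => prism
  wick := fun h => if h.2 = 1 then (h.1 + 1, 0) else if h.2 = 0 then (h.1 - 1, 1)
    else (h.1, snailPairing prism h.2)
  wick_wick := by
    have h : ∀ i : Field6, i ≠ 1 → i ≠ 0 →
        snailPairing prism i ≠ 1 ∧ snailPairing prism i ≠ 0 := by decide
    rintro ⟨j, i⟩
    by_cases h1 : i = 1
    · subst h1; simp
    by_cases h6 : i = 0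
    · subst h6; simp
    obtain ⟨h1', h6'⟩ := h i h1 h6
    simp [h1, h6, h1', h6', snailPairing_snailPairing]
  wick_ne := by
    rintro ⟨j, i⟩ e
    by_cases h1 : i = 1
    · subst h1; simp at e
    by_cases h6 : i = 0
    · subst h6; simp at e
    simp [h1, h6, snailPairing_ne] at e
  circles := 0

theorem necklace_connected (n : ℕ) : (necklace n).Connected := by
  refine connected_iff.2 (Or.inr ⟨rfl, ⟨(0 : ZMod (n + 1)), trivial⟩, ?_⟩)
  change ∀ T : Set (ZMod (n + 1)), _
  rintro T - ⟨(t : ZMod (n + 1)), ht⟩ hcl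
  refine Set.eq_univ_of_forall fun (v : ZMod (n + 1)) => ?_
  have hstep : ∀ j : ZMod (n + 1), j ∈ T → j + 1 ∈ T := fun j hj => hcl (j, 1) hj trivial
  have : ∀ m : ℕ, t + (m : ZMod (n + 1)) ∈ T := by
    intro m
    induction m with
    | zero => rw [Nat.cast_zero, add_zero]; exact ht
    | succ m ih => rw [Nat.cast_succ, ← add_assoc]; exact hstep _ ih
  have hv := this (ZMod.val (v - t))
  rwa [ZMod.natCast_val, ZMod.cast_id, add_sub_cancel] at hv

/-- Each colour has a long loop around the ring, which `F` sends to `none`, and at least one loop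
confined to each of the `n + 1` snails. The field labelled 6 is `0` in `Field6`. -/
theorem le_card_loop_necklace (n : ℕ) (c : Colour) :
    n + 2 ≤ Nat.card ((necklace n).Loop c) := by
  let F : (necklace n).Loop c → Option (ZMod (n + 1)) :=
    Quot.lift (fun h => if h.2 ∈ necklaceFields c then none else some h.1) (by
      have h1 : ∀ c, 1 ∈ necklaceFields c ∧ 0 ∈ necklaceFields c := by decide
      have h2 : ∀ c i, snailPairing prism i ∈ necklaceFields c ↔ i ∈ necklaceFields c := by decide
      have h3 : ∀ c i, edge prism c i ∈ necklaceFields c ↔ i ∈ necklaceFields c := by decide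
      rintro ⟨(j : ZMod (n + 1)), i⟩ _ (rfl | rfl)
      · simp only [necklace]
        by_cases e1 : i = 1
        · simp [e1, h1]
        by_cases e6 : i = 0
        · simp [e6, h1]
        simp [e1, e6, h2]
      · simp [necklace, h3])
  have hF : Function.Surjective F := by
    have h4 : ∀ c, ∃ i, i ∉ necklaceFields c := by decide
    have h1 : ∀ c, 1 ∈ necklaceFields c := by decide
    rintro (_ | j)
    · exact ⟨Quot.mk _ ((0 : ZMod (n + 1)), 1), if_pos (h1 c)⟩
    · obtain ⟨i, hi⟩ := h4 c
      exact ⟨Quot.mk _ (j, i), if_neg hi⟩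
  have := Nat.card_le_card_of_surjective F hF
  rw [Finite.card_option, Nat.card_zmod] at this
  exact this

theorem exists_connected_fTotal (n : ℕ) :
    ∃ D : Diagram, D.Connected ∧ D.numVertices = n ∧ 3 * n + 3 ≤ D.fTotal := by
  cases n with
  | zero =>
    let Z : Diagram := ⟨Empty, inferInstance, fun v => v.elim, id, fun _ => rfl,
      fun h => h.1.elim, 1⟩
    have hZ : Z.IsZeroCycle := ⟨inferInstanceAs (IsEmpty Empty), rfl⟩
    have h0 : Z.numVertices = 0 := Nat.card_of_isEmpty (α := Empty)
    exact ⟨Z, Or.inl hZ, h0, by rw [hZ.fTotal, h0]⟩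
  | succ n =>
    refine ⟨necklace n, necklace_connected n, Nat.card_zmod (n + 1), ?_⟩
    have h1 := le_card_loop_necklace n red
    have h2 := le_card_loop_necklace n green
    have h3 := le_card_loop_necklace n blue
    rw [Diagram.fTotal]
    omega

/-- The upper bound is attained for every number of vertices, by the 0-cycle or a necklace. -/
theorem isMaximal_iff :
    D.IsMaximal ↔ D.Connected ∧ D.fTotal = 3 * D.numVertices + 3 := by
  constructor
  · rintro ⟨h1, h2⟩
    obtain ⟨D', c', n', f'⟩ := exists_connected_fTotal D.numVertices
    have := h2 D' c' n'
    have := h1.fTotal_le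
    exact ⟨h1, by omega⟩
  · rintro ⟨h1, h2⟩
    exact ⟨h1, fun D' c' n' => by rw [h2, ← n']; exact c'.fTotal_le⟩

/-- Equality in the sum of the three Euler bounds makes each of them sharp, and three sharp pair
sums fix each colour. -/
theorem IsMaximal.isPlanar (h : D.IsMaximal) [hV : Nonempty D.V] :
    D.IsPlanar ∧ D.circles = 0 := by
  obtain ⟨h1, h2⟩ := isMaximal_iff.1 h
  rcases connected_iff.1 h1 with h | ⟨h0, h⟩
  · exact (not_isEmpty_of_nonempty D.V h.1).elim
  · have e1 := card_loop_add_le h (show red ≠ green by decide)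
    have e2 := card_loop_add_le h (show green ≠ blue by decide)
    have e3 := card_loop_add_le h (show red ≠ blue by decide)
    rw [Diagram.fTotal, numVertices, h0] at h2
    exact ⟨⟨h, fun c => by cases c <;> omega⟩, h0⟩

/-! ### Short cycles of planar diagrams -/

theorem IsRegular.not_oneCycle {v : D.V} (hv : D.IsRegular v) {x y : Field6} :
    D.wick (v, x) ≠ (v, y) := by
  intro e
  refine hv.false (i := x) (j := y) (fun h => D.wick_ne (v, x) (by rw [e, h])) fun c => ?_
  rw [← e, loop_wick]

theorem IsPlanar.isSnailForm (hD : D.IsPlanar) {v : D.V} {x y : Field6}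
    (h : D.IsOneCycle v x y) : D.IsSnailForm v x y := by
  rcases hD.isRegular_or_snail v with hv | ⟨s, hs, ht⟩
  · exact absurd h hv.not_oneCycle
  · have e : s x = y := congrArg Prod.snd
      ((ht x).unique (twin_of_wick (A := {v}) (h := (v, x)) (h' := (v, y)) rfl rfl h))
    exact ⟨s, hs, e, fun i _ _ => (ht i).joined⟩

/-- The two legs of a snail vertex in a two-cycle are twins, and their component contains the
other vertex of the cycle. -/
theorem IsSnailVertex.twoCycle {L R : D.V} (hLR : L ≠ R) {s : Perm Field6}
    (hs : D.IsSnailVertex L s) {x y z w : Field6} (hxz : x ≠ z) (h1 : D.wick (L, x) = (R, y))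
    (h2 : D.wick (L, z) = (R, w)) :
    s x = z ∧ ∀ i, i ≠ x → i ≠ z → D.wick (L, i) = (L, s i) ∨
      ∃ K, D.IsConn K ∧ Disjoint K {L, R} ∧ D.legs K = {D.wick (L, i), D.wick (L, s i)} := by
  obtain ⟨n1, a1, b1, c1⟩ := hs.2 x
  have hw : D.wick (R, w) = (L, z) := by rw [← h2, D.wick_wick]
  obtain ⟨K, k1, k2, k3⟩ : ∃ K, D.IsConn K ∧ Disjoint K {L} ∧
      D.legs K = {D.wick (L, x), D.wick (L, s x)} := by
    refine c1.resolve_left fun e => hLR ?_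
    rw [h1] at e
    exact (congrArg Prod.fst e).symm
  have hR : R ∈ K := by
    have := fst_mem_of_legs_eq k3
    rwa [h1] at this
  have hmem : (R, w) ∈ D.legs K :=
    ⟨hR, by rw [hw]; exact fun hL => Set.disjoint_left.1 k2 hL rfl⟩
  have e : s x = z := by
    rw [k3] at hmem
    rcases hmem with e | e
    · rw [← h2] at e
      exact absurd (congrArg Prod.snd (wick_injective e)).symm hxz
    · rw [← h2] at e
      exact (congrArg Prod.snd (wick_injective e)).symm
  refine ⟨e, fun i hx hz => (hs.2 i).2.2.2.imp_right ?_⟩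
  rintro ⟨K', k1', k2', k3'⟩
  refine ⟨K', k1', ?_, k3'⟩
  rw [Set.disjoint_insert_right, Set.disjoint_singleton_right]
  refine ⟨Set.disjoint_singleton_right.1 k2', fun hR' => ?_⟩
  -- If the subgraph at another pair of legs also contained `R`, it would be `K`, whose only legs
  -- are those at `x` and `z`.
  have hKK := eq_of_isConn k1 k1' k2 k2' (wick_mem_of_legs_eq a1 b1 k3)
    (wick_mem_of_legs_eq (A := {L}) (h := (L, i)) (h' := (L, s i)) rfl rfl k3') hR hR'
  subst hKK
  have hi : D.wick (L, i) ∈ ({D.wick (L, x), D.wick (L, s x)} : Set _) := by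
    rw [← k3, k3']; exact Or.inl rfl
  rcases hi with h | h
  · exact hx (congrArg Prod.snd (wick_injective h))
  · exact hz ((congrArg Prod.snd (wick_injective h)).trans e)

/-- Walking twice along red, green and blue edges is closed in the wheel, but not in the prism. -/
theorem prism_not_iso_wheel (ρ : Field6 → Field6) (hρ : Function.Injective ρ)
    (h : ∀ c i, ρ (edge prism c i) = edge wheel c (ρ i)) : False := by
  have hw : ∀ i, edge wheel red (edge wheel green (edge wheel blue
      (edge wheel red (edge wheel green (edge wheel blue i))))) = i := by decide
  have hp : edge prism red (edge prism green (edge prism blue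
      (edge prism red (edge prism green (edge prism blue 1))))) = 6 := by decide
  have := hw (ρ 1)
  rw [← h, ← h, ← h, ← h, ← h, ← h, hp] at this
  exact absurd (hρ this) (by decide)

/-- `K_{3,3}` is bipartite; a triangle is the only way to satisfy the condition for all three
colours. -/
theorem wheel_no_triangle (y w t : Field6) (hyw : y ≠ w) :
    ¬ ∀ c, edge wheel c y = w ∨ edge wheel c y = t ∨ edge wheel c w = t := by
  revert y w t; decide

theorem IsMixedTwoCycle.ne {L R : D.V} {x y z w : Field6}
    (h : D.IsMixedTwoCycle L R x y z w) : L ≠ R := by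
  rintro rfl
  exact absurd (h.1.symm.trans h.2.1) (by decide)

theorem IsMixedTwoCycle.ne' {L R : D.V} {x y z w : Field6}
    (h : D.IsMixedTwoCycle L R x y z w) : y ≠ w := by
  obtain ⟨-, -, h3, h4, h5⟩ := h
  rintro rfl
  exact h3 (congrArg Prod.snd (wick_injective (h4.trans h5.symm)))

/-- Between regular vertices `two_cycle` would give an isomorphism of prism and wheel or a triangle
in the wheel. If one end is a snail, the two legs on the cycle are twins and share all loops; the
contractions carry this to the other end, which is then not regular either. -/
theorem IsPlanar.mixedTwoCycle (hD : D.IsPlanar) {L R : D.V} {x y z w : Field6}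
    (h : D.IsMixedTwoCycle L R x y z w) :
    ∃ s t, D.IsSnailVertex L s ∧ D.IsSnailVertex R t := by
  have hLR := h.ne
  have hyw := h.ne'
  obtain ⟨hkL, hkR, hxz, h1, h2⟩ := h
  have h1' : D.wick (R, y) = (L, x) := by rw [← h1, D.wick_wick]
  have h2' : D.wick (R, w) = (L, z) := by rw [← h2, D.wick_wick]
  have key : ∀ {L R : D.V} {x y z w : Field6}, L ≠ R → x ≠ z → y ≠ w → D.wick (L, x) = (R, y) →
      D.wick (L, z) = (R, w) → ∀ s, D.IsSnailVertex L s → ∃ t, D.IsSnailVertex R t := by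
    intro L R x y z w hLR hxz hyw h1 h2 s hs
    refine (hD.isRegular_or_snail R).resolve_left fun hR => hR.false hyw fun c => ?_
    have := (hs.2 x).loop_eq c
    rw [(hs.twoCycle hLR hxz h1 h2).1] at this
    rw [← h1, ← h2, loop_wick, loop_wick, this]
  rcases hD.isRegular_or_snail L with hL | ⟨s, hs⟩
  · rcases hD.isRegular_or_snail R with hR | ⟨t, ht⟩
    · exfalso
      rcases hD.two_cycle hLR hL hR hxz h1 h2 with ⟨ρ, hρ, hc⟩ | ⟨t, t', -, -, -, hc⟩
      · refine prism_not_iso_wheel ρ (fun i j e => ?_) (by rwa [hkL, hkR] at hc)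
        have := hρ j
        rw [← e] at this
        exact congrArg Prod.snd ((hρ i).symm.unique this.symm)
      · refine wheel_no_triangle y w t' hyw fun c => ?_
        have := hc c
        rw [hkR] at this
        tauto
    · obtain ⟨s, hs⟩ := key hLR.symm hyw hxz h1' h2' t ht
      exact ⟨s, t, hs, ht⟩
  · obtain ⟨t, ht⟩ := key hLR hxz hyw h1 h2 s hs
    exact ⟨s, t, hs, ht⟩

theorem IsMixedTwoCycle.isDoubleSnail {L R : D.V} {x y z w : Field6}
    (h : D.IsMixedTwoCycle L R x y z w) {s t : Perm Field6} (hs : D.IsSnailVertex L s)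
    (ht : D.IsSnailVertex R t) :
    s x = z ∧ t y = w ∧ D.IsDoubleSnail L R x y z w ∧ ¬ D.IsMelonForm L R x y z w := by
  have hLR := h.ne
  have hyw := h.ne'
  obtain ⟨hkL, hkR, hxz, h1, h2⟩ := h
  have h1' : D.wick (R, y) = (L, x) := by rw [← h1, D.wick_wick]
  have h2' : D.wick (R, w) = (L, z) := by rw [← h2, D.wick_wick]
  obtain ⟨ex, jx⟩ := hs.twoCycle hLR hxz h1 h2
  obtain ⟨ey, jy⟩ := ht.twoCycle hLR.symm hyw h1' h2'
  refine ⟨ex, ey, ⟨⟨s, hs.1, ex, fun i hi hi' => ?_⟩, ⟨t, ht.1, ey, fun i hi hi' => ?_⟩⟩, ?_⟩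
  · rcases jx i hi hi' with e | ⟨K, -, k2, k3⟩
    · exact joined_of_wick _ e
    · exact joined_of_legs k2 k3
  · rcases jy i hi hi' with e | ⟨K, -, k2, k3⟩
    · exact joined_of_wick _ e
    · rw [Set.pair_comm] at k2
      exact joined_of_legs k2 k3
  · rintro ⟨ρ, -, -, hρ⟩
    -- A two-point subgraph joining `(L, i)` to `R` would have to absorb the subgraph `K` at `i`,
    -- and thus would come out at `(L, s i)`, which is not one of its two legs. With a direct
    -- contraction this is immediate.
    obtain ⟨i, hix, hiz⟩ : ∃ i : Field6, i ≠ x ∧ i ≠ z := by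
      clear * -; revert x z; decide
    obtain ⟨S, hS, hcl⟩ := hρ i hix hiz
    have hLS : L ∉ S := fun hL => Set.disjoint_left.1 hS hL (Or.inl rfl)
    have hsi : s i ≠ i := fun e => (hs.2 i).1 (by rw [e])
    have hend : ¬ ((L, s i).1 ∈ S ∨ (L, s i) = (L, i) ∨ (L, s i) = (R, ρ i)) := by
      rintro (h | h | h)
      · exact hLS h
      · exact hsi (congrArg Prod.snd h)
      · exact hLR (congrArg Prod.fst h)
    rcases jx i hix hiz with e | ⟨K, k1, k2, k3⟩
    · exact hend (e ▸ hcl (L, i) (Or.inr (Or.inl rfl)))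
    · have hK1 := fst_mem_of_legs_eq k3
      have hK2 : (D.wick (L, s i)).1 ∈ K :=
        (show D.wick (L, s i) ∈ D.legs K by rw [k3]; exact Or.inr rfl).1
      have hin : ∀ k : D.V × Field6, k.1 ∈ K → (k.1 ∈ S ∨ k = (L, i) ∨ k = (R, ρ i)) →
          k.1 ∈ S := by
        rintro k hk (h | rfl | rfl)
        · exact h
        · exact absurd (Or.inl rfl) (Set.disjoint_left.1 k2 hk)
        · exact absurd (Or.inr rfl) (Set.disjoint_left.1 k2 hk)
      have hsub : K ⊆ S := by
        have := k1.2 (K ∩ S) Set.inter_subset_left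
          ⟨_, hK1, hin _ hK1 (hcl (L, i) (Or.inr (Or.inl rfl)))⟩
          fun k hk hw => ⟨hw, hin _ hw (hcl k (Or.inl hk.2))⟩
        rw [← this]; exact Set.inter_subset_right
      have := hcl _ (Or.inl (hsub hK2))
      rw [D.wick_wick] at this
      exact hend this

end Diagram

namespace Diagram

variable {D D' E : Diagram}

/-! ### The melonic moves preserve maximality -/

theorem isConn_univ_iff_closed : D.IsConn Set.univ ↔ Nonempty D.V ∧
    ∀ T : Set D.V, T.Nonempty → (∀ h : D.V × Field6, h.1 ∈ T → (D.wick h).1 ∈ T) →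
      T = Set.univ := by
  constructor
  · rintro ⟨⟨v, -⟩, h⟩
    exact ⟨⟨v⟩, fun T hT hcl => h T (Set.subset_univ _) hT fun k hk _ => hcl k hk⟩
  · rintro ⟨⟨v⟩, h⟩
    exact ⟨⟨v, trivial⟩, fun T _ hT hcl => h T hT fun k hk => hcl k hk trivial⟩

theorem loop_congr {X : Type*} {c : Colour} (F : D.V × Field6 → X)
    (hw : ∀ h, F (D.wick h) = F h) (he : ∀ h, F (D.inner c h) = F h) {h h' : D.V × Field6}
    (hh : D.loop c h = D.loop c h') : F h = F h' :=
  (mem_of_loop_eq (T := {k | F k = F h}) (fun k hk => (hw k).trans hk)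
    (fun k hk => (he k).trans hk) hh rfl).symm

theorem card_loop_eq {X : Type*} {c : Colour} (F : D.V × Field6 → X)
    (hw : ∀ h, F (D.wick h) = F h) (he : ∀ h, F (D.inner c h) = F h)
    (hF : Function.Surjective F) (hinj : ∀ h h', F h = F h' → D.loop c h = D.loop c h') :
    Nat.card (D.Loop c) = Nat.card X := by
  refine Nat.card_eq_of_bijective (Quot.lift F ?_ : D.Loop c → X) ⟨?_, fun x => ?_⟩
  · exact fun h h' hh => loop_congr F hw he (Quot.sound hh)
  · intro l l'
    obtain ⟨h, rfl⟩ := D.loop_surjective c l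
    obtain ⟨h', rfl⟩ := D.loop_surjective c l'
    exact hinj h h'
  · obtain ⟨h, rfl⟩ := hF x
    exact ⟨D.loop c h, rfl⟩

theorem card_le_card_loop {X : Type*} {c : Colour} (F : D.V × Field6 → X)
    (hw : ∀ h, F (D.wick h) = F h) (he : ∀ h, F (D.inner c h) = F h)
    (hF : Function.Surjective F) : Nat.card X ≤ Nat.card (D.Loop c) := by
  refine Nat.card_le_card_of_surjective (Quot.lift F ?_ : D.Loop c → X) fun x => ?_
  · exact fun h h' hh => loop_congr F hw he (Quot.sound hh)
  · obtain ⟨h, rfl⟩ := hF x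
    exact ⟨D.loop c h, rfl⟩

/-- A property that is transported along the edges of one colour and all propagators but one is
transported along this propagator too. -/
theorem of_cut (c : Colour) (a : D.V × Field6) (Q : D.V × Field6 → Prop)
    (hi : ∀ b, Q b → Q (D.inner c b)) (hw : ∀ b, b ≠ a → b ≠ D.wick a → Q b → Q (D.wick b)) :
    Q a → Q (D.wick a) := by
  intro ha
  by_contra hn
  refine false_of_involutions (T := {b | Q b}) (a := a) ha (D.inner c) D.wick hi (D.inner_inner c)
    (D.inner_ne c) (fun b hb hba => ?_) D.wick_wick D.wick_ne
  have hb' : b ≠ D.wick a := by rintro rfl; exact hn hb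
  exact ⟨hw b hba hb' hb, fun e => hb' (by rw [← e, D.wick_wick])⟩

theorem of_cut_iff (c : Colour) (a : D.V × Field6) (Q : D.V × Field6 → Prop)
    (hi : ∀ b, Q b → Q (D.inner c b)) (hw : ∀ b, b ≠ a → b ≠ D.wick a → Q b → Q (D.wick b)) :
    Q (D.wick a) ↔ Q a := by
  refine ⟨fun h => ?_, of_cut c a Q hi hw⟩
  have := of_cut c (D.wick a) Q hi (fun b h1 h2 => hw b (by rwa [D.wick_wick] at h2) h1) h
  rwa [D.wick_wick] at this

/-- Closed diagrams that can be inserted into a propagator of a maximal diagram. -/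
structure IsInsertable (E : Diagram) : Prop where
  conn : E.IsConn Set.univ
  fTotal : E.fTotal = 3 * E.numVertices + 3
  circles : E.circles = 0

end Diagram

open Diagram

theorem ReplacesPropagator.numVertices {D D' E : Diagram} (h : ReplacesPropagator E D D') :
    D'.numVertices = D.numVertices + E.numVertices := by
  obtain ⟨φ, -⟩ := h
  rw [Diagram.numVertices, ← Nat.card_congr φ, Nat.card_sum]
  rfl

/-- The half-edges of the two parts of a sum of vertex sets. -/
theorem forall_sum_halfEdge {V V₁ V₂ : Type*} (φ : V₁ ⊕ V₂ ≃ V) {Q : V × Field6 → Prop}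
    (h1 : ∀ k : V₁ × Field6, Q (φ (Sum.inl k.1), k.2))
    (h2 : ∀ k : V₂ × Field6, Q (φ (Sum.inr k.1), k.2)) (x : V × Field6) : Q x := by
  obtain ⟨v, i⟩ := x
  obtain ⟨u | u, rfl⟩ := φ.surjective v
  · exact h1 (u, i)
  · exact h2 (u, i)

/-- For each colour the loop through the propagator of `D` merges with the loop through the cut
propagator of `E`, and all others persist. If a circle is replaced nothing merges, but the three
loops of the circle are lost. -/
theorem ReplacesPropagator.fTotal {D D' E : Diagram} (h : ReplacesPropagator E D D')
    (hE : E.circles = 0) : D'.fTotal + 3 = D.fTotal + E.fTotal := by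
  classical
  obtain ⟨φ, k1, k2, h⟩ := h
  let i (k : D.V × Field6) : D'.V × Field6 := (φ (Sum.inl k.1), k.2)
  let j (b : E.V × Field6) : D'.V × Field6 := (φ (Sum.inr b.1), b.2)
  have inner_i : ∀ c k, D'.inner c (i k) = i (D.inner c k) := fun c k => by
    simp only [Diagram.inner, i, k1]
  have inner_j : ∀ c b, D'.inner c (j b) = j (E.inner c b) := fun c b => by
    simp only [Diagram.inner, j, k2]
  rcases h with ⟨hc, h, a, w1, w2, w3, w4⟩ | ⟨hc, w3, w4⟩
  · change D'.wick (i h) = j a at w1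
    change D'.wick (i (D.wick h)) = j (E.wick a) at w2
    change ∀ k, k ≠ h → k ≠ D.wick h → D'.wick (i k) = i (D.wick k) at w3
    change ∀ b, b ≠ a → b ≠ E.wick a → D'.wick (j b) = j (E.wick b) at w4
    have w1' : D'.wick (j a) = i h := by rw [← w1, D'.wick_wick]
    have w2' : D'.wick (j (E.wick a)) = i (D.wick h) := by rw [← w2, D'.wick_wick]
    have key : ∀ c, Nat.card (D'.Loop c) + 1 = Nat.card (D.Loop c) + Nat.card (E.Loop c) := by
      intro c
      -- Parity: a strand entering the cut `E` at one end leaves it at the other.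
      have hA : D'.loop c (j (E.wick a)) = D'.loop c (j a) := by
        refine (of_cut_iff c a (fun b => D'.loop c (j b) = D'.loop c (j a)) (fun b hb => ?_)
          (fun b b1 b2 hb => ?_)).2 rfl
        · rw [← inner_j, loop_inner]; exact hb
        · rw [← w4 b b1 b2, loop_wick]; exact hb
      have hah : D'.loop c (i h) = D'.loop c (j a) := by rw [← w1, loop_wick]
      have hah' : D'.loop c (i (D.wick h)) = D'.loop c (j a) := by rw [← hA, ← w2, loop_wick]
      have hB : ∀ k k', D.loop c k = D.loop c k' → D'.loop c (i k) = D'.loop c (i k') := by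
        intro k k'
        refine loop_congr (fun k => D'.loop c (i k)) (fun k => ?_)
          (fun k => by rw [← inner_i, loop_inner])
        by_cases e1 : k = h
        · rw [e1, hah, hah']
        by_cases e2 : k = D.wick h
        · rw [e2, D.wick_wick, hah, hah']
        rw [← w3 k e1 e2, loop_wick]
      have hC : ∀ k k', E.loop c k = E.loop c k' → D'.loop c (j k) = D'.loop c (j k') := by
        intro k k'
        refine loop_congr (fun k => D'.loop c (j k)) (fun k => ?_)
          (fun k => by rw [← inner_j, loop_inner])
        by_cases e1 : k = a
        · rw [e1, hA]
        by_cases e2 : k = E.wick a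
        · rw [e2, E.wick_wick, hA]
        rw [← w4 k e1 e2, loop_wick]
      -- The merged loop is recorded on the side of `D`, so the loop of `a` is left out on the side
      -- of `E`.
      let F (x : D'.V × Field6) : D.Loop c ⊕ {l : E.Loop c // l ≠ E.loop c a} :=
        match φ.symm x.1 with
        | Sum.inl v => Sum.inl (D.loop c (v, x.2))
        | Sum.inr u => if hl : E.loop c (u, x.2) = E.loop c a then Sum.inl (D.loop c h)
            else Sum.inr ⟨E.loop c (u, x.2), hl⟩
      have Fi : ∀ k, F (i k) = Sum.inl (D.loop c k) := fun k => by simp [F, i]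
      have Fj : ∀ b, E.loop c b = E.loop c a → F (j b) = Sum.inl (D.loop c h) := by
        intro b hb; simp [F, j, hb]
      have Fj' : ∀ b, ∀ hb : E.loop c b ≠ E.loop c a, F (j b) = Sum.inr ⟨_, hb⟩ := by
        intro b hb; simp [F, j, hb]
      have Fjj : ∀ b b', E.loop c b = E.loop c b' → F (j b) = F (j b') := by
        intro b b' e
        by_cases hb : E.loop c b = E.loop c a
        · rw [Fj b hb, Fj b' (e ▸ hb)]
        · have hb' : E.loop c b' ≠ E.loop c a := e ▸ hb
          rw [Fj' b hb, Fj' b' hb']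
          congr 2
      have hcard := card_loop_eq (D := D') (c := c) F
        (forall_sum_halfEdge φ (fun k => ?_) (fun b => ?_))
        (forall_sum_halfEdge φ (fun k => ?_) (fun b => ?_)) ?_
        (forall_sum_halfEdge φ (fun k => forall_sum_halfEdge φ (fun k' => ?_) (fun b' => ?_))
          (fun b => forall_sum_halfEdge φ (fun k' => ?_) (fun b' => ?_)))
      · rw [hcard, Nat.card_sum, add_assoc]
        congr 1
        have := Set.ncard_add_ncard_compl ({E.loop c a} : Set (E.Loop c))
        rw [Set.ncard_singleton, ← Nat.card_coe_set_eq, add_comm] at this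
        exact this
      · change F (D'.wick (i k)) = F (i k)
        by_cases e1 : k = h
        · rw [e1, w1, Fj a rfl, Fi]
        by_cases e2 : k = D.wick h
        · rw [e2, w2, Fj _ (loop_wick c a), Fi, loop_wick]
        rw [w3 k e1 e2, Fi, Fi, loop_wick]
      · change F (D'.wick (j b)) = F (j b)
        by_cases e1 : b = a
        · rw [e1, w1', Fj a rfl, Fi]
        by_cases e2 : b = E.wick a
        · rw [e2, w2', Fj _ (loop_wick c a), Fi, loop_wick]
        rw [w4 b e1 e2]
        exact Fjj _ _ (loop_wick c b)
      · change F (D'.inner c (i k)) = F (i k)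
        rw [inner_i, Fi, Fi, loop_inner]
      · change F (D'.inner c (j b)) = F (j b)
        rw [inner_j]
        exact Fjj _ _ (loop_inner c b)
      · rintro (l | ⟨l, hl⟩)
        · obtain ⟨k, rfl⟩ := D.loop_surjective c l
          exact ⟨i k, Fi k⟩
        · obtain ⟨b, rfl⟩ := E.loop_surjective c l
          exact ⟨j b, Fj' b hl⟩
      · change F (i k) = F (i k') → D'.loop c (i k) = D'.loop c (i k')
        intro e
        rw [Fi, Fi] at e
        exact hB _ _ (Sum.inl_injective e)
      · change F (i k) = F (j b') → D'.loop c (i k) = D'.loop c (j b')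
        intro e
        by_cases hb : E.loop c b' = E.loop c a
        · rw [Fi, Fj _ hb] at e
          rw [hB _ _ (Sum.inl_injective e), hC _ _ hb, hah]
        · rw [Fi, Fj' _ hb] at e
          exact absurd e Sum.inl_ne_inr
      · change F (j b) = F (i k') → D'.loop c (j b) = D'.loop c (i k')
        intro e
        by_cases hb : E.loop c b = E.loop c a
        · rw [Fi, Fj _ hb] at e
          rw [← hB _ _ (Sum.inl_injective e), hC _ _ hb, hah]
        · rw [Fi, Fj' _ hb] at e
          exact absurd e.symm Sum.inl_ne_inr
      · change F (j b) = F (j b') → D'.loop c (j b) = D'.loop c (j b')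
        intro e
        by_cases hb : E.loop c b = E.loop c a <;> by_cases hb' : E.loop c b' = E.loop c a
        · rw [hC _ _ hb, hC _ _ hb']
        · rw [Fj _ hb, Fj' _ hb'] at e
          exact absurd e Sum.inl_ne_inr
        · rw [Fj' _ hb, Fj _ hb'] at e
          exact absurd e.symm Sum.inl_ne_inr
        · rw [Fj' _ hb, Fj' _ hb'] at e
          exact hC _ _ (congrArg Subtype.val (Sum.inr_injective e))
    have r := key red
    have g := key green
    have b := key blue
    rw [Diagram.fTotal, Diagram.fTotal, Diagram.fTotal]
    omega
  · change ∀ k, D'.wick (i k) = i (D.wick k) at w3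
    change ∀ b, D'.wick (j b) = j (E.wick b) at w4
    have key : ∀ c, Nat.card (D'.Loop c) = Nat.card (D.Loop c) + Nat.card (E.Loop c) := by
      intro c
      let F (x : D'.V × Field6) : D.Loop c ⊕ E.Loop c :=
        match φ.symm x.1 with
        | Sum.inl v => Sum.inl (D.loop c (v, x.2))
        | Sum.inr u => Sum.inr (E.loop c (u, x.2))
      have Fi : ∀ k, F (i k) = Sum.inl (D.loop c k) := fun k => by simp [F, i]
      have Fj : ∀ b, F (j b) = Sum.inr (E.loop c b) := fun b => by simp [F, j]
      have hcard := card_loop_eq (D := D') (c := c) F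
        (forall_sum_halfEdge φ (fun k => ?_) (fun b => ?_))
        (forall_sum_halfEdge φ (fun k => ?_) (fun b => ?_)) ?_
        (forall_sum_halfEdge φ (fun k => forall_sum_halfEdge φ (fun k' => ?_) (fun b' => ?_))
          (fun b => forall_sum_halfEdge φ (fun k' => ?_) (fun b' => ?_)))
      · rw [hcard, Nat.card_sum]
      · change F (D'.wick (i k)) = F (i k)
        rw [w3, Fi, Fi, loop_wick]
      · change F (D'.wick (j b)) = F (j b)
        rw [w4, Fj, Fj, loop_wick]
      · change F (D'.inner c (i k)) = F (i k)
        rw [inner_i, Fi, Fi, loop_inner]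
      · change F (D'.inner c (j b)) = F (j b)
        rw [inner_j, Fj, Fj, loop_inner]
      · rintro (l | l)
        · obtain ⟨k, rfl⟩ := D.loop_surjective c l
          exact ⟨i k, Fi k⟩
        · obtain ⟨b, rfl⟩ := E.loop_surjective c l
          exact ⟨j b, Fj b⟩
      · change F (i k) = F (i k') → D'.loop c (i k) = D'.loop c (i k')
        rw [Fi, Fi]
        intro e
        exact loop_congr (fun k => D'.loop c (i k)) (fun k => by rw [← w3, loop_wick])
          (fun k => by rw [← inner_i, loop_inner]) (Sum.inl_injective e)
      · change F (i k) = F (j b') → _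
        rw [Fi, Fj]
        exact fun e => absurd e Sum.inl_ne_inr
      · change F (j b) = F (i k') → _
        rw [Fi, Fj]
        exact fun e => absurd e.symm Sum.inl_ne_inr
      · change F (j b) = F (j b') → D'.loop c (j b) = D'.loop c (j b')
        rw [Fj, Fj]
        intro e
        exact loop_congr (fun k => D'.loop c (j k)) (fun k => by rw [← w4, loop_wick])
          (fun k => by rw [← inner_j, loop_inner]) (Sum.inr_injective e)
    have r := key red
    have g := key green
    have b := key blue
    rw [Diagram.fTotal, Diagram.fTotal, Diagram.fTotal]
    omega

theorem ReplacesPropagator.connected_iff {D D' E : Diagram} (h : ReplacesPropagator E D D')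
    (hE : E.IsConn Set.univ) : D.Connected ↔ D'.Connected := by
  rw [isConn_univ_iff_closed] at hE
  obtain ⟨⟨u₀⟩, hE⟩ := hE
  obtain ⟨φ, -, -, h⟩ := h
  have hne : ¬ IsEmpty D'.V := fun h => h.elim (φ (Sum.inr u₀))
  have hD' : D'.Connected ↔ D'.circles = 0 ∧ ∀ T : Set D'.V, T.Nonempty →
      (∀ h : D'.V × Field6, h.1 ∈ T → (D'.wick h).1 ∈ T) → T = Set.univ := by
    rw [Diagram.connected_iff, isConn_univ_iff_closed, IsZeroCycle]
    have : Nonempty D'.V := ⟨φ (Sum.inr u₀)⟩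
    tauto
  rw [hD']
  let i (k : D.V × Field6) : D'.V × Field6 := (φ (Sum.inl k.1), k.2)
  let j (b : E.V × Field6) : D'.V × Field6 := (φ (Sum.inr b.1), b.2)
  rcases h with ⟨hc, h, a, w1, w2, w3, w4⟩ | ⟨hc, w3, w4⟩
  · change D'.wick (i h) = j a at w1
    change D'.wick (i (D.wick h)) = j (E.wick a) at w2
    change ∀ k, k ≠ h → k ≠ D.wick h → D'.wick (i k) = i (D.wick k) at w3
    change ∀ b, b ≠ a → b ≠ E.wick a → D'.wick (j b) = j (E.wick b) at w4
    have w1' : D'.wick (j a) = i h := by rw [← w1, D'.wick_wick]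
    have w2' : D'.wick (j (E.wick a)) = i (D.wick h) := by rw [← w2, D'.wick_wick]
    have hD : D.Connected ↔ D.circles = 0 ∧ ∀ T : Set D.V, T.Nonempty →
        (∀ h : D.V × Field6, h.1 ∈ T → (D.wick h).1 ∈ T) → T = Set.univ := by
      rw [Diagram.connected_iff, isConn_univ_iff_closed, IsZeroCycle]
      have h1 : Nonempty D.V := ⟨h.1⟩
      have : ¬ IsEmpty D.V := not_isEmpty_of_nonempty _
      tauto
    rw [hD, hc]
    refine and_congr_right fun _ => ⟨fun hT T' hne' hcl => ?_, fun hT' T hne hcl => ?_⟩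
    -- Cutting one propagator of `E` does not separate its two ends: a closed vertex set has an even
    -- number of half-edges.
    · have ha : (j (E.wick a)).1 ∈ T' ↔ (j a).1 ∈ T' :=
        of_cut_iff red a (fun b => (j b).1 ∈ T') (fun b hb => hb) fun b b1 b2 hb => by
          have := hcl (j b) hb
          rwa [w4 b b1 b2] at this
      have ia : (i h).1 ∈ T' ↔ (j a).1 ∈ T' :=
        ⟨fun hh => by have := hcl _ hh; rwa [w1] at this,
          fun hh => by have := hcl _ hh; rwa [w1'] at this⟩
      have ia' : (i (D.wick h)).1 ∈ T' ↔ (j (E.wick a)).1 ∈ T' :=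
        ⟨fun hh => by have := hcl _ hh; rwa [w2] at this,
          fun hh => by have := hcl _ hh; rwa [w2'] at this⟩
      have cD : {v | φ (Sum.inl v) ∈ T'}.Nonempty → {v | φ (Sum.inl v) ∈ T'} = Set.univ := by
        refine fun hn => hT _ hn fun k hk => ?_
        change (i (D.wick k)).1 ∈ T'
        by_cases e1 : k = h
        · subst e1; rw [ia', ha, ← ia]; exact hk
        by_cases e2 : k = D.wick h
        · subst e2; rw [D.wick_wick, ia, ← ha, ← ia']; exact hk
        have := hcl (i k) hk
        rwa [w3 k e1 e2] at this
      have cE : {v | φ (Sum.inr v) ∈ T'}.Nonempty → {v | φ (Sum.inr v) ∈ T'} = Set.univ := by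
        refine fun hn => hE _ hn fun b hb => ?_
        change (j (E.wick b)).1 ∈ T'
        by_cases e1 : b = a
        · subst e1; rw [ha]; exact hb
        by_cases e2 : b = E.wick a
        · subst e2; rw [E.wick_wick, ← ha]; exact hb
        have := hcl (j b) hb
        rwa [w4 b e1 e2] at this
      have : {v | φ (Sum.inl v) ∈ T'} = Set.univ ∧ {v | φ (Sum.inr v) ∈ T'} = Set.univ := by
        obtain ⟨v, hv⟩ := hne'
        obtain ⟨v | v, rfl⟩ := φ.surjective v
        · have h1 := cD ⟨v, hv⟩
          exact ⟨h1, cE ⟨a.1, ia.1 (Set.eq_univ_iff_forall.1 h1 h.1)⟩⟩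
        · have h1 := cE ⟨v, hv⟩
          exact ⟨cD ⟨h.1, ia.2 (Set.eq_univ_iff_forall.1 h1 a.1)⟩, h1⟩
      refine Set.eq_univ_of_forall fun v => ?_
      obtain ⟨v | v, rfl⟩ := φ.surjective v
      · exact Set.eq_univ_iff_forall.1 this.1 v
      · exact Set.eq_univ_iff_forall.1 this.2 v
    · let q : D.V ⊕ E.V → Prop := Sum.elim (· ∈ T) (fun _ => h.1 ∈ T)
      have qi : ∀ k, q (φ.symm (i k).1) ↔ k.1 ∈ T := fun k => by simp [q, i]
      have qj : ∀ b, q (φ.symm (j b).1) ↔ h.1 ∈ T := fun k => by simp [q, j]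
      have hww : (D.wick h).1 ∈ T ↔ h.1 ∈ T :=
        ⟨fun hh => by simpa [D.wick_wick] using hcl _ hh, hcl h⟩
      have := hT' {v | q (φ.symm v)} (by
          obtain ⟨v, hv⟩ := hne
          exact ⟨φ (Sum.inl v), by simpa [q] using hv⟩)
        (forall_sum_halfEdge φ (fun k hk => ?_) (fun b hb => ?_))
      · refine Set.eq_univ_of_forall fun v => ?_
        exact (qi (v, 0)).1 (Set.eq_univ_iff_forall.1 this _)
      · change q (φ.symm (i k).1) at hk
        change q (φ.symm (D'.wick (i k)).1)
        rw [qi] at hk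
        by_cases e1 : k = h
        · rw [e1, w1, qj, ← e1]; exact hk
        by_cases e2 : k = D.wick h
        · rw [e2, w2, qj, ← hww, ← e2]; exact hk
        rw [w3 k e1 e2, qi]; exact hcl k hk
      · change q (φ.symm (j b).1) at hb
        change q (φ.symm (D'.wick (j b)).1)
        rw [qj] at hb
        by_cases e1 : b = a
        · rw [e1, w1', qi]; exact hb
        by_cases e2 : b = E.wick a
        · rw [e2, w2', qi, hww]; exact hb
        rw [w4 b e1 e2, qj]; exact hb
  · change ∀ k, D'.wick (i k) = i (D.wick k) at w3
    change ∀ b, D'.wick (j b) = j (E.wick b) at w4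
    constructor
    · intro hD
      rcases Diagram.connected_iff.1 hD with ⟨he, h1⟩ | ⟨h0, -⟩
      · refine ⟨by omega, fun T' ⟨t, ht⟩ hcl => Set.eq_univ_of_forall fun v => ?_⟩
        have hr : ∀ v, ∃ u, φ (Sum.inr u) = v := fun v => by
          obtain ⟨u | u, rfl⟩ := φ.surjective v
          · exact he.elim u
          · exact ⟨u, rfl⟩
        obtain ⟨t, rfl⟩ := hr t
        obtain ⟨v, rfl⟩ := hr v
        have := hE {v | φ (Sum.inr v) ∈ T'} ⟨t, ht⟩ fun b hb => by
          have := hcl (j b) hb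
          rwa [w4] at this
        exact Set.eq_univ_iff_forall.1 this v
      · omega
    · rintro ⟨h0, hT'⟩
      refine Or.inl ⟨⟨fun v => ?_⟩, by omega⟩
      have := hT' (Set.range fun u => φ (Sum.inr u)) ⟨_, u₀, rfl⟩
        (forall_sum_halfEdge φ (fun k hk => ?_) (fun b hb => ?_))
      · obtain ⟨u, hu⟩ := Set.eq_univ_iff_forall.1 this (φ (Sum.inl v))
        exact Sum.inr_ne_inl (φ.injective hu)
      · obtain ⟨u, hu⟩ := hk
        exact absurd (φ.injective hu) Sum.inr_ne_inl
      · exact ⟨(E.wick b).1, by change _ = (D'.wick (j b)).1; rw [w4]⟩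

/-- Both sides of `f_tot ≤ 3V + 3` grow by `3 * E.numVertices`. The converse direction is what
allows subgraphs to be removed. -/
theorem ReplacesPropagator.isMaximal_iff {D D' E : Diagram} (hE : E.IsInsertable)
    (h : ReplacesPropagator E D D') : D.IsMaximal ↔ D'.IsMaximal := by
  rw [Diagram.isMaximal_iff, Diagram.isMaximal_iff, h.connected_iff hE.conn]
  have h1 := h.fTotal hE.circles
  have h2 := h.numVertices
  have h3 := hE.fTotal
  refine and_congr_right fun _ => ?_
  omega

theorem closedSnail_isInsertable (k : Interaction) : (closedSnail k).IsInsertable := by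
  have hc : (closedSnail k).IsConn Set.univ := isConn_univ_iff_closed.2
    ⟨⟨()⟩, fun T ⟨_, ht⟩ _ => Set.eq_univ_of_forall fun _ => ht⟩
  have hn : (closedSnail k).numVertices = 1 := Nat.card_unique (α := Unit)
  refine ⟨hc, le_antisymm (Connected.fTotal_le (Diagram.connected_iff.2 (Or.inr ⟨rfl, hc⟩))) ?_,
    rfl⟩
  -- The snail pairing contains an edge of each colour, which closes to a loop by itself; the other
  -- four fields give at least one more.
  have key : ∀ c, 2 ≤ Nat.card ((closedSnail k).Loop c) := by
    intro c
    obtain ⟨p, h1, q, h2, h3⟩ : ∃ p, snailPairing k p = edge k c p ∧ ∃ q, q ≠ p ∧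
        q ≠ edge k c p := by
      clear hc hn; revert k c; decide
    have h4 : ∀ i, snailPairing k i = p ↔ i = edge k c p := fun i =>
      ⟨fun h => by rw [← h1, ← h, snailPairing_snailPairing], fun h => by
        rw [h, ← h1, snailPairing_snailPairing]⟩
    have h5 : ∀ i, snailPairing k i = edge k c p ↔ i = p := fun i =>
      ⟨fun h => by rw [← h1] at h; exact (snailPairing k).injective h, fun h => by rw [h, h1]⟩
    have h6 : ∀ i, edge k c i = p ↔ i = edge k c p := fun i =>
      ⟨fun h => by rw [← h, edge_edge], fun h => by rw [h, edge_edge]⟩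
    have := card_le_card_loop (D := closedSnail k) (c := c) (X := Prop)
      (fun h => h.2 = p ∨ h.2 = edge k c p)
      (fun h => by simp only [closedSnail, h4, h5]; exact propext or_comm)
      (fun h => by
        change (edge k c h.2 = p ∨ edge k c h.2 = edge k c p) = _
        rw [h6, (edge k c).injective.eq_iff]
        exact propext or_comm) ?_
    · simpa using this
    · intro P
      by_cases hP : P
      · exact ⟨((), p), by simp [hP]⟩
      · exact ⟨((), q), by simp [hP, h2, h3]⟩
  have := key red
  have := key green
  have := key blue
  rw [Diagram.fTotal, hn]
  omega

theorem closedMelon_isInsertable (k : Interaction) : (closedMelon k).IsInsertable := by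
  have hc : (closedMelon k).IsConn Set.univ := isConn_univ_iff_closed.2
    ⟨⟨true⟩, fun T ⟨t, ht⟩ hcl => Set.eq_univ_of_forall fun v => by
      have : (!t) ∈ T := hcl (t, 0) ht
      cases t <;> cases v <;> assumption⟩
  have hn : (closedMelon k).numVertices = 2 := (Nat.card_eq_fintype_card (α := Bool)).trans rfl
  refine ⟨hc, le_antisymm (Connected.fTotal_le (Diagram.connected_iff.2 (Or.inr ⟨rfl, hc⟩))) ?_,
    rfl⟩
  -- Each of the three edges of colour `c` forms a loop together with its copy in the other vertex.
  have key : ∀ c, 3 ≤ Nat.card ((closedMelon k).Loop c) := by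
    intro c
    obtain ⟨p, q, h1, r, h2⟩ : ∃ p q,
        (∀ i, (if edge k c i = p ∨ edge k c i = edge k c p then (0 : Fin 3)
          else if edge k c i = q ∨ edge k c i = edge k c q then 1 else 2) =
          (if i = p ∨ i = edge k c p then (0 : Fin 3)
          else if i = q ∨ i = edge k c q then 1 else 2)) ∧
        ∃ r, (q ≠ p ∧ q ≠ edge k c p) ∧ (r ≠ p ∧ r ≠ edge k c p) ∧ (r ≠ q ∧ r ≠ edge k c q) := by
      clear hc hn; revert k c; decide +kernel
    have := card_le_card_loop (D := closedMelon k) (c := c) (X := Fin 3)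
      (fun h => if h.2 = p ∨ h.2 = edge k c p then (0 : Fin 3)
          else if h.2 = q ∨ h.2 = edge k c q then 1 else 2)
      (fun h => rfl) (fun h => h1 h.2) ?_
    · simpa using this
    · obtain ⟨g1, g2, g3⟩ := h2
      intro n
      fin_cases n
      · exact ⟨(true, p), by simp⟩
      · exact ⟨(true, q), by simp [g1]⟩
      · exact ⟨(true, r), by simp [g2, g3]⟩
  have := key red
  have := key green
  have := key blue
  rw [Diagram.fTotal, hn]
  omega

/-! ### Vertex expansion -/

/-- The fields of a prism on the same side as the field `4`. -/
def IsRight (i : Field6) : Prop := i = 4 ∨ i = 5 ∨ i = 0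

instance : DecidablePred IsRight := fun i => inferInstanceAs (Decidable (i = 4 ∨ i = 5 ∨ i = 0))

theorem isRight_snailPairing (i : Field6) : IsRight (snailPairing prism i) ↔ ¬ IsRight i := by
  revert i; decide

/-- For the prism the snail pairing is itself an automorphism, the reflection that exchanges the two
triangles along the rungs. It accounts for the labels 6, 5, 4 of the left vertex in an expansion. -/
theorem snailPairing_edge (c : Colour) (i : Field6) :
    snailPairing prism (edge prism c i) = edge prism c (snailPairing prism i) := by
  revert c i; decide

/-- The only edges between the two triangles are the rungs. -/
theorem edge_eq_snailPairing (c : Colour) (i : Field6)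
    (h : ¬ (IsRight (edge prism c i) ↔ IsRight i)) : edge prism c i = snailPairing prism i := by
  revert c i; decide

theorem eq_or_eq_edge_of_not_isRight (c : Colour) (i j : Field6) (h1 : ¬ IsRight i)
    (h2 : ¬ IsRight (edge prism c i)) (h3 : ¬ IsRight j) (h4 : ¬ IsRight (edge prism c j)) :
    j = i ∨ j = edge prism c i := by
  revert c i j; decide

/-- Each triangle of the prism has one side of each colour. -/
theorem exists_not_isRight (c : Colour) : ∃ i, ¬ IsRight i ∧ ¬ IsRight (edge prism c i) := by
  revert c; decide

theorem expandLeg_of_ne {V : Type} {P v : V} (h : v ≠ P) (i : Field6) :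
    expandLeg P (v, i) = (some v, i) := by
  simp [expandLeg, h]

theorem expandLeg_right {V : Type} (P : V) {i : Field6} (h : IsRight i) :
    expandLeg P (P, i) = (some P, i) := by
  rcases h with rfl | rfl | rfl <;> simp [expandLeg]

theorem expandLeg_left {V : Type} (P : V) {i : Field6} (h : ¬ IsRight i) :
    expandLeg P (P, i) = (none, snailPairing prism i) := by
  have : i = 1 ∨ i = 2 ∨ i = 3 := by revert i; decide
  rcases this with rfl | rfl | rfl <;> simp [expandLeg] <;> decide

theorem ExpandsVertex.numVertices {D D' : Diagram} (h : ExpandsVertex D D') :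
    D'.numVertices = D.numVertices + 1 := by
  obtain ⟨P, φ, -⟩ := h
  rw [Diagram.numVertices, ← Nat.card_congr φ, Finite.card_option]
  rfl

/-- The half-edges of an expanded diagram are those of the original diagram and those of the new
propagators. -/
theorem forall_expand {V V' : Type} (P : V) (φ : Option V ≃ V') {Q : V' × Field6 → Prop}
    (h1 : ∀ h : V × Field6, Q (φ (expandLeg P h).1, (expandLeg P h).2))
    (h2 : ∀ i, ¬ IsRight i → Q (φ none, i)) (h3 : ∀ i, ¬ IsRight i → Q (φ (some P), i))
    (x : V' × Field6) : Q x := by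
  obtain ⟨v, i⟩ := x
  obtain ⟨_ | v, rfl⟩ := φ.surjective v
  · by_cases hi : IsRight i
    · have := h1 (P, snailPairing prism i)
      rw [expandLeg_left P (by rw [isRight_snailPairing]; exact not_not.2 hi),
        snailPairing_snailPairing] at this
      exact this
    · exact h2 i hi
  · by_cases hv : v = P
    · subst hv
      by_cases hi : IsRight i
      · have := h1 (v, i)
        rwa [expandLeg_right v hi] at this
      · exact h3 i hi
    · have := h1 (v, i)
      rwa [expandLeg_of_ne hv] at this

/-- For each colour the side of the triangle `{1, 2, 3}` in the left vertex and that in the right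
vertex close to one new loop. The rung of this colour becomes a path through both vertices, and the
sides of the triangles of `P` survive, one in each new vertex; so old loops persist. -/
theorem ExpandsVertex.fTotal {D D' : Diagram} (h : ExpandsVertex D D') :
    D'.fTotal = D.fTotal + 3 := by
  classical
  obtain ⟨P, φ, kP, hc, kn, ks, hr, hw⟩ := h
  let i (h : D.V × Field6) : D'.V × Field6 := (φ (expandLeg P h).1, (expandLeg P h).2)
  change ∀ h, D'.wick (i h) = i (D.wick h) at hw
  have hr : ∀ f, ¬ IsRight f → D'.wick (φ none, f) = (φ (some P), f) := by
    intro f hf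
    exact hr f (by revert f; decide)
  have hr' : ∀ f, ¬ IsRight f → D'.wick (φ (some P), f) = (φ none, f) := by
    intro f hf
    rw [← hr f hf, D'.wick_wick]
  have iv : ∀ v f, v ≠ P → i (v, f) = (φ (some v), f) := fun v f hv => by
    simp only [i, expandLeg_of_ne hv]
  have iR : ∀ f, IsRight f → i (P, f) = (φ (some P), f) := fun f hf => by
    simp only [i, expandLeg_right P hf]
  have iL : ∀ f, ¬ IsRight f → i (P, f) = (φ none, snailPairing prism f) := fun f hf => by
    simp only [i, expandLeg_left P hf]
  have key : ∀ c, Nat.card (D'.Loop c) = Nat.card (D.Loop c) + 1 := by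
    intro c
    set e := edge prism c with he
    set σ := snailPairing prism with hσ
    have σσ : ∀ f, σ (σ f) = f := snailPairing_snailPairing prism
    have ee : ∀ f, e (e f) = f := edge_edge prism c
    have in_n : ∀ f, D'.inner c (φ none, f) = (φ none, e f) := fun f => by
      simp only [Diagram.inner, kn, he]
    have in_P : ∀ f, D'.inner c (φ (some P), f) = (φ (some P), e f) := fun f => by
      simp only [Diagram.inner, ks, kP, he]
    have in_v : ∀ v f, D'.inner c (φ (some v), f) = (φ (some v), edge (D.kind v) c f) :=
      fun v f => by simp only [Diagram.inner, ks]
    have xe : ∀ f, D'.loop c (φ none, e f) = D'.loop c (φ none, f) := fun f => by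
      rw [← in_n, loop_inner]
    have ye : ∀ f, D'.loop c (φ (some P), e f) = D'.loop c (φ (some P), f) := fun f => by
      rw [← in_P, loop_inner]
    have xy : ∀ f, ¬ IsRight f ∨ ¬ IsRight (e f) →
        D'.loop c (φ none, f) = D'.loop c (φ (some P), f) := by
      rintro f (hf | hf)
      · rw [← hr f hf, loop_wick]
      · rw [← xe, ← ye, ← hr _ hf, loop_wick]
    -- the loop of `D'` through a half-edge of `D` depends on the loop in `D` only
    have hB : ∀ h h', D.loop c h = D.loop c h' → D'.loop c (i h) = D'.loop c (i h') := by
      intro h h'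
      refine loop_congr (fun h => D'.loop c (i h)) (fun h => by rw [← hw, loop_wick]) ?_
      rintro ⟨v, f⟩
      by_cases hv : v = P
      · subst hv
        have hin : D.inner c (v, f) = (v, e f) := by simp only [Diagram.inner, kP, he]
        rw [hin]
        by_cases h1 : IsRight f <;> by_cases h2 : IsRight (e f)
        · rw [iR _ h1, iR _ h2, ye]
        · rw [iR _ h1, iL _ h2, edge_eq_snailPairing c f (by tauto), ← hσ, σσ, ← xy f (Or.inr h2)]
        · have hf : f = σ (e f) := by rw [he, edge_eq_snailPairing c f (by tauto), ← hσ, σσ]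
          rw [iR _ h2, iL _ h1, ye, ← xy f (Or.inl h1), ← edge_eq_snailPairing c f (by tauto), ← he,
            xe]
        · rw [iL _ h1, iL _ h2, snailPairing_edge, ← he, ← hσ, xe]
      · have hin : D.inner c (v, f) = (v, edge (D.kind v) c f) := rfl
        rw [hin, iv _ _ hv, iv _ _ hv, ← in_v, loop_inner]
    -- Here `none` stands for the new loop. Its fields are those for which both ends of the `c`-edge
    -- lie in `{1, 2, 3}`.
    let F (x : D'.V × Field6) : Option (D.Loop c) :=
      match φ.symm x.1 with
      | none => if IsRight x.2 ∨ IsRight (e x.2) then some (D.loop c (P, σ x.2)) else none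
      | some v => if v = P ∧ ¬ (IsRight x.2 ∨ IsRight (e x.2)) then none
          else some (D.loop c (v, x.2))
    have Fn : ∀ f, IsRight f ∨ IsRight (e f) → F (φ none, f) = some (D.loop c (P, σ f)) :=
      fun f hf => by simp [F, hf]
    have Fn' : ∀ f, ¬ (IsRight f ∨ IsRight (e f)) → F (φ none, f) = none :=
      fun f hf => by simp [F, hf]
    have FP : ∀ f, IsRight f ∨ IsRight (e f) → F (φ (some P), f) = some (D.loop c (P, f)) :=
      fun f hf => by
        simp only [F, φ.symm_apply_apply]
        exact if_neg fun h => h.2 hf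
    have FP' : ∀ f, ¬ (IsRight f ∨ IsRight (e f)) → F (φ (some P), f) = none :=
      fun f hf => by
        simp only [F, φ.symm_apply_apply]
        exact if_pos ⟨trivial, hf⟩
    have Fv : ∀ v f, v ≠ P → F (φ (some v), f) = some (D.loop c (v, f)) :=
      fun v f hv => by simp [F, hv]
    have Fi : ∀ h, F (i h) = some (D.loop c h) := by
      rintro ⟨v, f⟩
      by_cases hv : v = P
      · subst hv
        by_cases h1 : IsRight f
        · rw [iR _ h1, FP _ (Or.inl h1)]
        · rw [iL _ h1, Fn _ (Or.inl (by rw [hσ, isRight_snailPairing]; exact h1)), σσ]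
      · rw [iv _ _ hv, Fv _ _ hv]
    have Frung : ∀ f, ¬ IsRight f → F (φ none, f) = F (φ (some P), f) := by
      intro f hf
      by_cases h : IsRight f ∨ IsRight (e f)
      · have h' : e f = σ f := edge_eq_snailPairing c f (by tauto)
        rw [Fn f h, FP f h, ← h']
        have : D.inner c (P, f) = (P, e f) := by simp only [Diagram.inner, kP, he]
        rw [← this, loop_inner]
      · rw [Fn' f h, FP' f h]
    have Finj : ∀ x h, F x = some (D.loop c h) → D'.loop c x = D'.loop c (i h) := by
      refine forall_expand P φ (fun h' h e => ?_) (fun f hf h e => ?_) (fun f hf h e => ?_)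
      · change F (i h') = _ at e
        rw [Fi] at e
        exact hB _ _ (Option.some_injective _ e)
      · by_cases h1 : IsRight f ∨ IsRight ((edge prism c) f)
        · rw [Fn f h1] at e
          rw [← hB _ _ (Option.some_injective _ e)]
          have h2 : edge prism c f = σ f := edge_eq_snailPairing c f (by tauto)
          have h3 : IsRight (σ f) := by rw [hσ, isRight_snailPairing]; exact hf
          rw [iR _ h3, ← h2, ← he, ye, xy f (Or.inl hf)]
        · rw [Fn' f h1] at e
          exact absurd e.symm (Option.some_ne_none _)
      · by_cases h1 : IsRight f ∨ IsRight ((edge prism c) f)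
        · rw [FP f h1] at e
          rw [← hB _ _ (Option.some_injective _ e)]
          have h2 : edge prism c f = σ f := edge_eq_snailPairing c f (by tauto)
          rw [iL _ hf, ← h2, ← he, xe, xy f (Or.inl hf)]
        · rw [FP' f h1] at e
          exact absurd e.symm (Option.some_ne_none _)
    obtain ⟨f₀, hf₀, hf₀'⟩ := exists_not_isRight c
    have Fnone : ∀ x, F x = none → D'.loop c x = D'.loop c (φ none, f₀) := by
      have hx : ∀ f, ¬ IsRight f → ¬ IsRight (e f) →
          D'.loop c (φ none, f) = D'.loop c (φ none, f₀) := by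
        intro f h1 h2
        rcases eq_or_eq_edge_of_not_isRight c f₀ f hf₀ hf₀' h1 h2 with rfl | rfl
        · rfl
        · exact xe f₀
      refine forall_expand P φ (fun h' e => ?_) (fun f hf e => ?_) (fun f hf e => ?_)
      · change F (i h') = none at e
        rw [Fi] at e
        exact absurd e (Option.some_ne_none _)
      · refine hx f hf fun h2 => ?_
        rw [Fn f (Or.inr h2)] at e
        exact absurd e (Option.some_ne_none _)
      · rw [← xy f (Or.inl hf)]
        refine hx f hf fun h2 => ?_
        rw [FP f (Or.inr h2)] at e
        exact absurd e (Option.some_ne_none _)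
    have hcard := card_loop_eq (D := D') (c := c) F
      (forall_expand P φ (fun h => ?_) (fun f hf => ?_) (fun f hf => ?_)) ?_ ?_ ?_
    · rw [hcard, Finite.card_option]
    · change F (D'.wick (i h)) = F (i h)
      rw [hw, Fi, Fi, loop_wick]
    · rw [hr f hf, Frung f hf]
    · rw [hr' f hf, Frung f hf]
    · rintro ⟨v, f⟩
      obtain ⟨_ | v, rfl⟩ := φ.surjective v
      · rw [in_n]
        by_cases h : IsRight f ∨ IsRight (e f)
        · rw [Fn f h, Fn _ (by rw [ee]; exact h.symm), hσ, he, snailPairing_edge]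
          have : D.inner c (P, snailPairing prism f) = (P, edge prism c (snailPairing prism f)) := by
            simp only [Diagram.inner, kP]
          rw [← this, loop_inner]
        · rw [Fn' f h, Fn' _ (by rw [ee]; tauto)]
      · by_cases hv : v = P
        · subst hv
          rw [in_P]
          by_cases h : IsRight f ∨ IsRight (e f)
          · rw [FP f h, FP _ (by rw [ee]; exact h.symm)]
            have : D.inner c (v, f) = (v, e f) := by simp only [Diagram.inner, kP, he]
            rw [← this, loop_inner]
          · rw [FP' f h, FP' _ (by rw [ee]; tauto)]
        · rw [in_v, Fv _ _ hv, Fv _ _ hv, loop_edge]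
    · rintro (_ | l)
      · exact ⟨(φ none, f₀), Fn' f₀ (by rw [not_or]; exact ⟨hf₀, hf₀'⟩)⟩
      · obtain ⟨h, rfl⟩ := D.loop_surjective c l
        exact ⟨i h, Fi h⟩
    · intro x x' hx
      rcases hFx : F x' with _ | l
      · rw [hFx] at hx
        rw [Fnone x hx, Fnone x' hFx]
      · obtain ⟨h, rfl⟩ := D.loop_surjective c l
        rw [hFx] at hx
        rw [Finj x h hx, Finj x' h hFx]
  have r := key red
  have g := key green
  have b := key blue
  rw [Diagram.fTotal, Diagram.fTotal, hc]
  omega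

theorem connected_iff_of_nonempty {D : Diagram} (h : Nonempty D.V) :
    D.Connected ↔ D.circles = 0 ∧ ∀ T : Set D.V, T.Nonempty →
      (∀ h : D.V × Field6, h.1 ∈ T → (D.wick h).1 ∈ T) → T = Set.univ := by
  rw [Diagram.connected_iff, isConn_univ_iff_closed, IsZeroCycle]
  have := not_isEmpty_of_nonempty D.V
  tauto

theorem ExpandsVertex.connected_iff {D D' : Diagram} (h : ExpandsVertex D D') :
    D.Connected ↔ D'.Connected := by
  obtain ⟨P, φ, kP, hc, kn, ks, hr, hw⟩ := h
  rw [connected_iff_of_nonempty ⟨P⟩, connected_iff_of_nonempty ⟨φ none⟩, hc]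
  let i (h : D.V × Field6) : D'.V × Field6 := (φ (expandLeg P h).1, (expandLeg P h).2)
  change ∀ h, D'.wick (i h) = i (D.wick h) at hw
  have hr : ∀ f, ¬ IsRight f → D'.wick (φ none, f) = (φ (some P), f) := by
    intro f hf
    exact hr f (by revert f; decide)
  have hr' : ∀ f, ¬ IsRight f → D'.wick (φ (some P), f) = (φ none, f) := by
    intro f hf
    rw [← hr f hf, D'.wick_wick]
  let q (o : Option D.V) : D.V := o.getD P
  have qi : ∀ h, q (φ.symm (i h).1) = h.1 := by
    rintro ⟨v, f⟩
    simp only [i, φ.symm_apply_apply]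
    by_cases hv : v = P
    · subst hv
      by_cases hf : IsRight f
      · rw [expandLeg_right v hf]; rfl
      · rw [expandLeg_left v hf]; rfl
    · rw [expandLeg_of_ne hv]; rfl
  refine and_congr_right fun _ => ⟨fun hT T' hne' hcl => ?_, fun hT' T hne hcl => ?_⟩
  · have h1 : ¬ IsRight 1 := by decide
    have hnP : φ none ∈ T' ↔ φ (some P) ∈ T' :=
      ⟨fun h => by have := hcl (φ none, 1) h; rwa [hr 1 h1] at this,
        fun h => by have := hcl (φ (some P), 1) h; rwa [hr' 1 h1] at this⟩
    have hi : ∀ h, (i h).1 ∈ T' ↔ φ (some h.1) ∈ T' := by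
      rintro ⟨v, f⟩
      simp only [i]
      by_cases hv : v = P
      · subst hv
        by_cases hf : IsRight f
        · rw [expandLeg_right v hf]
        · rw [expandLeg_left v hf]; exact hnP
      · rw [expandLeg_of_ne hv]
    have := hT {v | φ (some v) ∈ T'} (by
        obtain ⟨v, hv⟩ := hne'
        obtain ⟨_ | v, rfl⟩ := φ.surjective v
        · exact ⟨P, hnP.1 hv⟩
        · exact ⟨v, hv⟩) fun h hh => by
      have := hcl (i h) ((hi h).2 hh)
      rw [hw] at this
      exact (hi _).1 this
    refine Set.eq_univ_of_forall fun v => ?_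
    obtain ⟨_ | v, rfl⟩ := φ.surjective v
    · exact hnP.2 (Set.eq_univ_iff_forall.1 this P)
    · exact Set.eq_univ_iff_forall.1 this v
  · have := hT' {v | q (φ.symm v) ∈ T} (by
        obtain ⟨v, hv⟩ := hne
        exact ⟨φ (some v), by simpa [q] using hv⟩)
      (forall_expand P φ (fun h hh => ?_) (fun f hf hh => ?_) (fun f hf hh => ?_))
    · refine Set.eq_univ_of_forall fun v => ?_
      have := Set.eq_univ_iff_forall.1 this (φ (some v))
      simpa [q] using this
    · change q (φ.symm (i h).1) ∈ T at hh
      change q (φ.symm (D'.wick (i h)).1) ∈ T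
      rw [qi] at hh
      rw [hw, qi]
      exact hcl h hh
    · change q (φ.symm (D'.wick (φ none, f)).1) ∈ T
      rw [hr f hf]
      simpa [q] using hh
    · change q (φ.symm (D'.wick (φ (some P), f)).1) ∈ T
      rw [hr' f hf]
      simpa [q] using hh

theorem ExpandsVertex.isMaximal_iff {D D' : Diagram} (h : ExpandsVertex D D') :
    D.IsMaximal ↔ D'.IsMaximal := by
  rw [Diagram.isMaximal_iff, Diagram.isMaximal_iff, h.connected_iff]
  have h1 := h.fTotal
  have h2 := h.numVertices
  refine and_congr_right fun _ => ?_
  omega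

/-! ### Relabelling -/

theorem edge_of_isAutomorphism {k : Interaction} {α : Perm Field6} (h : IsAutomorphism k α)
    (c : Colour) (i : Field6) : edge k c (α i) = α (edge k c i) := by
  have := congrArg (fun β : Perm Field6 => β (α i)) (h c)
  simpa using this.symm

theorem Diagram.Same.isMaximal_iff {D D' : Diagram} (h : D.Same D') :
    D.IsMaximal ↔ D'.IsMaximal := by
  obtain ⟨hc, φ, α, hk, hα, hw⟩ := h
  let f (h : D.V × Field6) : D'.V × Field6 := (φ h.1, α h.1 h.2)
  change ∀ h, D'.wick (f h) = f (D.wick h) at hw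
  have hf : Function.Surjective f := by
    rintro ⟨v, i⟩
    obtain ⟨v, rfl⟩ := φ.surjective v
    exact ⟨(v, (α v).symm i), by simp [f]⟩
  have hfi : Function.Injective f := by
    rintro ⟨v, i⟩ ⟨v', i'⟩ e
    obtain rfl : v = v' := φ.injective (congrArg Prod.fst e)
    exact Prod.ext rfl ((α v).injective (congrArg Prod.snd e))
  have hin : ∀ c h, D'.inner c (f h) = f (D.inner c h) := fun c h => by
    simp only [Diagram.inner, f, hk, edge_of_isAutomorphism (hα h.1)]
  have hn : D'.numVertices = D.numVertices := (Nat.card_congr φ).symm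
  have hl : ∀ c, Nat.card (D.Loop c) = Nat.card (D'.Loop c) := by
    intro c
    refine card_loop_eq (fun h => D'.loop c (f h)) (fun h => by rw [← hw, loop_wick])
      (fun h => by rw [← hin, loop_inner]) ((D'.loop_surjective c).comp hf) fun h h' e => ?_
    have := mem_of_loop_eq (D := D') (T := f '' {k | D.loop c k = D.loop c h}) ?_ ?_ e
      ⟨h, rfl, rfl⟩
    · obtain ⟨k, hk, e⟩ := this
      rw [hfi e] at hk
      exact hk.symm
    · rintro _ ⟨k, hk, rfl⟩
      exact ⟨D.wick k, (D.loop_wick c k).trans hk, (hw k).symm⟩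
    · rintro _ ⟨k, hk, rfl⟩
      exact ⟨D.inner c k, (D.loop_inner c k).trans hk, (hin c k).symm⟩
  have hft : D'.fTotal = D.fTotal := by
    simp only [Diagram.fTotal, hl, hc]
  have hcon : D.Connected ↔ D'.Connected := by
    by_cases hV : Nonempty D.V
    · rw [connected_iff_of_nonempty hV, connected_iff_of_nonempty (hV.map φ), hc]
      refine and_congr_right fun _ => ⟨fun hT T' ⟨t, ht⟩ hcl => ?_, fun hT' T ⟨t, ht⟩ hcl => ?_⟩
      · have := hT {v | φ v ∈ T'} ⟨φ.symm t, by simpa using ht⟩ fun h hh => by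
          have := hcl (f h) hh
          rwa [hw] at this
        refine Set.eq_univ_of_forall fun v => ?_
        have := Set.eq_univ_iff_forall.1 this (φ.symm v)
        simpa using this
      · have := hT' {v | φ.symm v ∈ T} ⟨φ t, by simpa using ht⟩ fun h hh => by
          obtain ⟨h, rfl⟩ := hf h
          have := hcl h (by simpa [f] using hh)
          rw [hw]
          simpa [f] using this
        refine Set.eq_univ_of_forall fun v => ?_
        have := Set.eq_univ_iff_forall.1 this (φ v)
        simpa using this
    · have hV' : ¬ Nonempty D'.V := fun h => hV (h.map φ.symm)
      rw [Connected, Connected, IsZeroCycle, IsZeroCycle, hc]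
      have h1 := not_nonempty_iff.1 hV
      have h2 := not_nonempty_iff.1 hV'
      tauto
  rw [Diagram.isMaximal_iff, Diagram.isMaximal_iff, hcon, hn, hft]

theorem Melonic.isMaximal {D : Diagram} (h : Melonic D) : D.IsMaximal := by
  induction h with
  | zeroCycle D h => exact Diagram.isMaximal_iff.2 ⟨Or.inl h, h.fTotal⟩
  | prismMove D D' _ h ih =>
    rcases h with h | h | h
    · exact (h.isMaximal_iff (closedSnail_isInsertable _)).1 ih
    · exact (h.isMaximal_iff (closedMelon_isInsertable _)).1 ih
    · exact h.isMaximal_iff.1 ih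
  | wheelMove D D' _ h ih =>
    rcases h with h | h
    · exact (h.isMaximal_iff (closedSnail_isInsertable _)).1 ih
    · exact (h.isMaximal_iff (closedMelon_isInsertable _)).1 ih
  | same D D' _ h ih => exact h.isMaximal_iff.1 ih

/-! ### Inverse moves -/

theorem IsAutomorphism.inv {k : Interaction} {α : Perm Field6} (h : IsAutomorphism k α) :
    IsAutomorphism k α⁻¹ := fun c => by
  have := h c
  rw [Perm.one_apply] at this ⊢
  nth_rewrite 1 [← this]
  group

theorem isAutomorphism_one (k : Interaction) : IsAutomorphism k 1 := fun c => by simp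

namespace Diagram

variable {D : Diagram}

/-- The diagram with the fields of each vertex renamed. -/
def relabel (D : Diagram) (α : D.V → Perm Field6) : Diagram where
  V := D.V
  finite := D.finite
  kind := D.kind
  wick h := ((D.wick (h.1, (α h.1)⁻¹ h.2)).1,
    α (D.wick (h.1, (α h.1)⁻¹ h.2)).1 (D.wick (h.1, (α h.1)⁻¹ h.2)).2)
  wick_wick h := by simp [D.wick_wick]
  wick_ne := by
    rintro ⟨v, i⟩ e
    obtain ⟨i, rfl⟩ := (α v).surjective i
    have e0 : (α v)⁻¹ (α v i) = i := (α v).symm_apply_apply i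
    dsimp only at e
    rw [e0] at e
    have hne := D.wick_ne (v, i)
    generalize D.wick (v, i) = k at e hne
    obtain ⟨w, j⟩ := k
    obtain rfl : w = v := congrArg Prod.fst e
    exact hne (Prod.ext rfl ((α w).injective (congrArg Prod.snd e)))
  circles := D.circles

theorem relabel_wick (α : D.V → Perm Field6) {v w : D.V} {i j : Field6}
    (h : D.wick (v, i) = (w, j)) : (D.relabel α).wick (v, α v i) = (w, α w j) := by
  simp [relabel, h]

theorem relabel_same (α : D.V → Perm Field6) (hα : ∀ v, IsAutomorphism (D.kind v) (α v)) :
    (D.relabel α).Same D :=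
  ⟨rfl, Equiv.refl _, fun v => (α v)⁻¹, fun _ => rfl, fun v => (hα v).inv, fun h => by
    refine Prod.ext rfl ?_
    exact ((α _).symm_apply_apply _).symm⟩

/-- The diagram on a set of vertices with given contractions. -/
def restrict (D : Diagram) (X : Set D.V) (W : D.V × Field6 → D.V × Field6)
    (hX : ∀ k, k.1 ∈ X → (W k).1 ∈ X) (hW : ∀ k, k.1 ∈ X → W (W k) = k)
    (hne : ∀ k, k.1 ∈ X → W k ≠ k) (n : ℕ) : Diagram where
  V := X
  finite := inferInstance
  kind v := D.kind v
  wick k := (⟨(W (k.1, k.2)).1, hX _ k.1.2⟩, (W (k.1, k.2)).2)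
  wick_wick k := by
    have := hW (k.1, k.2) k.1.2
    exact Prod.ext (Subtype.ext (congrArg Prod.fst this)) (congrArg Prod.snd this :)
  wick_ne k e := hne (k.1, k.2) k.1.2
    (Prod.ext (congrArg (fun h => (h.1 : D.V)) e) (congrArg Prod.snd e :))
  circles := n

end Diagram

/-- Inverse of an insertion: if `D` contains `E` with at most the propagator `{a, wick a}` cut, the
copy is deleted and the two outside ends are contracted with each other. -/
theorem exists_replacesPropagator {D E : Diagram} (hD : D.circles = 0) (ι : E.V → D.V)
    (hι : Function.Injective ι) (hk : ∀ u, D.kind (ι u) = E.kind u) (a : E.V × Field6)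
    (hw : ∀ b, b ≠ a → b ≠ E.wick a → D.wick (ι b.1, b.2) = (ι (E.wick b).1, (E.wick b).2)) :
    ∃ D', ReplacesPropagator E D' D := by
  classical
  let j (b : E.V × Field6) : D.V × Field6 := (ι b.1, b.2)
  have hj : Function.Injective j := fun b b' e =>
    Prod.ext (hι (congrArg Prod.fst e)) (congrArg Prod.snd e :)
  have jr : ∀ b, (j b).1 ∈ Set.range ι := fun b => ⟨b.1, rfl⟩
  have rj : ∀ h : D.V × Field6, h.1 ∈ Set.range ι → ∃ b, j b = h := by
    rintro ⟨_, i⟩ ⟨u, rfl⟩; exact ⟨(u, i), rfl⟩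
  change ∀ b, b ≠ a → b ≠ E.wick a → D.wick (j b) = j (E.wick b) at hw
  let X : Set D.V := (Set.range ι)ᶜ
  have key : ∀ a, (∀ b, b ≠ a → b ≠ E.wick a → D.wick (j b) = j (E.wick b)) →
      (D.wick (j a)).1 ∈ X → (D.wick (j (E.wick a))).1 ∈ X := by
    intro a hw h1 h2
    obtain ⟨b, hb⟩ := rj _ h2
    have hb' : D.wick (j b) = j (E.wick a) := by rw [hb, D.wick_wick]
    by_cases e1 : b = a
    · subst e1
      rw [hb'] at h1
      exact h1 (jr _)
    by_cases e2 : b = E.wick a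
    · subst e2
      exact D.wick_ne _ hb'
    rw [hw b e1 e2] at hb'
    exact e1 (wick_injective (hj hb'))
  have key' : (D.wick (j (E.wick a))).1 ∈ X → (D.wick (j a)).1 ∈ X := by
    intro h
    have := key (E.wick a) (fun b h1 h2 => hw b (by rwa [E.wick_wick] at h2) h1) h
    rwa [E.wick_wick] at this
  have key := key a hw
  have hout : ∀ k : D.V × Field6, k.1 ∈ X → k ≠ D.wick (j a) → k ≠ D.wick (j (E.wick a)) →
      (D.wick k).1 ∈ X := by
    intro k hk h1 h2 h3
    obtain ⟨b, hb⟩ := rj _ h3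
    have hb' : D.wick (j b) = k := by rw [hb, D.wick_wick]
    rw [← hb'] at h1 h2 hk
    rw [hw b (fun e => h1 (by rw [e])) (fun e => h2 (by rw [e]))] at hk
    exact hk (jr _)
  set p := D.wick (j a) with hp
  set q := D.wick (j (E.wick a)) with hq
  have hpq : p ≠ q := fun e => E.wick_ne a (hj (wick_injective e)).symm
  have hpj : D.wick p = j a := D.wick_wick _
  have hqj : D.wick q = j (E.wick a) := D.wick_wick _
  -- By `key` and `key'` the ends `p` and `q` both lie outside the copy or both inside it.
  let W (k : D.V × Field6) : D.V × Field6 := if k = p then q else if k = q then p else D.wick k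
  have Wp : W p = q := if_pos rfl
  have Wq : W q = p := by simp only [W, if_neg hpq.symm, if_true]
  have Wo : ∀ k, k ≠ p → k ≠ q → W k = D.wick k := fun k h1 h2 => by simp only [W, if_neg h1, if_neg h2]
  have WX : ∀ k, k.1 ∈ X → (W k).1 ∈ X := by
    intro k hk
    by_cases h1 : k = p
    · subst h1; rw [Wp]; exact key hk
    by_cases h2 : k = q
    · subst h2; rw [Wq]; exact key' hk
    rw [Wo k h1 h2]; exact hout k hk h1 h2
  have WW : ∀ k, k.1 ∈ X → W (W k) = k := by
    intro k hk
    by_cases h1 : k = p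
    · rw [h1, Wp, Wq]
    by_cases h2 : k = q
    · rw [h2, Wq, Wp]
    rw [Wo k h1 h2, Wo, D.wick_wick]
    · intro e
      have : k = j a := by rw [← hpj, ← e, D.wick_wick]
      exact hk (this ▸ jr a)
    · intro e
      have : k = j (E.wick a) := by rw [← hqj, ← e, D.wick_wick]
      exact hk (this ▸ jr _)
  have Wne : ∀ k, k.1 ∈ X → W k ≠ k := by
    intro k hk
    by_cases h1 : k = p
    · rw [h1, Wp]; exact hpq.symm
    by_cases h2 : k = q
    · rw [h2, Wq]; exact hpq
    rw [Wo k h1 h2]; exact D.wick_ne k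
  -- If the ends lie inside, the copy is a closed `E`, and removing it leaves a circle.
  let D' := D.restrict X W WX WW Wne (if p.1 ∈ X then 0 else 1)
  have hbij : Function.Bijective (Sum.elim Subtype.val ι : X ⊕ E.V → D.V) := by
    constructor
    · rintro (u | u) (u' | u') e
      · exact congrArg _ (Subtype.ext e)
      · exact absurd ⟨u', e.symm⟩ u.2
      · exact absurd ⟨u, e⟩ u'.2
      · exact congrArg _ (hι e)
    · intro v
      by_cases hv : v ∈ X
      · exact ⟨Sum.inl ⟨v, hv⟩, rfl⟩
      · obtain ⟨u, hu⟩ := not_not.1 hv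
        exact ⟨Sum.inr u, hu⟩
  have hWo : ∀ k : D'.V × Field6, (k.1.1, k.2) ≠ p → (k.1.1, k.2) ≠ q →
      D.wick (k.1.1, k.2) = ((D'.wick k).1.1, (D'.wick k).2) := by
    intro k h1 h2
    rw [← Wo _ h1 h2]
    rfl
  refine ⟨D', Equiv.ofBijective _ hbij, fun v => rfl, hk, ?_⟩
  by_cases hpX : p.1 ∈ X
  · refine Or.inl ⟨by rw [hD]; exact (if_pos hpX).symm, (⟨p.1, hpX⟩, p.2), a, hpj, ?_, ?_, hw⟩
    · change D.wick (W p) = j (E.wick a)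
      rw [Wp, hqj]
    · intro k h1 h2
      refine hWo k (fun e => h1 ?_) (fun e => h2 ?_)
      · exact Prod.ext (Subtype.ext (congrArg Prod.fst e)) (congrArg Prod.snd e :)
      · rw [← Wp] at e
        exact Prod.ext (Subtype.ext (congrArg Prod.fst e)) (congrArg Prod.snd e :)
  · have hqX : q.1 ∉ X := fun h => hpX (key' h)
    refine Or.inr ⟨by rw [hD]; change 0 + 1 = ite _ _ _; rw [if_neg hpX], fun k => ?_, ?_⟩
    · exact hWo k (fun e => hpX (e ▸ k.1.2)) (fun e => hqX (e ▸ k.1.2))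
    · intro b
      change D.wick (j b) = j (E.wick b)
      have hpa : p = j (E.wick a) := by
        obtain ⟨b, hb⟩ := rj p (not_not.1 hpX)
        have hb' : D.wick (j b) = j a := by rw [hb, hpj]
        by_cases e1 : b = a
        · subst e1; exact absurd hb' (D.wick_ne _)
        by_cases e2 : b = E.wick a
        · rw [← hb, e2]
        rw [hw b e1 e2] at hb'
        exact absurd (by rw [← hj hb', E.wick_wick]) e2
      by_cases e1 : b = a
      · rw [e1]; exact hpa
      by_cases e2 : b = E.wick a
      · rw [e2, E.wick_wick, ← hpa, hpj]
      exact hw b e1 e2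

/-- Inverse of an expansion: `L` is absorbed into `R`, the fields 4, 5, 6 of `L` replacing the
contracted fields 3, 2, 1 of `R`. -/
theorem exists_expandsVertex {D : Diagram} {L R : D.V} (hLR : L ≠ R) (hL : D.kind L = prism)
    (hR : D.kind R = prism) (hw : ∀ i, ¬ IsRight i → D.wick (L, i) = (R, i)) :
    ∃ D', ExpandsVertex D' D := by
  classical
  have hw' : ∀ i, ¬ IsRight i → D.wick (R, i) = (L, i) := fun i hi => by rw [← hw i hi, D.wick_wick]
  let σ := snailPairing prism
  have σσ : ∀ f, σ (σ f) = f := snailPairing_snailPairing prism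
  have hσ : ∀ f, IsRight (σ f) ↔ ¬ IsRight f := isRight_snailPairing
  let X : Set D.V := {L}ᶜ
  -- `g` places the half-edges of the reduced diagram into `D`, `p` goes back, and `good` describes
  -- the image, that is all half-edges off the three contracted pairs.
  let g (k : D.V × Field6) : D.V × Field6 := if k.1 = R ∧ ¬ IsRight k.2 then (L, σ k.2) else k
  let p (k : D.V × Field6) : D.V × Field6 := if k.1 = L then (R, σ k.2) else k
  let good (k : D.V × Field6) : Prop := k.1 = L ∨ k.1 = R → IsRight k.2
  have gg : ∀ k : D.V × Field6, k.1 ∈ X → good (g k) := by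
    rintro ⟨v, i⟩ hv
    by_cases h : v = R ∧ ¬ IsRight i
    · simp only [g, if_pos h, good]
      exact fun _ => (hσ i).2 h.2
    · simp only [g, if_neg h, good]
      rintro (rfl | rfl)
      · exact absurd rfl hv
      · by_contra hi
        exact h ⟨rfl, hi⟩
  have wg : ∀ k, good k → good (D.wick k) := by
    intro k hk h
    by_contra hi
    have : k = D.wick (D.wick k) := (D.wick_wick k).symm
    generalize D.wick k = k' at this h hi
    obtain ⟨v, i⟩ := k'
    rcases h with rfl | rfl
    · rw [hw i hi] at this
      subst this
      exact hi (hk (Or.inr rfl))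
    · rw [hw' i hi] at this
      subst this
      exact hi (hk (Or.inl rfl))
  have gp : ∀ k, good k → g (p k) = k := by
    rintro ⟨v, i⟩ hk
    by_cases h : v = L
    · subst h
      have : IsRight i := hk (Or.inl rfl)
      simp only [p, if_true, g]
      rw [if_pos ⟨trivial, by rw [hσ]; exact not_not.2 this⟩, σσ]
    · simp only [p, if_neg h, g]
      exact if_neg fun h' => h'.2 (hk (Or.inr h'.1))
  have pg : ∀ k : D.V × Field6, k.1 ∈ X → p (g k) = k := by
    rintro ⟨v, i⟩ hv
    by_cases h : v = R ∧ ¬ IsRight i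
    · simp only [g, if_pos h, p, if_true, σσ]
      rw [h.1]
    · simp only [g, if_neg h, p]
      exact if_neg hv
  have pX : ∀ k, (p k).1 ∈ X := by
    rintro ⟨v, i⟩
    by_cases h : v = L
    · simp only [p, if_pos h]
      exact hLR.symm
    · simp only [p, if_neg h]
      exact h
  let W (k : D.V × Field6) : D.V × Field6 := p (D.wick (g k))
  have gW : ∀ k : D.V × Field6, k.1 ∈ X → g (W k) = D.wick (g k) := fun k hk => gp _ (wg _ (gg k hk))
  let D' := D.restrict X W (fun k _ => pX _)
    (fun k hk => by
      change p (D.wick (g (W k))) = k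
      rw [gW k hk, D.wick_wick, pg k hk])
    (fun k hk e => by
      have := gW k hk
      rw [e] at this
      exact D.wick_ne _ this.symm) D.circles
  have hbij : Function.Bijective (fun o : Option X => o.elim L Subtype.val) := by
    constructor
    · rintro (_ | u) (_ | u') e
      · rfl
      · exact absurd e.symm u'.2
      · exact absurd e u.2
      · exact congrArg _ (Subtype.ext e)
    · intro v
      by_cases hv : v = L
      · exact ⟨none, hv.symm⟩
      · exact ⟨some ⟨v, hv⟩, rfl⟩
  let φ : Option D'.V ≃ D.V := Equiv.ofBijective _ hbij
  let P : D'.V := ⟨R, hLR.symm⟩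
  have hφ : ∀ h : D'.V × Field6, (φ (expandLeg P h).1, (expandLeg P h).2) = g (h.1.1, h.2) := by
    rintro ⟨v, i⟩
    by_cases hv : v = P
    · subst hv
      by_cases hi : IsRight i
      · rw [expandLeg_right _ hi]
        simp only [g]
        rw [if_neg fun h => h.2 hi]
        rfl
      · rw [expandLeg_left _ hi]
        simp only [g]
        rw [if_pos ⟨rfl, hi⟩]
        rfl
    · rw [expandLeg_of_ne hv]
      simp only [g]
      rw [if_neg fun h => hv (Subtype.ext h.1)]
      rfl
  refine ⟨D', P, φ, hR, rfl, hL, fun _ => rfl, fun i hi => hw i ?_, fun h => ?_⟩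
  · revert i; decide
  · rw [hφ, hφ, ← gW _ h.1.2]
    rfl

/-! ### Maximal diagrams are generated by the moves -/

namespace Diagram

variable {D : Diagram}

/-- Two separate pieces would each have a positive even number of legs, at least four together. -/
theorem isConn_of_ncard_legs_le_two (hD : D.IsConn Set.univ) {S : Set D.V} (hS : S.Nonempty)
    (hl : (D.legs S).ncard ≤ 2) : D.IsConn S := by
  refine ⟨hS, fun T hT hne hcl => ?_⟩
  by_contra hTS
  obtain ⟨u, hu, huT⟩ := Set.not_subset.1 fun h => hTS (hT.antisymm h)
  obtain ⟨t, ht⟩ := hne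
  have hcl' : ∀ h : D.V × Field6, h.1 ∈ S \ T → (D.wick h).1 ∈ S → (D.wick h).1 ∈ S \ T :=
    fun h hh hw => ⟨hw, fun hwT => hh.2 (by
      have := hcl (D.wick h) hwT (by rw [D.wick_wick]; exact hh.1)
      rwa [D.wick_wick] at this)⟩
  have n1 := legs_nonempty hD (S := T) ⟨t, ht⟩ fun e => huT (e ▸ trivial)
  have n2 := legs_nonempty hD (S := S \ T) ⟨u, hu, huT⟩ fun e => (e ▸ trivial : t ∈ S \ T).2 ht
  have c1 := two_le_of_even (even_legs T) ((Set.ncard_pos (Set.toFinite _)).2 n1).ne'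
  have c2 := two_le_of_even (even_legs (S \ T)) ((Set.ncard_pos (Set.toFinite _)).2 n2).ne'
  have hd : Disjoint (D.legs T) (D.legs (S \ T)) :=
    Set.disjoint_left.2 fun h h1 h2 => h2.1.2 h1.1
  have := Set.ncard_le_ncard (s := D.legs T ∪ D.legs (S \ T)) (t := D.legs S) (by
    rintro h (hh | hh)
    · exact ⟨hT hh.1, fun hw => hh.2 (hcl h hh.1 hw)⟩
    · exact ⟨hh.1.1, fun hw => hh.2 (hcl' h hh.1 hw)⟩)
  rw [Set.ncard_union_eq hd] at this
  omega

/-- A smallest nonempty vertex set with at most two legs. -/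
structure IsSmallest (D : Diagram) (S : Set D.V) : Prop where
  nonempty : S.Nonempty
  legs_le : (D.legs S).ncard ≤ 2
  le : ∀ T : Set D.V, T.Nonempty → (D.legs T).ncard ≤ 2 → S.ncard ≤ T.ncard

theorem exists_isSmallest (D : Diagram) [Nonempty D.V] : ∃ S, D.IsSmallest S := by
  obtain ⟨S, ⟨h1, h2⟩, h3⟩ := (measure (Set.ncard (α := D.V))).wf.has_min
    {S | S.Nonempty ∧ (D.legs S).ncard ≤ 2} ⟨Set.univ, Set.univ_nonempty, by simp [legs_univ]⟩
  exact ⟨S, h1, h2, fun T h h' => not_lt.1 (h3 T ⟨h, h'⟩)⟩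

theorem ncard_pair_le {X : Type*} (a b : X) : ({a, b} : Set X).ncard ≤ 2 := by
  have := Set.ncard_insert_le a {b}
  rwa [Set.ncard_singleton] at this

/-- By minimality `K`, which misses `A`, cannot lie in `S`. The complement of `S` is connected and
meets `K`, and no leg of `K` leads into it, so `K` contains all of it. -/
theorem IsSmallest.compl_subset (hD : D.IsConn Set.univ) {S A K : Set D.V} (hS : D.IsSmallest S)
    (hA : A ⊆ S) {h h' : D.V × Field6} (h1 : h.1 ∈ A) (h2 : h'.1 ∈ A) (hd : Disjoint K A)
    (hl : D.legs K = {D.wick h, D.wick h'}) : Sᶜ.Nonempty ∧ Sᶜ ⊆ K := by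
  have hK : K.Nonempty := ⟨_, fst_mem_of_legs_eq hl⟩
  have hle := hS.le K hK (by rw [hl]; exact ncard_pair_le _ _)
  have hKS : ¬ K ⊆ S := fun hsub => by
    have := Set.eq_of_subset_of_ncard_le hsub hle
    exact Set.disjoint_left.1 hd (this ▸ hA h1) h1
  obtain ⟨u, hu, huS⟩ := Set.not_subset.1 hKS
  refine ⟨⟨u, huS⟩, subset_of_isConn (isConn_of_ncard_legs_le_two hD ⟨u, huS⟩
    (by rw [ncard_legs_compl]; exact hS.legs_le)) huS hu fun k hk hw => hw (hA ?_)⟩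
  exact wick_mem_of_legs_eq h1 h2 hl k hk

/-- At most one pair of twin legs inside a smallest vertex set is not contracted directly. -/
theorem IsSmallest.twin_unique (hD : D.IsConn Set.univ) {S A : Set D.V} (hS : D.IsSmallest S)
    (hA : A ⊆ S) {h h' g g' : D.V × Field6} (t1 : D.Twin A h h') (t2 : D.Twin A g g')
    (n1 : D.wick h ≠ h') (n2 : D.wick g ≠ g') : g = h ∨ g = h' := by
  obtain ⟨-, a1, b1, c1⟩ := t1
  obtain ⟨-, a2, b2, c2⟩ := t2
  obtain ⟨K, k1, k2, k3⟩ := c1.resolve_left n1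
  obtain ⟨K', k1', k2', k3'⟩ := c2.resolve_left n2
  obtain ⟨⟨u, hu⟩, hs⟩ := hS.compl_subset hD hA a1 b1 k2 k3
  obtain rfl := eq_of_isConn k1 k1' k2 k2' (wick_mem_of_legs_eq a1 b1 k3)
    (wick_mem_of_legs_eq a2 b2 k3') (hs hu) ((hS.compl_subset hD hA a2 b2 k2' k3').2 hu)
  have : D.wick g ∈ ({D.wick h, D.wick h'} : Set _) := by rw [← k3, k3']; exact Or.inl rfl
  exact this.imp (fun e => wick_injective e) (fun e => wick_injective e)

/-- A short loop inside a set of regular vertices is a two-cycle. -/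
theorem exists_two_cycle {c : Colour} {S : Set D.V} (hreg : ∀ v ∈ S, D.IsRegular v)
    {n : ℕ} (hn : {h : D.V × Field6 | D.loop c h ∈ D.innerLoops c S}.ncard < 6 * n)
    (hle : n ≤ (D.innerLoops c S).ncard) :
    ∃ L R x y, L ∈ S ∧ R ∈ S ∧ L ≠ R ∧ D.wick (L, x) = (R, y) ∧
      D.wick (L, edge (D.kind L) c x) = (R, edge (D.kind R) c y) := by
  classical
  have : Fintype D.V := Fintype.ofFinite _
  have : Fintype (D.Loop c) := Fintype.ofFinite _
  obtain ⟨l, hl, h6⟩ := Finset.exists_card_fiber_lt_of_card_lt_nsmul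
    (s := {h : D.V × Field6 | D.loop c h ∈ D.innerLoops c S}.toFinset)
    (t := (D.innerLoops c S).toFinset) (f := D.loop c) (b := 6) (by
      rw [← Set.ncard_eq_toFinset_card', ← Set.ncard_eq_toFinset_card', smul_eq_mul, Nat.cast_id]
      omega)
  rw [Set.mem_toFinset] at hl
  rw [Nat.cast_id] at h6
  set T : Set (D.V × Field6) := {h | D.loop c h = l} with hT
  have hT6 : T.ncard < 6 := by
    rw [Set.ncard_eq_toFinset_card']
    refine lt_of_eq_of_lt (congrArg Finset.card ?_) h6
    ext h
    simp only [Set.mem_toFinset, Finset.mem_filter, hT, Set.mem_ofPred_eq]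
    exact ⟨fun e => ⟨by rw [e]; exact hl, e⟩, fun e => e.2⟩
  have hTw : ∀ h ∈ T, D.wick h ∈ T := fun h hh => (D.loop_wick c h).trans hh
  have hTe : ∀ h ∈ T, D.inner c h ∈ T := fun h hh => (D.loop_inner c h).trans hh
  have hTS : ∀ h ∈ T, h.1 ∈ S := fun h hh => hl h hh
  obtain ⟨⟨L, x⟩, hx⟩ := D.loop_surjective c l
  change (L, x) ∈ T at hx
  obtain ⟨⟨R, y⟩, hy⟩ : ∃ k, D.wick (L, x) = k := ⟨_, rfl⟩
  have hyT : (R, y) ∈ T := hy ▸ hTw _ hx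
  have hxT' : (L, edge (D.kind L) c x) ∈ T := hTe _ hx
  have hyT' : (R, edge (D.kind R) c y) ∈ T := hTe _ hyT
  have hLS := hTS _ hx
  have hRS := hTS _ hyT
  have hLR : L ≠ R := by
    rintro rfl
    exact (hreg L hLS).not_oneCycle hy
  refine ⟨L, R, x, y, hLS, hRS, hLR, hy, ?_⟩
  let Q : Set (D.V × Field6) :=
    {(L, x), (L, edge (D.kind L) c x), (R, y), (R, edge (D.kind R) c y)}
  have hQ : Q.ncard = 4 := by
    have e1 := edge_ne (D.kind L) c x
    have e2 := edge_ne (D.kind R) c y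
    simp only [Q]
    rw [Set.ncard_insert_of_notMem, Set.ncard_insert_of_notMem, Set.ncard_pair] <;>
      simp [hLR, e1.symm, e2.symm]
  have hQT : Q ⊆ T := by
    rintro _ (rfl | rfl | rfl | rfl) <;> assumption
  have heven : Even T.ncard :=
    even_ncard_of_involution D.wick hTw (fun h _ => D.wick_wick h) (fun h _ => D.wick_ne h)
  have hQT' : Q = T := by
    refine Set.eq_of_subset_of_ncard_le hQT ?_
    have := Set.ncard_le_ncard hQT
    obtain ⟨r, hr⟩ := heven
    omega
  have := hTw _ hxT'
  rw [← hQT'] at this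
  rcases this with e | e | e | e
  · exact absurd e (hreg L hLS).not_oneCycle
  · exact absurd e (hreg L hLS).not_oneCycle
  · rw [← hy] at e
    exact absurd (congrArg Prod.snd (wick_injective e)) (edge_ne _ _ _)
  · exact e

/-- In the prism a field lies on one triangle, and any colour other than that of the opposite side
will do; the wheel has no triangles. -/
theorem exists_colour_not_opposite (k : Interaction) (i : Field6) : ∃ c, ∀ x, ∃ c',
    ¬ (edge k c' x = edge k c x ∨ edge k c' x = i ∨ edge k c' (edge k c x) = i) := by
  revert k i; decide +kernel

/-- Without legs there are `|S| + 1` loops on `6|S|` half-edges. With two legs there are `|S|` inner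
loops of every colour, and the loops through the legs use up some half-edges. The colour is then
free, and is chosen so that no 2-cycle of this colour is opposite to the leg `g` in a triangle. -/
theorem IsSmallest.exists_two_cycle (hD : D.IsPlanar) {S : Set D.V} (hS : D.IsSmallest S)
    (hreg : ∀ v ∈ S, D.IsRegular v) :
    ∃ c L R x y, (∀ h ∈ D.legs S, ∃ g ∈ D.legs S, ∀ x, ∃ c', ¬ (
        edge (D.kind g.1) c' x = edge (D.kind g.1) c x ∨ edge (D.kind g.1) c' x = g.2 ∨
          edge (D.kind g.1) c' (edge (D.kind g.1) c x) = g.2)) ∧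
      L ∈ S ∧ R ∈ S ∧ L ≠ R ∧ D.wick (L, x) = (R, y) ∧
      D.wick (L, edge (D.kind L) c x) = (R, edge (D.kind R) c y) := by
  have hcount : {h : D.V × Field6 | h.1 ∈ S}.ncard = 6 * S.ncard := by
    have : {h : D.V × Field6 | h.1 ∈ S} = S ×ˢ Set.univ := by ext h; simp
    rw [this, Set.ncard_prod, Set.ncard_univ, Nat.card_eq_fintype_card, Fintype.card_fin, mul_comm]
  have hsub : ∀ c, {h : D.V × Field6 | D.loop c h ∈ D.innerLoops c S} ⊆ {h | h.1 ∈ S} :=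
    fun c h hh => hh h rfl
  by_cases hl : D.legs S = ∅
  · have hSu : S = Set.univ := by
      by_contra hne
      have := legs_nonempty hD.conn hS.nonempty hne
      rw [hl] at this
      exact Set.not_nonempty_empty this
    obtain ⟨L, R, x, y, h⟩ := Diagram.exists_two_cycle (c := red) hreg (n := S.ncard + 1)
      (by have := Set.ncard_le_ncard (hsub red); omega) (by
        have := hD.card_loop red
        rw [hSu, innerLoops_univ, Set.ncard_univ, Set.ncard_univ, this])
    exact ⟨red, L, R, x, y, fun h hh => by rw [hl] at hh; exact hh.elim, h⟩
  · obtain ⟨g, hg⟩ := Set.nonempty_iff_ne_empty.2 hl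
    obtain ⟨c, hc⟩ := exists_colour_not_opposite (D.kind g.1) g.2
    have hconn := isConn_of_ncard_legs_le_two hD.conn hS.nonempty hS.legs_le
    have hconn' := isConn_of_ncard_legs_le_two hD.conn (S := Sᶜ) ⟨_, hg.2⟩
      (by rw [ncard_legs_compl]; exact hS.legs_le)
    obtain ⟨m, h1, h2, h3, -⟩ := hD.bond hconn hconn'
    have h3 := h3 c
    obtain ⟨r, rfl⟩ := h2
    have h4 := hS.legs_le
    obtain ⟨L, R, x, y, h⟩ := Diagram.exists_two_cycle (c := c) hreg (n := S.ncard) (by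
      rw [← hcount]
      refine Set.ncard_lt_ncard ⟨hsub c, fun h => ?_⟩
      exact hg.2 (h hg.1 _ (D.loop_wick c g))) (by omega)
    exact ⟨c, L, R, x, y, fun _ _ => ⟨g, hg, hc⟩, h⟩

/-- `D` is obtained by a move from a smaller maximal diagram. -/
def IsReducible (D : Diagram) : Prop :=
  ∃ D' : Diagram, D'.IsMaximal ∧ D'.numVertices < D.numVertices ∧ (Melonic D' → Melonic D)

theorem IsReducible.of_same {D' : Diagram} (h : D.Same D') (hr : D.IsReducible) :
    D'.IsReducible := by
  obtain ⟨D'', h1, h2, h3⟩ := hr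
  obtain ⟨φ, -⟩ := h.2
  exact ⟨D'', h1, by rwa [numVertices, numVertices, ← Nat.card_congr φ], fun hm => (h3 hm).same _ _ h⟩

theorem isReducible_of_replacesPropagator {E D' : Diagram} (hD : D.IsMaximal)
    (hE : E.IsInsertable) (hm : Melonic D' → ReplacesPropagator E D' D → Melonic D)
    (h : ReplacesPropagator E D' D) : D.IsReducible := by
  refine ⟨D', (h.isMaximal_iff hE).2 hD, ?_, fun h' => hm h' h⟩
  have : 0 < E.numVertices := by
    obtain ⟨⟨v, -⟩, -⟩ := hE.conn
    have : Nonempty E.V := ⟨v⟩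
    exact Nat.card_pos
  have := h.numVertices
  omega

theorem isReducible_of_closedSnail {k : Interaction} {D' : Diagram} (hD : D.IsMaximal)
    (h : ReplacesPropagator (closedSnail k) D' D) : D.IsReducible := by
  refine isReducible_of_replacesPropagator hD (closedSnail_isInsertable k) (fun hm h => ?_) h
  cases k
  · exact .prismMove _ _ hm (Or.inl h)
  · exact .wheelMove _ _ hm (Or.inl h)

theorem isReducible_of_closedMelon {k : Interaction} {D' : Diagram} (hD : D.IsMaximal)
    (h : ReplacesPropagator (closedMelon k) D' D) : D.IsReducible := by
  refine isReducible_of_replacesPropagator hD (closedMelon_isInsertable k) (fun hm h => ?_) h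
  cases k
  · exact .prismMove _ _ hm (Or.inr (Or.inl h))
  · exact .wheelMove _ _ hm (Or.inr h)

theorem isReducible_of_snail (hD : D.IsMaximal) (hc : D.circles = 0) {v : D.V}
    {s : Perm Field6} (hs : IsSnailPairing (D.kind v) s) {a : Field6}
    (hw : ∀ i, i ≠ a → i ≠ s a → D.wick (v, i) = (v, s i)) : D.IsReducible := by
  classical
  obtain ⟨α, hα, rfl⟩ := hs
  let β : D.V → Perm Field6 := Function.update (fun _ => 1) v α⁻¹
  have hβ : β v = α⁻¹ := Function.update_self _ _ _
  have hsame := D.relabel_same β fun u => by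
    by_cases hu : u = v
    · subst hu; rw [hβ]; exact hα.inv
    · simp only [β, Function.update_of_ne hu]; exact isAutomorphism_one _
  obtain ⟨D', h⟩ := exists_replacesPropagator (D := D.relabel β) (E := closedSnail (D.kind v)) hc
    (fun _ => v) (fun _ _ _ => rfl) (fun _ => rfl) ((), α⁻¹ a) (by
      rintro ⟨⟨⟩, i⟩ h1 h2
      have h1 : α i ≠ a := fun e => h1 (by rw [← e]; simp)
      have h2 : α i ≠ (α * snailPairing (D.kind v) * α⁻¹) a := fun e => h2 (by
        refine Prod.ext rfl ?_
        change i = snailPairing (D.kind v) (α⁻¹ a)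
        exact α.injective e)
      have := relabel_wick β (hw (α i) h1 h2)
      rw [hβ] at this
      change (D.relabel β).wick (v, i) = (v, snailPairing (D.kind v) i)
      simpa using this)
  exact (isReducible_of_closedSnail (hsame.isMaximal_iff.2 hD) h).of_same hsame

theorem isReducible_of_melon (hD : D.IsMaximal) (hc : D.circles = 0) {L R : D.V} (hLR : L ≠ R)
    (hk : D.kind L = D.kind R) {ρ : Perm Field6} (hρ : IsAutomorphism (D.kind R) ρ) {a : Field6}
    (hw : ∀ i, i ≠ a → D.wick (L, i) = (R, ρ i)) : D.IsReducible := by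
  classical
  let β : D.V → Perm Field6 := Function.update (fun _ => 1) R ρ⁻¹
  have hβ : β R = ρ⁻¹ := Function.update_self _ _ _
  have hβ' : β L = 1 := Function.update_of_ne hLR _ _
  have hsame := D.relabel_same β fun u => by
    by_cases hu : u = R
    · subst hu; rw [hβ]; exact hρ.inv
    · simp only [β, Function.update_of_ne hu]; exact isAutomorphism_one _
  have hw' : ∀ i, i ≠ a → (D.relabel β).wick (L, i) = (R, i) := fun i hi => by
    have := relabel_wick β (hw i hi)
    rw [hβ, hβ'] at this
    simpa using this
  obtain ⟨D', h⟩ := exists_replacesPropagator (D := D.relabel β) (E := closedMelon (D.kind L)) hc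
    (fun b : Bool => bif b then R else L) (by
      rintro (_ | _) (_ | _) e
      · rfl
      · exact absurd e hLR
      · exact absurd e.symm hLR
      · rfl) (by
      rintro (_ | _)
      · rfl
      · exact hk.symm) (false, a) (by
      rintro ⟨_ | _, i⟩ h1 h2
      · exact hw' i fun e => h1 (by rw [e])
      · exact (congrArg (D.relabel β).wick (hw' i fun e => h2 (by rw [e]; rfl))).symm.trans
          ((D.relabel β).wick_wick _))
  exact (isReducible_of_closedMelon (hsame.isMaximal_iff.2 hD) h).of_same hsame

/-- The three sides of a triangle have different colours, so matching sides by colour matches the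
corners; a reflection of each vertex brings the triangle to the fields 1, 2, 3. -/
theorem prism_triangle (x z t : Field6) (hxz : x ≠ z) (hx : t ≠ x) (hz : t ≠ z)
    (h : ∀ c, edge prism c x = z ∨ edge prism c x = t ∨ edge prism c z = t) (y w t' : Field6)
    (h' : ∀ c, edge prism c x = z ∧ edge prism c y = w ∨
      edge prism c x = t ∧ edge prism c y = t' ∨ edge prism c z = t ∧ edge prism c w = t') :
    ∃ α ∈ [1, snailPairing prism], ∃ β ∈ [1, snailPairing prism],
      α x = β y ∧ α z = β w ∧ α t = β t' ∧ ∀ i, ¬ IsRight i → i = α x ∨ i = α z ∨ i = α t := by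
  revert x z t y w t'; decide +kernel

theorem isAutomorphism_of_mem {α : Perm Field6} (h : α ∈ [1, snailPairing prism]) :
    IsAutomorphism prism α := by
  simp only [List.mem_cons, List.not_mem_nil, or_false] at h
  rcases h with rfl | rfl
  · exact isAutomorphism_one _
  · decide

theorem isReducible_of_triangle (hD : D.IsMaximal) {L R : D.V} (hLR : L ≠ R)
    (hL : D.kind L = prism) (hR : D.kind R = prism) {x z t y w t' : Field6} (hxz : x ≠ z)
    (htx : t ≠ x) (htz : t ≠ z)
    (h : ∀ c, edge prism c x = z ∧ edge prism c y = w ∨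
      edge prism c x = t ∧ edge prism c y = t' ∨ edge prism c z = t ∧ edge prism c w = t')
    (h1 : D.wick (L, x) = (R, y)) (h2 : D.wick (L, z) = (R, w)) (h3 : D.wick (L, t) = (R, t')) :
    D.IsReducible := by
  classical
  obtain ⟨α, hα, β, hβ, e1, e2, e3, h4⟩ := prism_triangle x z t hxz htx htz
    (fun c => by have := h c; tauto) y w t' h
  let γ : D.V → Perm Field6 := Function.update (Function.update (fun _ => 1) L α) R β
  have γR : γ R = β := Function.update_self _ _ _
  have γL : γ L = α := by
    simp only [γ, Function.update_of_ne hLR]; exact Function.update_self _ _ _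
  have hsame := D.relabel_same γ fun u => by
    by_cases hu : u = R
    · subst hu; rw [γR, hR]; exact isAutomorphism_of_mem hβ
    by_cases hu' : u = L
    · subst hu'; rw [γL, hL]; exact isAutomorphism_of_mem hα
    · simp only [γ, Function.update_of_ne hu, Function.update_of_ne hu']
      exact isAutomorphism_one _
  obtain ⟨D', hD'⟩ := exists_expandsVertex (D := D.relabel γ) hLR hL hR fun i hi => by
    have key : ∀ {p q}, D.wick (L, p) = (R, q) → α p = β q → i = α p →
        (D.relabel γ).wick (L, i) = (R, i) := by
      rintro p q e1 e2 rfl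
      have := relabel_wick γ e1
      rw [γR, γL, ← e2] at this
      exact this
    rcases h4 i hi with e | e | e
    · exact key h1 e1 e
    · exact key h2 e2 e
    · exact key h3 e3 e
  refine IsReducible.of_same hsame ⟨D', hD'.isMaximal_iff.2 (hsame.isMaximal_iff.2 hD), ?_,
    fun hm => .prismMove _ _ hm (Or.inr (Or.inr hD'))⟩
  rw [hD'.numVertices]
  exact Nat.lt_succ_self _

/-- In a smallest set at most one pair of twins fails to be a direct contraction, so a snail vertex
or a full matching of two regular vertices is an elementary snail or melon with at most one
propagator cut. In the remaining case the triangle must be contracted completely. -/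
theorem IsMaximal.isReducible (h : D.IsMaximal) [Nonempty D.V] : D.IsReducible := by
  obtain ⟨hD, hc⟩ := h.isPlanar
  obtain ⟨S, hS⟩ := D.exists_isSmallest
  by_cases hsn : ∃ v ∈ S, ∃ s, D.IsSnailVertex v s
  · obtain ⟨v, hv, s, hs, ht⟩ := hsn
    have hA : {v} ⊆ S := Set.singleton_subset_iff.2 hv
    have : ∃ a, ∀ i, i ≠ a → i ≠ s a → D.wick (v, i) = (v, s i) := by
      by_cases hn : ∃ a, D.wick (v, a) ≠ (v, s a)
      · obtain ⟨a, ha⟩ := hn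
        refine ⟨a, fun i h1 h2 => ?_⟩
        by_contra hi
        rcases hS.twin_unique hD.conn hA (ht a) (ht i) ha hi with e | e
        · exact h1 (congrArg Prod.snd e)
        · exact h2 (congrArg Prod.snd e)
      · exact ⟨0, fun i _ _ => by_contra fun hi => hn ⟨i, hi⟩⟩
    obtain ⟨a, ha⟩ := this
    exact isReducible_of_snail h hc hs ha
  have hreg : ∀ v ∈ S, D.IsRegular v := fun v hv =>
    (hD.isRegular_or_snail v).resolve_right fun hs => hsn ⟨v, hv, hs⟩
  obtain ⟨c, L, R, x, y, hop, hL, hR, hLR, h1, h2⟩ := hS.exists_two_cycle hD hreg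
  have hA : {L, R} ⊆ S := by rintro _ (rfl | rfl) <;> assumption
  have hxz := (edge_ne (D.kind L) c x).symm
  rcases hD.two_cycle hLR (hreg L hL) (hreg R hR) hxz h1 h2 with
    ⟨ρ, hρ, he⟩ | ⟨t, t', htx, htz, ht, he⟩
  · have hinj : Function.Injective ρ := fun i j e => by
      have := hρ j
      rw [← e] at this
      exact congrArg Prod.snd ((hρ i).symm.unique this.symm)
    let ρ' : Perm Field6 := Equiv.ofBijective ρ (Finite.injective_iff_bijective.1 hinj)
    have he' : ∀ c i, ρ' (edge (D.kind L) c i) = edge (D.kind R) c (ρ' i) := he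
    have hkk : D.kind L = D.kind R := by
      rcases hkL : D.kind L <;> rcases hkR : D.kind R
      · rfl
      · rw [hkL, hkR] at he
        exact (prism_not_iso_wheel ρ hinj he).elim
      · rw [hkL, hkR] at he'
        refine (prism_not_iso_wheel ρ'.symm ρ'.symm.injective fun c i => ?_).elim
        rw [ρ'.symm_apply_eq, he', ρ'.apply_symm_apply]
      · rfl
    have hau : IsAutomorphism (D.kind R) ρ' := fun c => by
      ext i
      have := he' c (ρ'⁻¹ i)
      rw [hkk] at this
      simpa using congrArg Fin.val this
    have : ∃ a, ∀ i, i ≠ a → D.wick (L, i) = (R, ρ' i) := by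
      by_cases hn : ∃ a, D.wick (L, a) ≠ (R, ρ a)
      · obtain ⟨a, ha⟩ := hn
        refine ⟨a, fun i hi => ?_⟩
        by_contra hi'
        rcases hS.twin_unique hD.conn hA (hρ a) (hρ i) ha hi' with e | e
        · exact hi (congrArg Prod.snd e)
        · exact hLR (congrArg Prod.fst e)
      · exact ⟨0, fun i _ => by_contra fun hi => hn ⟨i, hi⟩⟩
    obtain ⟨a, ha⟩ := this
    exact isReducible_of_melon h hc hLR hkk hau ha
  · have hyw := (edge_ne (D.kind R) c y).symm
    have hkL : D.kind L = prism := by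
      by_contra hk
      have hk : D.kind L = wheel := by cases hk' : D.kind L <;> tauto
      rw [hk] at he hxz
      exact wheel_no_triangle x _ t hxz fun c => by have := he c; tauto
    have hkR : D.kind R = prism := by
      by_contra hk
      have hk : D.kind R = wheel := by cases hk' : D.kind R <;> tauto
      rw [hk] at he hyw
      exact wheel_no_triangle y _ t' hyw fun c => by have := he c; tauto
    -- Otherwise the subgraph joining the third legs is the complement of `S`, and the legs of `S`
    -- are `(L, t)` and `(R, t')`. The 2-cycle would be opposite to a leg in the triangle, against
    -- the choice of the colour.
    have h3 : D.wick (L, t) = (R, t') := by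
      by_contra hn
      obtain ⟨-, a1, b1, c1⟩ := ht
      obtain ⟨K, k1, k2, k3⟩ := c1.resolve_left hn
      obtain ⟨-, hSK⟩ := hS.compl_subset hD.conn hA a1 b1 k2 k3
      have hKS : Kᶜ ⊆ S := Set.compl_subset_comm.1 hSK
      have hKc : Kᶜ = S := Set.eq_of_subset_of_ncard_le hKS (hS.le _
        ⟨L, fun hLK => Set.disjoint_left.1 k2 hLK (Or.inl rfl)⟩
        (by rw [ncard_legs_compl, k3]; exact ncard_pair_le _ _))
      have hlegs : D.legs S = {(L, t), (R, t')} := by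
        rw [← hKc, legs_compl, k3, Set.image_pair, D.wick_wick, D.wick_wick]
      obtain ⟨g, hg, hop⟩ := hop (L, t) (by rw [hlegs]; exact Or.inl rfl)
      rw [hlegs] at hg
      rcases hg with rfl | rfl
      · obtain ⟨c', hc'⟩ := hop x
        have := he c'
        tauto
      · obtain ⟨c', hc'⟩ := hop y
        have := he c'
        tauto
    rw [hkL] at hxz htz h2
    rw [hkR] at h2
    rw [hkL, hkR] at he
    exact isReducible_of_triangle h hLR hkL hkR hxz htx htz he h1 h2 h3

end Diagram

theorem melonic_of_isMaximal {D : Diagram} (h : D.IsMaximal) : Melonic D := by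
  induction hn : D.numVertices using Nat.strong_induction_on generalizing D with
  | _ n ih =>
    by_cases hV : Nonempty D.V
    · obtain ⟨D', h1, h2, h3⟩ := h.isReducible
      exact h3 (ih _ (hn ▸ h2) h1 rfl)
    · refine .zeroCycle D (h.1.resolve_right fun h => hV h.1)

/-! ### The forms of mixed 2-cycles -/

theorem IsColourSymmetry.edge_apply {k : Interaction} {π : Perm Colour} {α : Perm Field6}
    (h : IsColourSymmetry k π α) (c : Colour) (i : Field6) :
    edge k (π c) (α i) = α (edge k c i) := by
  rw [← h c]; simp

theorem IsColourSymmetry.mul {k : Interaction} {π π' : Perm Colour} {α α' : Perm Field6}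
    (h : IsColourSymmetry k π α) (h' : IsColourSymmetry k π' α') :
    IsColourSymmetry k (π * π') (α * α') := fun c => by
  rw [Perm.mul_apply, ← h, ← h']
  group

theorem EquivalentMixed.trans {x y z w x' y' z' w' x'' y'' z'' w'' : Field6}
    (h : EquivalentMixed x y z w x' y' z' w') (h' : EquivalentMixed x' y' z' w' x'' y'' z'' w'') :
    EquivalentMixed x y z w x'' y'' z'' w'' := by
  obtain ⟨π, α, β, h1, h2, rfl, rfl, rfl, rfl⟩ := h
  obtain ⟨π', α', β', h1', h2', rfl, rfl, rfl, rfl⟩ := h'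
  exact ⟨π' * π, α' * α, β' * β, h1'.mul h1, h2'.mul h2, rfl, rfl, rfl, rfl⟩

open Classical in
/-- The form of a mixed 2-cycle in terms of adjacency in the interaction graphs. -/
noncomputable def mixedForm (x y z w : Field6) : MixedForm :=
  if ∀ c, edge prism c x ≠ z then .form2
  else if ∃ a b, edge prism a (edge prism b x) = z then .form1
  else if ∀ c, edge wheel c y ≠ w then .form4
  else if ∃ c, edge prism c x = z ∧ edge wheel c y = w then .form5
  else .form3

/-- All conditions quantify over colours, so a common permutation of the colours does not matter. In
the prism, non-adjacent fields give form (2) and a side of a triangle form (1). On a rung the wheel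
fields are non-adjacent in form (4), joined by the colour of the rung in form (5), and by another
colour in form (3). -/
theorem EquivalentMixed.mixedForm_eq {x y z w x' y' z' w' : Field6}
    (h : EquivalentMixed x y z w x' y' z' w') : mixedForm x y z w = mixedForm x' y' z' w' := by
  obtain ⟨π, α, β, h1, h2, rfl, rfl, rfl, rfl⟩ := h
  have e1 : (∀ c, edge prism c (α x) ≠ α z) ↔ ∀ c, edge prism c x ≠ z := by
    refine (π.forall_congr_right (q := fun c => edge prism c (α x) ≠ α z)).symm.trans ?_
    simp only [h1.edge_apply, ne_eq, EmbeddingLike.apply_eq_iff_eq]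
  have e2 : (∃ a b, edge prism a (edge prism b (α x)) = α z) ↔
      ∃ a b, edge prism a (edge prism b x) = z := by
    refine (π.exists_congr_right
      (q := fun a => ∃ b, edge prism a (edge prism b (α x)) = α z)).symm.trans
      (exists_congr fun a => ?_)
    refine (π.exists_congr_right
      (q := fun b => edge prism (π a) (edge prism b (α x)) = α z)).symm.trans ?_
    simp only [h1.edge_apply, EmbeddingLike.apply_eq_iff_eq]
  have e3 : (∀ c, edge wheel c (β y) ≠ β w) ↔ ∀ c, edge wheel c y ≠ w := by
    refine (π.forall_congr_right (q := fun c => edge wheel c (β y) ≠ β w)).symm.trans ?_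
    simp only [h2.edge_apply, ne_eq, EmbeddingLike.apply_eq_iff_eq]
  have e4 : (∃ c, edge prism c (α x) = α z ∧ edge wheel c (β y) = β w) ↔
      ∃ c, edge prism c x = z ∧ edge wheel c y = w := by
    refine (π.exists_congr_right
      (q := fun c => edge prism c (α x) = α z ∧ edge wheel c (β y) = β w)).symm.trans ?_
    simp only [h1.edge_apply, h2.edge_apply, EmbeddingLike.apply_eq_iff_eq]
  rw [mixedForm, mixedForm]
  simp only [e1, e2, e3, e4]

theorem HasForm.mixedForm_eq {x y z w : Field6} {n : MixedForm} (h : HasForm x y z w n) :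
    mixedForm x y z w = n := by
  have e1 : ¬ ∀ c, edge prism c 1 ≠ 6 := by decide
  have e2 : ¬ ∃ a b, edge prism a (edge prism b 1) = 6 := by decide
  cases n with
  | form1 =>
    obtain ⟨W, h⟩ := h
    rw [h.mixedForm_eq, mixedForm, if_neg (by decide), if_pos (by decide)]
  | form2 =>
    obtain ⟨W, h⟩ := h
    rw [h.mixedForm_eq, mixedForm, if_pos (by decide)]
  | form3 =>
    rw [EquivalentMixed.mixedForm_eq h, mixedForm, if_neg e1, if_neg e2, if_neg (by decide),
      if_neg (by decide)]
  | form4 =>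
    rw [EquivalentMixed.mixedForm_eq h, mixedForm, if_neg e1, if_neg e2, if_pos (by decide)]
  | form5 =>
    rw [EquivalentMixed.mixedForm_eq h, mixedForm, if_neg e1, if_neg e2, if_neg (by decide),
      if_pos (by decide)]

/-- The colour permutation symmetries of the prism. -/
def prismSymmetries : List (Perm Colour × Perm Field6) := do
  let f ← [(1, 1), (swap green blue, swap 2 3 * swap 4 5)]
  let g ← [(1, 1), (swap red green, swap 1 3 * swap 4 6), (swap red blue, swap 1 2 * swap 5 6)]
  let h ← [(1, 1), (1, snailPairing prism)]
  return f * g * h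

theorem exists_prism_symmetry (x z : Field6) (h : x ≠ z) : ∃ p ∈ prismSymmetries,
    IsColourSymmetry prism p.1 p.2 ∧ p.2 x = 1 ∧ (p.2 z = 2 ∨ p.2 z = 4 ∨ p.2 z = 6) := by
  revert x z; decide +kernel

theorem exists_wheel_automorphism (y : Field6) :
    ∃ β ∈ [1, wheelRotation, wheelRotation⁻¹, snailPairing wheel,
      wheelRotation * snailPairing wheel, wheelRotation⁻¹ * snailPairing wheel],
      IsAutomorphism wheel β ∧ β y = 1 := by
  revert y; decide +kernel

/-- The symmetry used to normalize the prism fields permutes the colours; the wheel has to follow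
with the same permutation while keeping the field 1 in place. -/
theorem exists_wheel_symmetry (π : Perm Colour) :
    ∃ β ∈ [1, swap 2 4 * swap 3 5, swap 2 6 * swap 3 5, swap 2 4 * swap 3 5 * (swap 2 6 * swap 3 5),
      swap 2 6 * swap 3 5 * (swap 2 4 * swap 3 5),
      swap 2 4 * swap 3 5 * (swap 2 6 * swap 3 5) * (swap 2 4 * swap 3 5)],
      IsColourSymmetry wheel π β ∧ β 1 = 1 := by
  revert π; decide +kernel

theorem exists_hasForm {x y z w : Field6} (hxz : x ≠ z) (hyw : y ≠ w) : ∃ n, HasForm x y z w n := by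
  obtain ⟨⟨π, α⟩, -, hα, hx, hz⟩ := exists_prism_symmetry x z hxz
  obtain ⟨β, -, hβ, hy⟩ := exists_wheel_automorphism y
  obtain ⟨γ, -, hγ, h1⟩ := exists_wheel_symmetry π
  have he : EquivalentMixed x y z w 1 1 (α z) ((γ * β) w) :=
    ⟨π, α, γ * β, hα, by simpa using hγ.mul hβ, hx, by rw [Perm.mul_apply, hy, h1], rfl, rfl⟩
  have hw : (γ * β) w ≠ 1 := by
    rw [← h1, ← hy, Perm.mul_apply, Ne, γ.injective.eq_iff, β.injective.eq_iff]
    exact hyw.symm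
  rcases hz with hz | hz | hz <;> rw [show α z = _ from hz] at he
  · exact ⟨.form1, _, he⟩
  · exact ⟨.form2, _, he⟩
  -- Exchanging green and blue still fixes the fields 1, 6 of the prism and 1 of the wheel. It
  -- identifies the wheel fields 2 with 4 and 3 with 5.
  · obtain ⟨α', -, β', -, h⟩ : ∃ α' ∈ [1, swap 2 3 * swap 4 5], ∃ β' ∈ [1, swap 2 4 * swap 3 5],
        ∃ π ∈ [1, swap green blue], IsColourSymmetry prism π α' ∧ IsColourSymmetry wheel π β' ∧
          α' 1 = 1 ∧ β' 1 = 1 ∧ α' 6 = 6 ∧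
          (β' ((γ * β) w) = 2 ∨ β' ((γ * β) w) = 3 ∨ β' ((γ * β) w) = 6) := by
      clear he
      revert hw; generalize (γ * β) w = v; revert v; decide +kernel
    obtain ⟨π', -, h1, h2, h3, h4, h5, h | h | h⟩ := h
    · exact ⟨.form3, he.trans ⟨π', α', β', h1, h2, h3, h4, h5, h⟩⟩
    · exact ⟨.form4, he.trans ⟨π', α', β', h1, h2, h3, h4, h5, h⟩⟩
    · exact ⟨.form5, he.trans ⟨π', α', β', h1, h2, h3, h4, h5, h⟩⟩

theorem existsUnique_hasForm {x y z w : Field6} (hxz : x ≠ z) (hyw : y ≠ w) :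
    ∃! n, HasForm x y z w n := by
  obtain ⟨n, hn⟩ := exists_hasForm hxz hyw
  exact ⟨n, hn, fun m hm => hm.mixedForm_eq.symm.trans hn.mixedForm_eq⟩

theorem IsSnailPairing.exists_edge {k : Interaction} {s : Perm Field6} (h : IsSnailPairing k s)
    (i : Field6) : ∃ c, edge k c i = s i := by
  obtain ⟨α, hα, rfl⟩ := h
  obtain ⟨i, rfl⟩ := α.surjective i
  obtain ⟨c, hc⟩ : ∃ c, edge k c i = snailPairing k i := by
    clear hα; revert k i; decide
  exact ⟨c, by rw [edge_of_isAutomorphism hα, hc]; simp⟩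

/-- The pairs are the rungs of the prism, and a rung lies on no triangle. -/
theorem IsSnailPairing.edge_edge_ne {s : Perm Field6} (h : IsSnailPairing prism s)
    (i : Field6) (a b : Colour) : edge prism a (edge prism b i) ≠ s i := by
  obtain ⟨α, hα, rfl⟩ := h
  obtain ⟨i, rfl⟩ := α.surjective i
  rw [edge_of_isAutomorphism hα, edge_of_isAutomorphism hα]
  have : edge prism a (edge prism b i) ≠ snailPairing prism i := by revert i a b; decide
  simpa using this

theorem IsSnailPairing.ne {k : Interaction} {s : Perm Field6} (h : IsSnailPairing k s)
    (i : Field6) : s i ≠ i := by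
  obtain ⟨c, hc⟩ := h.exists_edge i
  rw [← hc]
  exact edge_ne k c i

theorem isSnailPairing_prism : IsSnailPairing prism (snailPairing prism) :=
  ⟨1, isAutomorphism_one _, by simp⟩

theorem exists_isSnailPairing_wheel (y : Field6) (c : Colour) :
    ∃ t, IsSnailPairing wheel t ∧ t y = edge wheel c y := by
  obtain ⟨α, -, h1, h2⟩ : ∃ α ∈ [1, wheelRotation, wheelRotation⁻¹], IsAutomorphism wheel α ∧
      (α * snailPairing wheel * α⁻¹) y = edge wheel c y := by
    revert y c; decide +kernel
  exact ⟨_, ⟨α, h1, rfl⟩, h2⟩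

/-- The forms (3) and (5) are those for which both pairs of fields belong to snail pairings. -/
theorem hasForm_three_or_five_iff {x y z w : Field6} :
    HasForm x y z w .form3 ∨ HasForm x y z w .form5 ↔
      (∃ s, IsSnailPairing prism s ∧ s x = z) ∧ ∃ t, IsSnailPairing wheel t ∧ t y = w := by
  constructor
  · intro h
    have h : mixedForm x y z w = .form3 ∨ mixedForm x y z w = .form5 :=
      h.imp HasForm.mixedForm_eq HasForm.mixedForm_eq
    by_cases h1 : ∀ c, edge prism c x ≠ z
    · rw [mixedForm, if_pos h1] at h
      rcases h with h | h <;> cases h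
    by_cases h2 : ∃ a b, edge prism a (edge prism b x) = z
    · rw [mixedForm, if_neg h1, if_pos h2] at h
      rcases h with h | h <;> cases h
    by_cases h3 : ∀ c, edge wheel c y ≠ w
    · rw [mixedForm, if_neg h1, if_neg h2, if_pos h3] at h
      rcases h with h | h <;> cases h
    refine ⟨⟨_, isSnailPairing_prism, ?_⟩, ?_⟩
    · clear h h3
      clear * - h1 h2
      revert x z; decide
    · obtain ⟨c, rfl⟩ := not_forall_not.1 h3
      exact exists_isSnailPairing_wheel y c
  · rintro ⟨⟨s, hs, rfl⟩, t, ht, rfl⟩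
    obtain ⟨n, hn⟩ := exists_hasForm (hs.ne x).symm (ht.ne y).symm
    have h := hn.mixedForm_eq
    rw [mixedForm, if_neg (not_forall_not.2 (hs.exists_edge x)),
      if_neg fun ⟨a, b, e⟩ => hs.edge_edge_ne x a b e,
      if_neg (not_forall_not.2 (ht.exists_edge y))] at h
    split_ifs at h
    · exact Or.inr (h ▸ hn)
    · exact Or.inl (h ▸ hn)

/-! ### Maximal diagrams with mixed 2-cycles -/

/-- The ends of the cut propagators of the two snails in `doubleSnail`. -/
def doubleSnailLeg (p q : Field6) (b : Bool) : Field6 := bif b then q else p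

/-- The interactions of the two vertices of `doubleSnail`. -/
def doubleSnailKind (b : Bool) : Interaction := bif b then wheel else prism

/-- The contractions of `doubleSnail`. -/
def doubleSnailWick (p q : Field6) (h : Bool × Field6) : Bool × Field6 :=
  if h.2 = doubleSnailLeg p q h.1 then (!h.1, doubleSnailLeg p q !h.1)
  else if h.2 = snailPairing (doubleSnailKind h.1) (doubleSnailLeg p q h.1) then
    (!h.1, snailPairing (doubleSnailKind !h.1) (doubleSnailLeg p q !h.1))
  else (h.1, snailPairing (doubleSnailKind h.1) h.2)

/-- An elementary wheel snail inserted into the closed elementary prism snail. -/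
def doubleSnail (p q : Field6) : Diagram where
  V := Bool
  finite := inferInstance
  kind := doubleSnailKind
  wick := doubleSnailWick p q
  wick_wick := by revert p q; decide +kernel
  wick_ne := by revert p q; decide +kernel
  circles := 0

theorem closedSnail_isMaximal (k : Interaction) : (closedSnail k).IsMaximal :=
  have h := closedSnail_isInsertable k
  Diagram.isMaximal_iff.2 ⟨Diagram.connected_iff.2 (Or.inr ⟨h.circles, h.conn⟩), h.fTotal⟩

theorem doubleSnail_isMaximal (p q : Field6) : (doubleSnail p q).IsMaximal := by
  refine (ReplacesPropagator.isMaximal_iff (D := closedSnail prism)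
    (D' := doubleSnail p q) (closedSnail_isInsertable wheel) ⟨Equiv.boolEquivPUnitSumPUnit.symm,
      fun _ => rfl, fun _ => rfl, Or.inl ⟨rfl, ((), p), ((), q), ?_, ?_, ?_, ?_⟩⟩).1 (closedSnail_isMaximal prism)
  · exact if_pos rfl
  · exact (if_neg (snailPairing_ne _ _)).trans (if_pos rfl)
  · rintro ⟨⟨⟩, i⟩ h1 h2
    exact (if_neg fun e => h1 (Prod.ext rfl e)).trans (if_neg fun e => h2 (Prod.ext rfl e))
  · rintro ⟨⟨⟩, i⟩ h1 h2
    exact (if_neg fun e => h1 (Prod.ext rfl e)).trans (if_neg fun e => h2 (Prod.ext rfl e))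

/-- The cut propagators of the two snails can be chosen freely, and automorphisms of the two
vertices turn the standard snail pairings into any others. -/
theorem exists_isMixedTwoCycle {x y : Field6} {s t : Perm Field6} (hs : IsSnailPairing prism s)
    (ht : IsSnailPairing wheel t) : ∃ (D : Diagram) (L R : D.V), D.IsMaximal ∧
      D.IsMixedTwoCycle L R x y (s x) (t y) := by
  have hne := hs.ne x
  obtain ⟨α, hα, rfl⟩ := hs
  obtain ⟨β, hβ, rfl⟩ := ht
  obtain ⟨x, rfl⟩ := α.surjective x
  obtain ⟨y, rfl⟩ := β.surjective y
  let γ (b : (doubleSnail x y).V) : Perm Field6 := bif b then β else α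
  have h1 : (doubleSnail x y).wick (false, x) = (true, y) := if_pos rfl
  have h2 : (doubleSnail x y).wick (false, snailPairing prism x) = (true, snailPairing wheel y) :=
    (if_neg (snailPairing_ne _ _)).trans (if_pos rfl)
  refine ⟨(doubleSnail x y).relabel γ, false, true,
    (Same.isMaximal_iff (relabel_same γ ?_)).2 (doubleSnail_isMaximal x y), rfl, rfl, hne.symm,
    relabel_wick γ h1, ?_⟩
  · rintro (_ | _)
    · exact hα
    · exact hβ
  · have := relabel_wick γ h2
    rwa [show (α * snailPairing prism * α⁻¹) (α x) = α (snailPairing prism x) by simp,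
      show (β * snailPairing wheel * β⁻¹) (β y) = β (snailPairing wheel y) by simp]

end PrismWheel

theorem mainTheorem8 :
    -- every mixed 2-cycle falls under exactly one of the five forms
    (∀ x y z w : PrismWheel.Field6, x ≠ z → y ≠ w → ∃! n, PrismWheel.HasForm x y z w n) ∧
    -- the allowed 1-cycles are those of the two separate theories: they are snails
    (∀ D : PrismWheel.Diagram, D.IsMaximal → ∀ (v : D.V) (x y : PrismWheel.Field6),
      D.IsOneCycle v x y → D.IsSnailForm v x y) ∧
    -- a mixed 2-cycle of a maximal diagram is of the third or fifth form, is a double snail, and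
    -- yields no elementary melon
    (∀ D : PrismWheel.Diagram, D.IsMaximal → ∀ (L R : D.V) (x y z w : PrismWheel.Field6),
      D.IsMixedTwoCycle L R x y z w →
        (PrismWheel.HasForm x y z w .form3 ∨ PrismWheel.HasForm x y z w .form5) ∧
        D.IsDoubleSnail L R x y z w ∧ ¬ D.IsMelonForm L R x y z w) ∧
    -- the third and fifth forms occur in maximal diagrams
    (∀ x y z w : PrismWheel.Field6,
      (PrismWheel.HasForm x y z w .form3 ∨ PrismWheel.HasForm x y z w .form5) →
        ∃ (D : PrismWheel.Diagram) (L R : D.V), D.IsMaximal ∧ D.IsMixedTwoCycle L R x y z w) ∧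
    -- the maximal diagrams are exactly those generated by the moves of the separate theories
    (∀ D : PrismWheel.Diagram, D.IsMaximal ↔ PrismWheel.Melonic D) := by
  refine ⟨fun x y z w => PrismWheel.existsUnique_hasForm, ?_, ?_, ?_, ?_⟩
  · intro D hD v x y h
    have : Nonempty D.V := ⟨v⟩
    exact hD.isPlanar.1.isSnailForm h
  · intro D hD L R x y z w h
    have : Nonempty D.V := ⟨L⟩
    obtain ⟨s, t, hs, ht⟩ := hD.isPlanar.1.mixedTwoCycle h
    obtain ⟨h1, h2, h3⟩ := h.isDoubleSnail hs ht
    obtain ⟨hL, hR, -⟩ := h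
    exact ⟨PrismWheel.hasForm_three_or_five_iff.2
      ⟨⟨s, hL ▸ hs.1, h1⟩, t, hR ▸ ht.1, h2⟩, h3⟩
  · intro x y z w h
    obtain ⟨⟨s, hs, rfl⟩, t, ht, rfl⟩ := PrismWheel.hasForm_three_or_five_iff.1 h
    exact PrismWheel.exists_isMixedTwoCycle hs ht
  · exact fun D => ⟨PrismWheel.melonic_of_isMaximal, fun h => h.isMaximal⟩
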